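/- Let $\mathfrak g=\mathfrak{spin}(3,1)_{\mathbb C}$ be the complex Lie algebra with basis $J_0,J_1,J_2,K_0,K_1,K_2$ and brackets $[J_a,J_b]=i\varepsilon_{abc}J_c$, $[J_a,K_b]=i\varepsilon_{abc}K_c$, $[K_a,K_b]=-i\varepsilon_{abc}J_c$; put $J_\pm=J_1\pm iJ_2$, $K_\pm=K_1\pm iK_2$. Its Casimirs are $\mathcal C_1=\vec J\cdot\vec K$ and $\mathcal C_2=\vec J\cdot\vec J-\vec K\cdot\vec K$. For a half-integer $j\ge 0$ let $\mathcal M_j=\{-j,-j+1,\dots,j\}$ and $C_\pm(j,m)=\sqrt{j\mp m}\,\sqrt{j\pm m+1}$. For $\gamma\in\{\tfrac12,1,\tfrac32,\dots\}$ and $A\in\{1,-1\}$ let $F^A_\gamma$ be the $\mathfrak g$-module with basis $|\mu\rangle$, $\mu\in\mathcal M_\gamma$, and $$J_0|\mu\rangle=\mu|\mu\rangle,\quad J_\pm|\mu\rangle=C_\pm(\gamma,\mu)|\mu\pm1\rangle,\quad K_0|\mu\rangle=iA\mu|\mu\rangle,\quad K_\pm|\mu\rangle=iA\,C_\pm(\gamma,\mu)|\mu\pm1\rangle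 .$$ For $\lambda\in\tfrac12\mathbb Z$ and $\rho\in\mathbb C$ put $$P^-_{\lambda,\rho}(j)=\frac{\sqrt{j+\lambda}\sqrt{j-\lambda}\sqrt{j+\rho}\sqrt{j-\rho}}{j\sqrt{2j+1}\sqrt{2j-1}},\quad P^+_{\lambda,\rho}(j)=P^-_{\lambda,\rho}(j+1),\quad P_{\lambda,\rho}(j)=\frac{i\lambda\rho}{j(j+1)}\ (j\ne0),\quad P_{\lambda,\rho}(0)=0,$$ with principal square roots and $P^-_{\lambda,\rho}(|\lambda|):=0$. Let $V_{\lambda,\rho}$ be the $\mathfrak g$-module with basis $|j,m\rangle$, where $j$ runs over $|\lambda|,|\lambda|+1,\dots$ up to and including the first $j$ with $P^+_{\lambda,\rho}(j)=0$ (and over all of $|\lambda|+\mathbb N_0$ if there is none), $m\in\mathcal M_j$, and $$J_0|j,m\rangle=m|j,m\rangle,\qquad J_\pm|j,m\rangle=C_\pm(j,m)|j,m\pm1\rangle,$$ $$K_0|j,m\rangle=P^+_{\lambda,\rho}(j)\sqrt{j+m+1}\sqrt{j-m+1}\,|j{+}1,m\rangle+P_{\lambda,\rho}(j)\,m\,|j,m\rangle+P^-_{\lambda,\rho}(j)\sqrt{j+m}\sqrt{j-m}\,|j{-}1,m\rangle,$$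 $$K_\pm|j,m\rangle=\mp P^+_{\lambda,\rho}(j)\sqrt{j\pm m+1}\sqrt{j\pm m+2}\,|j{+}1,m{\pm}1\rangle+P_{\lambda,\rho}(j)C_\pm(j,m)|j,m{\pm}1\rangle\pm P^-_{\lambda,\rho}(j)\sqrt{j\mp m}\sqrt{j\mp m-1}\,|j{-}1,m{\pm}1\rangle,$$ vectors outside the basis being read as $0$. Let $\gamma\ge\tfrac12$ be a half-integer, $A=\pm1$, $\lambda\in\tfrac12\mathbb Z$, $\rho\in\mathbb C$, and suppose that $V_{\lambda,\rho}$ is infinite-dimensional. Then the Casimirs $\mathcal C_1$ and $\mathcal C_2$ are simultaneously diagonalisable on $F^A_\gamma\otimes V_{\lambda,\rho}$ (there is a basis of common eigenvectors) if and only if $\rho+A\lambda\notin(-2\gamma,2\gamma)\cap\mathbb Z$. If $\rho+A\lambda\notin(-2\gamma,2\gamma)\cap\mathbb Z$, then the pairs of joint eigenvalues of $(\mathcal C_1,\mathcal C_2)$ are exactly $\bigl(i\Lambda\mathrm P,\ \Lambda^2+\mathrm P^2-1\bigr)$ with $(\Lambda,\mathrm P)=(\lambda+\nu,\rho+A\nu)$,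 $\nu\in\mathcal M_\gamma$, and $$F^A_\gamma\otimes V_{\lambda,\rho}\;\cong\;\bigoplus_{\nu\in\mathcal M_\gamma}V_{\lambda+\nu,\,\rho+A\nu}$$ as $\mathfrak g$-modules (an algebraic direct sum, not claimed to be orthogonal). If $\rho+A\lambda\in(-2\gamma,2\gamma)\cap\mathbb Z$, then neither $\mathcal C_1$ nor $\mathcal C_2$ is diagonalisable on $F^A_\gamma\otimes V_{\lambda,\rho}$. -/

import Mathlib

open scoped TensorProduct DirectSum

namespace SpinCG

/-! ### The complexified Lie algebra of `Spin(3,1)` -/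

/-- The complexified Lie algebra `𝔰𝔭𝔦𝔫(3,1)_ℂ`: the pair `(u, w)` stands for
`∑ a, u a • J a + ∑ a, w a • K a`. -/
def Spin31 : Type := (Fin 3 → ℂ) × (Fin 3 → ℂ)

noncomputable section

namespace Spin31

instance : AddCommGroup Spin31 := inferInstanceAs (AddCommGroup ((Fin 3 → ℂ) × (Fin 3 → ℂ)))
instance : Module ℂ Spin31 := inferInstanceAs (Module ℂ ((Fin 3 → ℂ) × (Fin 3 → ℂ)))

/-- The rotation coordinates. -/
def rot : Spin31 →ₗ[ℂ] (Fin 3 → ℂ) := LinearMap.fst ℂ _ _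
/-- The boost coordinates. -/
def boost : Spin31 →ₗ[ℂ] (Fin 3 → ℂ) := LinearMap.snd ℂ _ _
/-- The element with given rotation and boost coordinates. -/
def mk (u w : Fin 3 → ℂ) : Spin31 := (u, w)

@[simp] theorem rot_mk (u w : Fin 3 → ℂ) : rot (mk u w) = u := rfl
@[simp] theorem boost_mk (u w : Fin 3 → ℂ) : boost (mk u w) = w := rfl

theorem ext' {x y : Spin31} (h : rot x = rot y) (h' : boost x = boost y) : x = y :=
  Prod.ext h h'

/-- The rotation generators `J 0, J 1, J 2`. -/
def J (a : Fin 3) : Spin31 := mk (Pi.single a 1) 0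
/-- The boost generators `K 0, K 1, K 2`. -/
def K (a : Fin 3) : Spin31 := mk 0 (Pi.single a 1)

/-- The bracket with `[J_a, J_b] = i ε_{abc} J_c`, `[J_a, K_b] = i ε_{abc} K_c`,
`[K_a, K_b] = - i ε_{abc} J_c`. -/
instance : Bracket Spin31 Spin31 where
  bracket x y := mk
    (Complex.I • (crossProduct (rot x) (rot y) - crossProduct (boost x) (boost y)))
    (Complex.I • (crossProduct (rot x) (boost y) + crossProduct (boost x) (rot y)))

theorem rot_lie (x y : Spin31) : rot ⁅x, y⁆ =
    Complex.I • (crossProduct (rot x) (rot y) - crossProduct (boost x) (boost y)) := rfl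
theorem boost_lie (x y : Spin31) : boost ⁅x, y⁆ =
    Complex.I • (crossProduct (rot x) (boost y) + crossProduct (boost x) (rot y)) := rfl

instance : LieRing Spin31 where
  add_lie x y z := by
    apply ext' <;> simp only [rot_lie, boost_lie, map_add, LinearMap.add_apply] <;> module
  lie_add x y z := by
    apply ext' <;> simp only [rot_lie, boost_lie, map_add] <;> module
  lie_self x := by
    apply ext'
    · simp [rot_lie]
    · rw [boost_lie, cross_anticomm']; simp
  leibniz_lie x y z := by
    apply ext' <;> simp only [rot_lie, boost_lie, map_add, map_sub, map_smul,
      LinearMap.add_apply, LinearMap.sub_apply, LinearMap.smul_apply] <;>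
    simp only [leibniz_cross (rot x), leibniz_cross (boost x)] <;> module

instance : LieAlgebra ℂ Spin31 where
  lie_smul t x y := by
    apply ext' <;> simp only [rot_lie, boost_lie, map_smul] <;> module

end Spin31

/-- `∑ a, u a • J a + ∑ a, w a • K a` acting through operators `J₀, J₊, J₋, K₀, K₊, K₋`, where
`J₊ = J₁ + i J₂`, `J₋ = J₁ - i J₂`, and likewise for `K`. -/
def actionOfLadder {M : Type} [AddCommGroup M] [Module ℂ M]
    (J0 Jp Jm K0 Kp Km : Module.End ℂ M) (x : Spin31) : Module.End ℂ M :=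
  (x.rot 0 • J0 + x.rot 1 • ((1 / 2 : ℂ) • (Jp + Jm))
      + x.rot 2 • ((-Complex.I / 2) • (Jp - Jm)))
    + (x.boost 0 • K0 + x.boost 1 • ((1 / 2 : ℂ) • (Kp + Km))
      + x.boost 2 • ((-Complex.I / 2) • (Kp - Km)))

theorem actionOfLadder_add {M : Type} [AddCommGroup M] [Module ℂ M]
    (J0 Jp Jm K0 Kp Km : Module.End ℂ M) (x y : Spin31) :
    actionOfLadder J0 Jp Jm K0 Kp Km (x + y)
      = actionOfLadder J0 Jp Jm K0 Kp Km x + actionOfLadder J0 Jp Jm K0 Kp Km y := by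
  simp only [actionOfLadder, map_add, Pi.add_apply]; module

theorem actionOfLadder_smul {M : Type} [AddCommGroup M] [Module ℂ M]
    (J0 Jp Jm K0 Kp Km : Module.End ℂ M) (t : ℂ) (x : Spin31) :
    actionOfLadder J0 Jp Jm K0 Kp Km (t • x) = t • actionOfLadder J0 Jp Jm K0 Kp Km x := by
  simp only [actionOfLadder, map_smul, Pi.smul_apply, smul_eq_mul]; module

/-- The commutation relations of `𝔰𝔭𝔦𝔫(3,1)_ℂ` in terms of the ladder operators. -/
structure LadderRelations {M : Type} [AddCommGroup M] [Module ℂ M]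
    (J0 Jp Jm K0 Kp Km : Module.End ℂ M) : Prop where
  j0p : J0 * Jp - Jp * J0 = Jp
  j0m : J0 * Jm - Jm * J0 = -Jm
  jpm : Jp * Jm - Jm * Jp = (2 : ℂ) • J0
  j0k0 : J0 * K0 - K0 * J0 = 0
  j0kp : J0 * Kp - Kp * J0 = Kp
  j0km : J0 * Km - Km * J0 = -Km
  jpk0 : Jp * K0 - K0 * Jp = -Kp
  jmk0 : Jm * K0 - K0 * Jm = Km
  jpkp : Jp * Kp - Kp * Jp = 0
  jmkm : Jm * Km - Km * Jm = 0
  jpkm : Jp * Km - Km * Jp = (2 : ℂ) • K0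
  jmkp : Jm * Kp - Kp * Jm = -(2 : ℂ) • K0
  k0p : K0 * Kp - Kp * K0 = -Jp
  k0m : K0 * Km - Km * K0 = Jm
  kpm : Kp * Km - Km * Kp = -(2 : ℂ) • J0

theorem LadderRelations.map_lie {M : Type} [AddCommGroup M] [Module ℂ M]
    {J0 Jp Jm K0 Kp Km : Module.End ℂ M} (h : LadderRelations J0 Jp Jm K0 Kp Km)
    (x y : Spin31) :
    actionOfLadder J0 Jp Jm K0 Kp Km ⁅x, y⁆
      = actionOfLadder J0 Jp Jm K0 Kp Km x * actionOfLadder J0 Jp Jm K0 Kp Km y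
        - actionOfLadder J0 Jp Jm K0 Kp Km y * actionOfLadder J0 Jp Jm K0 Kp Km x := by
  let := LieRing.ofAssociativeRing (A := Module.End ℂ M)
  let := LieAlgebra.ofAssociativeAlgebra (R := ℂ) (A := Module.End ℂ M)
  obtain ⟨h1, h2, h3, h4, h5, h6, h7, h8, h9, h10, h11, h12, h13, h14, h15⟩ := h
  simp only [← LieRing.of_associative_ring_bracket] at h1 h2 h3 h4 h5 h6 h7 h8 h9 h10 h11 h12 h13 h14 h15 ⊢
  have r1 : ⁅Jp, J0⁆ = -Jp := by rw [← lie_skew, h1]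
  have r2 : ⁅Jm, J0⁆ = Jm := by rw [← lie_skew, h2, neg_neg]
  have r3 : ⁅Jm, Jp⁆ = -((2 : ℂ) • J0) := by rw [← lie_skew, h3]
  have r4 : ⁅K0, J0⁆ = 0 := by rw [← lie_skew, h4, neg_zero]
  have r5 : ⁅Kp, J0⁆ = -Kp := by rw [← lie_skew, h5]
  have r6 : ⁅Km, J0⁆ = Km := by rw [← lie_skew, h6, neg_neg]
  have r7 : ⁅K0, Jp⁆ = Kp := by rw [← lie_skew, h7, neg_neg]
  have r8 : ⁅K0, Jm⁆ = -Km := by rw [← lie_skew, h8]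
  have r9 : ⁅Kp, Jp⁆ = 0 := by rw [← lie_skew, h9, neg_zero]
  have r10 : ⁅Km, Jm⁆ = 0 := by rw [← lie_skew, h10, neg_zero]
  have r11 : ⁅Km, Jp⁆ = -((2 : ℂ) • K0) := by rw [← lie_skew, h11]
  have r12 : ⁅Kp, Jm⁆ = -(-(2 : ℂ) • K0) := by rw [← lie_skew, h12]
  have r13 : ⁅Kp, K0⁆ = Jp := by rw [← lie_skew, h13, neg_neg]
  have r14 : ⁅Km, K0⁆ = -Jm := by rw [← lie_skew, h14]
  have r15 : ⁅Km, Kp⁆ = -(-(2 : ℂ) • J0) := by rw [← lie_skew, h15]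
  simp only [actionOfLadder, Spin31.rot_lie, Spin31.boost_lie, cross_apply, lie_add, add_lie,
    lie_sub, sub_lie, lie_smul, smul_lie, lie_self, h1, h2, h3, h4, h5, h6,
    h7, h8, h9, h10, h11, h12, h13, h14, h15, r1, r2, r3, r4, r5, r6,
    r7, r8, r9, r10, r11, r12, r13, r14, r15]
  simp only [Pi.smul_apply, Pi.sub_apply, Pi.add_apply, Matrix.cons_val, smul_eq_mul]
  have hI : Complex.I ^ 2 = -1 := Complex.I_sq
  match_scalars <;> ring_nf <;> simp only [hI] <;> ring

/-! ### Weights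

Half-integers are recorded by their doubles throughout: `a = 2j`, `b = 2m`, `g = 2γ`, `l = 2λ`. -/

/-- The set `ℳ_j = {-j, -j+1, …, j}` for the half-integer `j = a / 2`; its elements `m = b / 2`
are recorded by the integers `b = 2m`. -/
def weights (a : ℤ) : Set ℤ := {b | -a ≤ b ∧ b ≤ a ∧ (2 : ℤ) ∣ a - b}

/-- `C_ε(j,m) = √(j - ε m) √(j + ε m + 1)`, with `ε = ±1`. -/
def coeffC (ε : ℤˣ) (j m : ℂ) : ℂ :=
  (j - (ε : ℤ) * m).sqrt * (j + (ε : ℤ) * m + 1).sqrt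

/-! ### The finite-dimensional modules `F^A_γ` -/

/-- The module `F^A_γ` with `γ = g / 2`, with basis `|γ_A, μ⟩`, `μ ∈ ℳ_γ`. -/
def FinMod (_A : ℤˣ) (g : ℤ) : Type := weights g →₀ ℂ

namespace FinMod

variable (A : ℤˣ) (g : ℤ)

instance : AddCommGroup (FinMod A g) := inferInstanceAs (AddCommGroup (weights g →₀ ℂ))
instance : Module ℂ (FinMod A g) := inferInstanceAs (Module ℂ (weights g →₀ ℂ))

/-- The basis vectors `|γ_A, μ⟩`. -/
def basis : Module.Basis (weights g) ℂ (FinMod A g) := Module.Basis.ofRepr (LinearEquiv.refl ℂ _)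

open Classical in
/-- The vector `|γ_A, b/2⟩`, which is zero unless `b/2 ∈ ℳ_γ`. -/
def ket (b : ℤ) : FinMod A g := if h : b ∈ weights g then basis A g ⟨b, h⟩ else 0

/-- `J₀ |γ_A, μ⟩ = μ |γ_A, μ⟩`. -/
def J0 : Module.End ℂ (FinMod A g) :=
  (basis A g).constr ℂ fun b => ((b : ℤ) / 2 : ℂ) • ket A g b

/-- `J_± |γ_A, μ⟩ = C_±(γ, μ) |γ_A, μ ± 1⟩`. -/
def Jpm (ε : ℤˣ) : Module.End ℂ (FinMod A g) :=
  (basis A g).constr ℂ fun b => coeffC ε (g / 2) ((b : ℤ) / 2) • ket A g (b + 2 * ε)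

/-- `K₀ |γ_A, μ⟩ = i A μ |γ_A, μ⟩`. -/
def K0 : Module.End ℂ (FinMod A g) :=
  (basis A g).constr ℂ fun b => (Complex.I * (A : ℤ) * ((b : ℤ) / 2)) • ket A g b

/-- `K_± |γ_A, μ⟩ = i A C_±(γ, μ) |γ_A, μ ± 1⟩`. -/
def Kpm (ε : ℤˣ) : Module.End ℂ (FinMod A g) :=
  (basis A g).constr ℂ fun b =>
    (Complex.I * (A : ℤ) * coeffC ε (g / 2) ((b : ℤ) / 2)) • ket A g (b + 2 * ε)

end FinMod

/-! ### The modules `V_{λ,ρ}` -/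

/-- `P⁻_{λ,ρ}(j)`. -/
def coeffPminus (lam ρ j : ℂ) : ℂ :=
  ((j + lam).sqrt * (j - lam).sqrt * (j + ρ).sqrt * (j - ρ).sqrt)
    / (j * (2 * j + 1).sqrt * (2 * j - 1).sqrt)

/-- `P⁺_{λ,ρ}(j) = P⁻_{λ,ρ}(j + 1)`. -/
def coeffPplus (lam ρ j : ℂ) : ℂ := coeffPminus lam ρ (j + 1)

open Classical in
/-- `P_{λ,ρ}(j)`. -/
def coeffP (lam ρ j : ℂ) : ℂ := if j = 0 then 0 else Complex.I * lam * ρ / (j * (j + 1))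

/-- The labels `(a, b) = (2j, 2m)` of the basis `|(λ,ρ) j, m⟩` of `V_{λ,ρ}`, with `λ = l / 2`:
`j` runs over `|λ|, |λ| + 1, …`, up to and including the first value at which `P⁺_{λ,ρ}` vanishes
(if there is one), and `m` runs over `ℳ_j`. -/
def labels (l : ℤ) (ρ : ℂ) : Set (ℤ × ℤ) :=
  {p | |l| ≤ p.1 ∧ (2 : ℤ) ∣ p.1 - l ∧
    (∀ c : ℤ, |l| ≤ c → c < p.1 → (2 : ℤ) ∣ c - l → coeffPplus (l / 2) ρ (c / 2) ≠ 0) ∧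
    p.2 ∈ weights p.1}

/-- The module `V_{λ,ρ}` with `λ = l / 2`, with basis `|(λ,ρ) j, m⟩`. -/
def IrrMod (l : ℤ) (ρ : ℂ) : Type := labels l ρ →₀ ℂ

namespace IrrMod

variable (l : ℤ) (ρ : ℂ)

instance : AddCommGroup (IrrMod l ρ) := inferInstanceAs (AddCommGroup (labels l ρ →₀ ℂ))
instance : Module ℂ (IrrMod l ρ) := inferInstanceAs (Module ℂ (labels l ρ →₀ ℂ))

/-- The basis vectors `|(λ,ρ) j, m⟩`. -/
def basis : Module.Basis (labels l ρ) ℂ (IrrMod l ρ) :=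
  Module.Basis.ofRepr (LinearEquiv.refl ℂ _)

open Classical in
/-- The vector `|(λ,ρ) a/2, b/2⟩`, which is zero if there is no such basis vector. -/
def ket (a b : ℤ) : IrrMod l ρ := if h : (a, b) ∈ labels l ρ then basis l ρ ⟨(a, b), h⟩ else 0

/-- The linear operator with prescribed values on the basis `|(λ,ρ) a/2, b/2⟩`. -/
def ofKets (f : ℤ → ℤ → IrrMod l ρ) : Module.End ℂ (IrrMod l ρ) :=
  (basis l ρ).constr ℂ fun p => f p.1.1 p.1.2

/-- `J₀ |j, m⟩ = m |j, m⟩`. -/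
def J0 : Module.End ℂ (IrrMod l ρ) := ofKets l ρ fun a b => (b / 2 : ℂ) • ket l ρ a b

/-- `J_± |j, m⟩ = C_±(j, m) |j, m ± 1⟩`. -/
def Jpm (ε : ℤˣ) : Module.End ℂ (IrrMod l ρ) :=
  ofKets l ρ fun a b => coeffC ε (a / 2) (b / 2) • ket l ρ a (b + 2 * ε)

/-- The action of `K₀`. -/
def K0 : Module.End ℂ (IrrMod l ρ) := ofKets l ρ fun a b =>
  let j : ℂ := a / 2
  let m : ℂ := b / 2
  (coeffPplus (l / 2) ρ j * (j + m + 1).sqrt * (j - m + 1).sqrt) • ket l ρ (a + 2) b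
    + (coeffP (l / 2) ρ j * m) • ket l ρ a b
    + (coeffPminus (l / 2) ρ j * (j + m).sqrt * (j - m).sqrt) • ket l ρ (a - 2) b

/-- The action of `K_±`. -/
def Kpm (ε : ℤˣ) : Module.End ℂ (IrrMod l ρ) := ofKets l ρ fun a b =>
  let j : ℂ := a / 2
  let m : ℂ := b / 2
  let e : ℂ := (ε : ℤ)
  (-e * coeffPplus (l / 2) ρ j * (j + e * m + 1).sqrt * (j + e * m + 2).sqrt) •
      ket l ρ (a + 2) (b + 2 * ε)
    + (coeffP (l / 2) ρ j * coeffC ε j m) • ket l ρ a (b + 2 * ε)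
    + (e * coeffPminus (l / 2) ρ j * (j - e * m).sqrt * (j - e * m - 1).sqrt) •
      ket l ρ (a - 2) (b + 2 * ε)

end IrrMod

theorem sqrt_mul_self' (z : ℂ) : z.sqrt * z.sqrt = z := by
  rw [Complex.sqrt, ← pow_two, ← Complex.cpow_nat_mul]; simp

theorem sqrt_sq' (z : ℂ) : z.sqrt ^ 2 = z := by rw [pow_two, sqrt_mul_self']

namespace IrrMod

variable (l : ℤ) (ρ : ℂ)

theorem basis_eq_ket (p : labels l ρ) : basis l ρ p = ket l ρ p.1.1 p.1.2 := by
  have h : (p.1.1, p.1.2) ∈ labels l ρ := p.2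
  rw [ket, dif_pos h]

theorem ket_of_not_mem {a b : ℤ} (h : (a, b) ∉ labels l ρ) : ket l ρ a b = 0 := by
  rw [ket, dif_neg h]

theorem smul_ket_eq_zero {c : ℂ} {a b : ℤ} (h : (a, b) ∈ labels l ρ → c = 0) :
    c • ket l ρ a b = 0 := by
  by_cases hm : (a, b) ∈ labels l ρ
  · rw [h hm, zero_smul]
  · rw [ket_of_not_mem l ρ hm, smul_zero]

theorem ofKets_ket (f : ℤ → ℤ → IrrMod l ρ) (a b : ℤ)
    (h : (a, b) ∉ labels l ρ → f a b = 0) : ofKets l ρ f (ket l ρ a b) = f a b := by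
  by_cases hm : (a, b) ∈ labels l ρ
  · rw [ket, dif_pos hm, ofKets, Module.Basis.constr_basis]
  · rw [h hm, ket_of_not_mem l ρ hm, map_zero]

theorem J0_ket (a b : ℤ) : J0 l ρ (ket l ρ a b) = (b / 2 : ℂ) • ket l ρ a b :=
  ofKets_ket l ρ _ a b fun h => by rw [ket_of_not_mem l ρ h, smul_zero]

theorem coeffC_eq_zero {ε : ℤˣ} {a b : ℤ} (hb : b ∉ weights a) (hb' : b + 2 * ε ∈ weights a) :
    coeffC ε (a / 2) (b / 2) = 0 := by
  rcases Int.units_eq_one_or ε with rfl | rfl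
  · simp only [weights, Set.mem_ofPred_eq, Units.val_one] at hb hb'
    have : b = -a - 2 := by omega
    subst this
    simp only [coeffC, Units.val_one]
    push_cast
    rw [show ((a : ℂ) / 2 + 1 * ((-a - 2) / 2) + 1) = 0 by ring]; simp
  · simp only [weights, Set.mem_ofPred_eq, Units.val_neg, Units.val_one] at hb hb'
    have : b = a + 2 := by omega
    subst this
    simp only [coeffC, Units.val_neg, Units.val_one]
    push_cast
    rw [show ((a : ℂ) / 2 + -1 * ((a + 2) / 2) + 1) = 0 by ring]; simp

theorem Jpm_ket (ε : ℤˣ) (a b : ℤ) : Jpm l ρ ε (ket l ρ a b) =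
    coeffC ε (a / 2) (b / 2) • ket l ρ a (b + 2 * ε) :=
  ofKets_ket l ρ _ a b fun h => by
    apply smul_ket_eq_zero
    intro hm
    exact coeffC_eq_zero (fun hb => h ⟨hm.1, hm.2.1, hm.2.2.1, hb⟩) hm.2.2.2

theorem coeffPminus_self : coeffPminus (l / 2) ρ ((|l| : ℤ) / 2) = 0 := by
  rcases abs_choice l with h | h <;> rw [h] <;> simp [coeffPminus]
  left; left; left; left
  rw [show (-(l : ℂ) / 2 + l / 2) = 0 by ring]; simp

theorem coeffPplus_eq_minus (a : ℤ) :
    coeffPplus (l / 2) ρ (a / 2) = coeffPminus (l / 2) ρ (((a + 2 : ℤ) : ℂ) / 2) := by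
  rw [coeffPplus]; congr 1; push_cast; ring

theorem coeffPplus_eq_zero {a b b' : ℤ} (h : (a, b) ∉ labels l ρ)
    (h' : (a + 2, b') ∈ labels l ρ) (hb : b ∈ weights a) : coeffPplus (l / 2) ρ (a / 2) = 0 := by
  rw [coeffPplus_eq_minus]
  obtain ⟨h1, h2, h3, -⟩ := h'
  simp only at h1 h2 h3
  by_cases hl : |l| ≤ a
  · exact absurd ⟨hl, by simp only; omega, fun c hc hc' hc'' => h3 c hc (by simp only at hc'; omega) hc'', hb⟩ h
  · have : a + 2 = |l| := by
      have : (2 : ℤ) ∣ |l| - l := by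
        rcases abs_choice l with h | h <;> rw [h] <;> omega
      omega
    rw [this, coeffPminus_self]

theorem coeffPminus_eq_zero {a b b' : ℤ} (h : (a, b) ∉ labels l ρ)
    (h' : (a - 2, b') ∈ labels l ρ) (hb : b ∈ weights a) : coeffPminus (l / 2) ρ (a / 2) = 0 := by
  obtain ⟨h1, h2, h3, -⟩ := h'
  simp only at h1 h2 h3
  by_contra hP
  refine h ⟨by simp only; omega, by simp only; omega, fun c hc hc' hc'' => ?_, hb⟩
  simp only at hc'
  by_cases hca : c < a - 2
  · exact h3 c hc hca hc''
  · have : c = a - 2 := by omega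
    subst this
    rw [coeffPplus_eq_minus]
    simpa using hP

theorem K0_ket (a b : ℤ) : K0 l ρ (ket l ρ a b) =
    (coeffPplus (l / 2) ρ (a / 2) * ((a : ℂ) / 2 + b / 2 + 1).sqrt * ((a : ℂ) / 2 - b / 2 + 1).sqrt)
        • ket l ρ (a + 2) b
      + (coeffP (l / 2) ρ (a / 2) * (b / 2)) • ket l ρ a b
      + (coeffPminus (l / 2) ρ (a / 2) * ((a : ℂ) / 2 + b / 2).sqrt * ((a : ℂ) / 2 - b / 2).sqrt)
        • ket l ρ (a - 2) b :=
  ofKets_ket l ρ _ a b fun h => by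
    simp only
    rw [ket_of_not_mem l ρ h, smul_zero, smul_ket_eq_zero, smul_ket_eq_zero, add_zero, add_zero]
    · intro h'
      have hb : b ∈ weights a := by
        have := h'.2.2.2; simp only [weights, Set.mem_ofPred_eq] at this ⊢; omega
      rw [coeffPminus_eq_zero l ρ h h' hb, zero_mul, zero_mul]
    · intro h'
      by_cases hb : b ∈ weights a
      · rw [coeffPplus_eq_zero l ρ h h' hb, zero_mul, zero_mul]
      · have := h'.2.2.2
        simp only [weights, Set.mem_ofPred_eq] at this hb
        have : b = a + 2 ∨ b = -a - 2 := by omega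
        rcases this with rfl | rfl
        · rw [show ((a : ℂ) / 2 - ((a + 2 : ℤ) : ℂ) / 2 + 1) = 0 by push_cast; ring]; simp
        · rw [show ((a : ℂ) / 2 + ((-a - 2 : ℤ) : ℂ) / 2 + 1) = 0 by push_cast; ring]; simp

theorem Kpm_ket (ε : ℤˣ) (a b : ℤ) : Kpm l ρ ε (ket l ρ a b) =
    (-((ε : ℤ) : ℂ) * coeffPplus (l / 2) ρ (a / 2) * ((a : ℂ) / 2 + (ε : ℤ) * (b / 2) + 1).sqrt
        * ((a : ℂ) / 2 + (ε : ℤ) * (b / 2) + 2).sqrt) • ket l ρ (a + 2) (b + 2 * ε)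
      + (coeffP (l / 2) ρ (a / 2) * coeffC ε (a / 2) (b / 2)) • ket l ρ a (b + 2 * ε)
      + (((ε : ℤ) : ℂ) * coeffPminus (l / 2) ρ (a / 2) * ((a : ℂ) / 2 - (ε : ℤ) * (b / 2)).sqrt
        * ((a : ℂ) / 2 - (ε : ℤ) * (b / 2) - 1).sqrt) • ket l ρ (a - 2) (b + 2 * ε) :=
  ofKets_ket l ρ _ a b fun h => by
    simp only
    rw [smul_ket_eq_zero, smul_ket_eq_zero, smul_ket_eq_zero, add_zero, add_zero]
    · intro h'
      have hb : b ∈ weights a := by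
        have := h'.2.2.2
        rcases Int.units_eq_one_or ε with rfl | rfl <;>
        simp only [weights, Set.mem_ofPred_eq, Units.val_neg, Units.val_one] at this ⊢ <;> omega
      rw [coeffPminus_eq_zero l ρ h h' hb]; ring
    · intro hm
      rw [coeffC_eq_zero (fun hb => h ⟨hm.1, hm.2.1, hm.2.2.1, hb⟩) hm.2.2.2, mul_zero]
    · intro h'
      by_cases hb : b ∈ weights a
      · rw [coeffPplus_eq_zero l ρ h h' hb]; ring
      · have := h'.2.2.2
        rcases Int.units_eq_one_or ε with rfl | rfl
        · simp only [weights, Set.mem_ofPred_eq, Units.val_one] at this hb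
          have : b = -a - 2 ∨ b = -a - 4 := by omega
          simp only [Units.val_one]
          rcases this with rfl | rfl
          · rw [show ((a : ℂ) / 2 + ((1 : ℤ) : ℂ) * (((-a - 2 : ℤ) : ℂ) / 2) + 1) = 0 by
              push_cast; ring]; simp
          · rw [show ((a : ℂ) / 2 + ((1 : ℤ) : ℂ) * (((-a - 4 : ℤ) : ℂ) / 2) + 2) = 0 by
              push_cast; ring]; simp
        · simp only [weights, Set.mem_ofPred_eq, Units.val_neg, Units.val_one] at this hb
          have : b = a + 2 ∨ b = a + 4 := by omega
          simp only [Units.val_neg, Units.val_one]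
          rcases this with rfl | rfl
          · rw [show ((a : ℂ) / 2 + ((-1 : ℤ) : ℂ) * (((a + 2 : ℤ) : ℂ) / 2) + 1) = 0 by
              push_cast; ring]; simp
          · rw [show ((a : ℂ) / 2 + ((-1 : ℤ) : ℂ) * (((a + 4 : ℤ) : ℂ) / 2) + 2) = 0 by
              push_cast; ring]; simp

end IrrMod

set_option linter.unusedSimpArgs false
set_option linter.unusedTactic false
set_option linter.unreachableTactic false

namespace IrrMod

variable (l : ℤ) (ρ : ℂ)

theorem end_ext {f g : Module.End ℂ (IrrMod l ρ)}
    (h : ∀ a b : ℤ, (a, b) ∈ labels l ρ → f (ket l ρ a b) = g (ket l ρ a b)) : f = g :=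
  (basis l ρ).ext fun p => by rw [basis_eq_ket]; exact h _ _ p.2

theorem coeffPminus_sq (lam j : ℂ) : coeffPminus lam ρ j ^ 2 =
    ((j + lam) * (j - lam) * (j + ρ) * (j - ρ)) / (j ^ 2 * (2 * j + 1) * (2 * j - 1)) := by
  simp only [coeffPminus, div_pow, mul_pow, sqrt_sq']

theorem coeffP_eq (lam j : ℂ) : coeffP lam ρ j = Complex.I * lam * ρ / (j * (j + 1)) := by
  by_cases h : j = 0 <;> simp [coeffP, h]

theorem j0p : J0 l ρ * Jpm l ρ 1 - Jpm l ρ 1 * J0 l ρ = Jpm l ρ 1 := by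
  refine end_ext l ρ fun a b _ => ?_
  simp only [LinearMap.sub_apply, Module.End.mul_apply, J0_ket, Jpm_ket, map_smul]
  match_scalars
  push_cast; ring

theorem j0m : J0 l ρ * Jpm l ρ (-1) - Jpm l ρ (-1) * J0 l ρ = -Jpm l ρ (-1) := by
  refine end_ext l ρ fun a b _ => ?_
  simp only [LinearMap.sub_apply, LinearMap.neg_apply, Module.End.mul_apply, J0_ket, Jpm_ket,
    map_smul]
  match_scalars
  push_cast; ring

theorem jpm : Jpm l ρ 1 * Jpm l ρ (-1) - Jpm l ρ (-1) * Jpm l ρ 1 = (2 : ℂ) • J0 l ρ := by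
  refine end_ext l ρ fun a b _ => ?_
  simp only [LinearMap.sub_apply, LinearMap.smul_apply, Module.End.mul_apply, J0_ket, Jpm_ket,
    map_smul, Units.val_one, Units.val_neg, coeffC]
  push_cast
  simp only [mul_one, mul_neg, neg_add_cancel_right, add_neg_cancel_right]
  match_scalars
  ring_nf
  simp only [sqrt_sq']
  ring_nf

theorem j0k0 : J0 l ρ * K0 l ρ - K0 l ρ * J0 l ρ = 0 := by
  refine end_ext l ρ fun a b _ => ?_
  simp only [LinearMap.sub_apply, LinearMap.zero_apply, Module.End.mul_apply, J0_ket, K0_ket,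
    map_smul, map_add]
  match_scalars <;> ring

theorem j0kp : J0 l ρ * Kpm l ρ 1 - Kpm l ρ 1 * J0 l ρ = Kpm l ρ 1 := by
  refine end_ext l ρ fun a b _ => ?_
  simp only [LinearMap.sub_apply, Module.End.mul_apply, J0_ket, Kpm_ket, map_smul, map_add]
  match_scalars <;> push_cast <;> ring

theorem j0km : J0 l ρ * Kpm l ρ (-1) - Kpm l ρ (-1) * J0 l ρ = -Kpm l ρ (-1) := by
  refine end_ext l ρ fun a b _ => ?_
  simp only [LinearMap.sub_apply, LinearMap.neg_apply, Module.End.mul_apply, J0_ket, Kpm_ket,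
    map_smul, map_add]
  match_scalars <;> push_cast <;> ring

theorem jpk0 : Jpm l ρ 1 * K0 l ρ - K0 l ρ * Jpm l ρ 1 = -Kpm l ρ 1 := by
  refine end_ext l ρ fun a b _ => ?_
  simp only [LinearMap.sub_apply, LinearMap.neg_apply, LinearMap.smul_apply, LinearMap.zero_apply,
    Module.End.mul_apply, Jpm_ket, K0_ket, J0_ket, Kpm_ket, map_smul, map_add, Units.val_one,
    Units.val_neg, coeffC]
  push_cast
  simp only [mul_one, mul_neg, neg_add_cancel_right, add_neg_cancel_right, neg_mul, one_mul]
  match_scalars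
  all_goals ring_nf
  all_goals try simp only [sqrt_sq']
  all_goals try ring_nf

theorem jmk0 : Jpm l ρ (-1) * K0 l ρ - K0 l ρ * Jpm l ρ (-1) = Kpm l ρ (-1) := by
  refine end_ext l ρ fun a b _ => ?_
  simp only [LinearMap.sub_apply, LinearMap.neg_apply, LinearMap.smul_apply, LinearMap.zero_apply,
    Module.End.mul_apply, Jpm_ket, K0_ket, J0_ket, Kpm_ket, map_smul, map_add, Units.val_one,
    Units.val_neg, coeffC]
  push_cast
  simp only [mul_one, mul_neg, neg_add_cancel_right, add_neg_cancel_right, neg_mul, one_mul]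
  match_scalars
  all_goals ring_nf
  all_goals try simp only [sqrt_sq']
  all_goals try ring_nf

theorem jpkp : Jpm l ρ 1 * Kpm l ρ 1 - Kpm l ρ 1 * Jpm l ρ 1 = 0 := by
  refine end_ext l ρ fun a b _ => ?_
  simp only [LinearMap.sub_apply, LinearMap.neg_apply, LinearMap.smul_apply, LinearMap.zero_apply,
    Module.End.mul_apply, Jpm_ket, K0_ket, J0_ket, Kpm_ket, map_smul, map_add, Units.val_one,
    Units.val_neg, coeffC]
  push_cast
  simp only [mul_one, mul_neg, neg_add_cancel_right, add_neg_cancel_right, neg_mul, one_mul]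
  match_scalars
  all_goals ring_nf
  all_goals try simp only [sqrt_sq']
  all_goals try ring_nf

theorem jmkm : Jpm l ρ (-1) * Kpm l ρ (-1) - Kpm l ρ (-1) * Jpm l ρ (-1) = 0 := by
  refine end_ext l ρ fun a b _ => ?_
  simp only [LinearMap.sub_apply, LinearMap.neg_apply, LinearMap.smul_apply, LinearMap.zero_apply,
    Module.End.mul_apply, Jpm_ket, K0_ket, J0_ket, Kpm_ket, map_smul, map_add, Units.val_one,
    Units.val_neg, coeffC]
  push_cast
  simp only [mul_one, mul_neg, neg_add_cancel_right, add_neg_cancel_right, neg_mul, one_mul]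
  match_scalars
  all_goals ring_nf
  all_goals try simp only [sqrt_sq']
  all_goals try ring_nf

theorem jpkm : Jpm l ρ 1 * Kpm l ρ (-1) - Kpm l ρ (-1) * Jpm l ρ 1 = (2 : ℂ) • K0 l ρ := by
  refine end_ext l ρ fun a b _ => ?_
  simp only [LinearMap.sub_apply, LinearMap.neg_apply, LinearMap.smul_apply, LinearMap.zero_apply,
    Module.End.mul_apply, Jpm_ket, K0_ket, J0_ket, Kpm_ket, map_smul, map_add, Units.val_one,
    Units.val_neg, coeffC]
  push_cast
  simp only [mul_one, mul_neg, neg_add_cancel_right, add_neg_cancel_right, neg_mul, one_mul]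
  match_scalars
  all_goals ring_nf
  all_goals try simp only [sqrt_sq']
  all_goals try ring_nf

theorem jmkp : Jpm l ρ (-1) * Kpm l ρ 1 - Kpm l ρ 1 * Jpm l ρ (-1) = -(2 : ℂ) • K0 l ρ := by
  refine end_ext l ρ fun a b _ => ?_
  simp only [LinearMap.sub_apply, LinearMap.neg_apply, LinearMap.smul_apply, LinearMap.zero_apply,
    Module.End.mul_apply, Jpm_ket, K0_ket, J0_ket, Kpm_ket, map_smul, map_add, Units.val_one,
    Units.val_neg, coeffC]
  push_cast
  simp only [mul_one, mul_neg, neg_add_cancel_right, add_neg_cancel_right, neg_mul, one_mul]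
  match_scalars
  all_goals ring_nf
  all_goals try simp only [sqrt_sq']
  all_goals try ring_nf



theorem coeffP_step {a b : ℤ} (h : (a, b) ∈ labels l ρ) :
    ((a : ℂ) + 4) * coeffP (l / 2) ρ (a / 2 + 1) = a * coeffP (l / 2) ρ (a / 2) := by
  have h1 := h.1
  simp only at h1
  have ha : 0 ≤ a := (abs_nonneg l).trans h1
  rcases eq_or_lt_of_le ha with rfl | ha
  · have : l = 0 := abs_nonpos_iff.1 h1
    subst this; simp [coeffP_eq]
  · have c0 : (a : ℂ) ≠ 0 := by exact_mod_cast ha.ne'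
    have c1 : (a : ℂ) + 2 ≠ 0 := by exact_mod_cast (by omega : a + 2 ≠ 0)
    have c2 : (a : ℂ) + 4 ≠ 0 := by exact_mod_cast (by omega : a + 4 ≠ 0)
    rw [coeffP_eq, coeffP_eq,
      show (a : ℂ) / 2 * (a / 2 + 1) = a * (a + 2) / 4 by ring,
      show ((a : ℂ) / 2 + 1) * (a / 2 + 1 + 1) = (a + 2) * (a + 4) / 4 by ring]
    field_simp

theorem coeffP_step' {a b : ℤ} (h : (a, b) ∈ labels l ρ) :
    coeffPminus (l / 2) ρ (a / 2) * (((a : ℂ) + 2) * coeffP (l / 2) ρ (a / 2)) =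
      coeffPminus (l / 2) ρ (a / 2) * (((a : ℂ) - 2) * coeffP (l / 2) ρ (-1 + a / 2)) := by
  have h1 := h.1
  have h2 := h.2.1
  simp only at h1 h2
  have ha : 0 ≤ a := (abs_nonneg l).trans h1
  by_cases hl : |l| = a
  · rw [← hl, coeffPminus_self]; ring
  · have ha' : 0 < a := by have := abs_nonneg l; omega
    by_cases ha2 : a = 2
    · have : l = 0 := by
        have := abs_lt.1 (lt_of_le_of_ne h1 hl)
        omega
      subst this; simp [coeffP_eq]
    · have c0 : (a : ℂ) ≠ 0 := by exact_mod_cast ha'.ne'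
      have c1 : (a : ℂ) + 2 ≠ 0 := by exact_mod_cast (by omega : a + 2 ≠ 0)
      have c2 : (a : ℂ) - 2 ≠ 0 := by exact_mod_cast (by omega : a - 2 ≠ 0)
      rw [coeffP_eq, coeffP_eq,
        show (a : ℂ) / 2 * (a / 2 + 1) = a * (a + 2) / 4 by ring,
        show (-1 + (a : ℂ) / 2) * (-1 + a / 2 + 1) = (a - 2) * a / 4 by ring]
      field_simp

theorem coeff_diag {a b : ℤ} (h : (a, b) ∈ labels l ρ) :
    (b : ℂ) * (coeffPminus (l / 2) ρ (a / 2 + 1) ^ 2 * (a + 3)) =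
      b * (coeffPminus (l / 2) ρ (a / 2) ^ 2 * (a - 1) + coeffP (l / 2) ρ (a / 2) ^ 2 + 1) := by
  obtain ⟨h1, h2, -, hb⟩ := h
  simp only [weights, Set.mem_ofPred_eq] at h1 h2 hb
  have ha : 0 ≤ a := (abs_nonneg l).trans h1
  have hI : Complex.I ^ 2 = -1 := Complex.I_sq
  rw [coeffPminus_sq, coeffPminus_sq, coeffP_eq]
  rcases eq_or_lt_of_le ha with rfl | ha
  · have : b = 0 := by omega
    subst this; simp
  · have c0 : (a : ℂ) ≠ 0 := by exact_mod_cast ha.ne'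
    have c1 : (a : ℂ) + 2 ≠ 0 := by exact_mod_cast (by omega : a + 2 ≠ 0)
    have c2 : (a : ℂ) + 1 ≠ 0 := by exact_mod_cast (by omega : a + 1 ≠ 0)
    have c3 : (a : ℂ) + 3 ≠ 0 := by exact_mod_cast (by omega : a + 3 ≠ 0)
    by_cases ha1 : a = 1
    · subst ha1
      have hl : (l : ℂ) ^ 2 = 1 := by
        have : l = 1 ∨ l = -1 := by have := abs_le.1 h1; omega
        rcases this with rfl | rfl <;> norm_num
      push_cast
      congr 1
      field_simp
      ring_nf
      simp only [hI, hl, show (l : ℂ) ^ 4 = (l ^ 2) ^ 2 by ring]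
      ring
    · have c4 : (a : ℂ) - 1 ≠ 0 := by exact_mod_cast (by omega : a - 1 ≠ 0)
      congr 1
      rw [show (2 * ((a : ℂ) / 2 + 1) + 1) = a + 3 by ring,
        show (2 * ((a : ℂ) / 2 + 1) - 1) = a + 1 by ring,
        show (2 * ((a : ℂ) / 2) + 1) = a + 1 by ring,
        show (2 * ((a : ℂ) / 2) - 1) = a - 1 by ring,
        show (a : ℂ) / 2 + 1 = (a + 2) / 2 by ring]
      field_simp
      simp only [hI]
      ring

theorem kpm : Kpm l ρ 1 * Kpm l ρ (-1) - Kpm l ρ (-1) * Kpm l ρ 1 = -(2 : ℂ) • J0 l ρ := by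
  refine end_ext l ρ fun a b hab => ?_
  have hs := coeffP_step l ρ hab
  have hs' := coeffP_step' l ρ hab
  have hd := coeff_diag l ρ hab
  simp only [LinearMap.sub_apply, LinearMap.neg_apply, LinearMap.smul_apply,
    Module.End.mul_apply, J0_ket, Kpm_ket, map_smul, map_add, Units.val_one,
    Units.val_neg, coeffC, coeffPplus]
  push_cast
  simp only [mul_one, mul_neg, neg_add_cancel_right, add_neg_cancel_right, neg_mul, one_mul,
    add_sub_cancel_right, sub_add_cancel]
  match_scalars
  all_goals ring_nf
  all_goals try simp only [sqrt_sq']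
  all_goals ring_nf at hs hs' hd ⊢
  · linear_combination coeffPminus (↑l * (1 / 2)) ρ (1 + ↑a * (1 / 2)) *
      (1 + ↑a * (1 / 2) + ↑b * (-1 / 2) : ℂ).sqrt * (1 + ↑a * (1 / 2) + ↑b * (1 / 2) : ℂ).sqrt * hs
  · linear_combination -hd
  · linear_combination (↑a * (1 / 2) + ↑b * (1 / 2) : ℂ).sqrt *
      (↑a * (1 / 2) + ↑b * (-1 / 2) : ℂ).sqrt * hs'


theorem ladder : LadderRelations (J0 l ρ) (Jpm l ρ 1) (Jpm l ρ (-1)) (K0 l ρ) (Kpm l ρ 1)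
    (Kpm l ρ (-1)) := by
  have key : ∀ X P Q : Module.End ℂ (IrrMod l ρ), X * (P * Q - Q * P) - (P * Q - Q * P) * X =
      ((X * P - P * X) * Q - Q * (X * P - P * X)) + (P * (X * Q - Q * X) - (X * Q - Q * X) * P) := by
    intro X P Q; noncomm_ring
  have h2 : (2 : ℂ) ≠ 0 := two_ne_zero
  have hp := key (Jpm l ρ 1) (Kpm l ρ 1) (Kpm l ρ (-1))
  rw [kpm, jpkp, jpkm] at hp
  have hm := key (Jpm l ρ (-1)) (Kpm l ρ 1) (Kpm l ρ (-1))
  rw [kpm, jmkp, jmkm] at hm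
  refine ⟨j0p l ρ, j0m l ρ, jpm l ρ, j0k0 l ρ, j0kp l ρ, j0km l ρ, jpk0 l ρ, jmk0 l ρ, jpkp l ρ,
    jmkm l ρ, jpkm l ρ, jmkp l ρ, ?_, ?_, kpm l ρ⟩
  · refine smul_right_injective _ h2 ?_
    simp only [mul_smul_comm, smul_mul_assoc, zero_mul, mul_zero, sub_zero, zero_add] at hp
    rw [← smul_sub, ← smul_sub] at hp
    have h3 : Jpm l ρ 1 * J0 l ρ - J0 l ρ * Jpm l ρ 1 = -Jpm l ρ 1 := by
      rw [← neg_sub, j0p]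
    rw [h3] at hp
    calc (2 : ℂ) • (K0 l ρ * Kpm l ρ 1 - Kpm l ρ 1 * K0 l ρ)
        = -((2 : ℂ) • (Kpm l ρ 1 * K0 l ρ - K0 l ρ * Kpm l ρ 1)) := by rw [← smul_neg, neg_sub]
      _ = (2 : ℂ) • -Jpm l ρ 1 := by rw [← hp]; module
  · refine smul_right_injective _ h2 ?_
    simp only [mul_smul_comm, smul_mul_assoc, zero_mul, mul_zero, sub_zero, add_zero] at hm
    rw [← smul_sub, ← smul_sub] at hm
    have h3 : Jpm l ρ (-1) * J0 l ρ - J0 l ρ * Jpm l ρ (-1) = Jpm l ρ (-1) := by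
      rw [← neg_sub, j0m, neg_neg]
    rw [h3] at hm
    calc (2 : ℂ) • (K0 l ρ * Kpm l ρ (-1) - Kpm l ρ (-1) * K0 l ρ)
        = -(-(2 : ℂ) • (K0 l ρ * Kpm l ρ (-1) - Kpm l ρ (-1) * K0 l ρ)) := by module
      _ = (2 : ℂ) • Jpm l ρ (-1) := by rw [← hm]; module

/-- The Lie algebra action on `V_{λ,ρ}`. -/
instance : LieRingModule Spin31 (IrrMod l ρ) where
  bracket x v := actionOfLadder (J0 l ρ) (Jpm l ρ 1) (Jpm l ρ (-1)) (K0 l ρ) (Kpm l ρ 1)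
    (Kpm l ρ (-1)) x v
  add_lie x y v := by rw [actionOfLadder_add, LinearMap.add_apply]
  lie_add x v w := map_add _ v w
  leibniz_lie x y v := by
    rw [(ladder l ρ).map_lie, LinearMap.sub_apply, Module.End.mul_apply, Module.End.mul_apply,
      sub_add_cancel]

instance : LieModule ℂ Spin31 (IrrMod l ρ) where
  smul_lie t x v := by
    change actionOfLadder _ _ _ _ _ _ (t • x) v = t • actionOfLadder _ _ _ _ _ _ x v
    rw [actionOfLadder_smul, LinearMap.smul_apply]
  lie_smul t x v := map_smul _ t v

end IrrMod

namespace FinMod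

variable (A : ℤˣ) (g : ℤ)

theorem basis_eq_ket (b : weights g) : basis A g b = ket A g b := by
  rw [ket, dif_pos b.2]

theorem ket_of_not_mem {b : ℤ} (h : b ∉ weights g) : ket A g b = 0 := by
  rw [ket, dif_neg h]

theorem J0_ket (b : ℤ) : J0 A g (ket A g b) = (b / 2 : ℂ) • ket A g b := by
  by_cases h : b ∈ weights g
  · conv_lhs => rw [ket, dif_pos h, J0, Module.Basis.constr_basis]
  · rw [ket_of_not_mem A g h, map_zero, smul_zero]

theorem Jpm_ket (ε : ℤˣ) (b : ℤ) : Jpm A g ε (ket A g b) =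
    coeffC ε (g / 2) (b / 2) • ket A g (b + 2 * ε) := by
  by_cases h : b ∈ weights g
  · conv_lhs => rw [ket, dif_pos h, Jpm, Module.Basis.constr_basis]
  · rw [ket_of_not_mem A g h, map_zero]
    by_cases h' : b + 2 * ε ∈ weights g
    · rw [IrrMod.coeffC_eq_zero h h', zero_smul]
    · rw [ket_of_not_mem A g h', smul_zero]

theorem K0_eq : K0 A g = (Complex.I * (A : ℤ)) • J0 A g :=
  (basis A g).ext fun b => by
    rw [LinearMap.smul_apply, K0, J0, Module.Basis.constr_basis, Module.Basis.constr_basis,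
      smul_smul]

theorem Kpm_eq (ε : ℤˣ) : Kpm A g ε = (Complex.I * (A : ℤ)) • Jpm A g ε :=
  (basis A g).ext fun b => by
    rw [LinearMap.smul_apply, Kpm, Jpm, Module.Basis.constr_basis, Module.Basis.constr_basis,
      smul_smul]

theorem end_ext {f g' : Module.End ℂ (FinMod A g)}
    (h : ∀ b : ℤ, f (ket A g b) = g' (ket A g b)) : f = g' :=
  (basis A g).ext fun p => by rw [basis_eq_ket]; exact h _

theorem j0p : J0 A g * Jpm A g 1 - Jpm A g 1 * J0 A g = Jpm A g 1 := by
  refine end_ext A g fun b => ?_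
  simp only [LinearMap.sub_apply, Module.End.mul_apply, J0_ket, Jpm_ket, map_smul]
  match_scalars
  push_cast; ring

theorem j0m : J0 A g * Jpm A g (-1) - Jpm A g (-1) * J0 A g = -Jpm A g (-1) := by
  refine end_ext A g fun b => ?_
  simp only [LinearMap.sub_apply, LinearMap.neg_apply, Module.End.mul_apply, J0_ket, Jpm_ket,
    map_smul]
  match_scalars
  push_cast; ring

theorem jpm : Jpm A g 1 * Jpm A g (-1) - Jpm A g (-1) * Jpm A g 1 = (2 : ℂ) • J0 A g := by
  refine end_ext A g fun b => ?_
  simp only [LinearMap.sub_apply, LinearMap.smul_apply, Module.End.mul_apply, J0_ket, Jpm_ket,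
    map_smul, Units.val_one, Units.val_neg, coeffC]
  push_cast
  simp only [mul_one, mul_neg, neg_add_cancel_right, add_neg_cancel_right]
  match_scalars
  ring_nf
  simp only [sqrt_sq']
  ring_nf

theorem ladder : LadderRelations (J0 A g) (Jpm A g 1) (Jpm A g (-1)) (K0 A g) (Kpm A g 1)
    (Kpm A g (-1)) := by
  have hA : (Complex.I * ((A : ℤ) : ℂ)) * (Complex.I * ((A : ℤ) : ℂ)) = -1 := by
    rcases Int.units_eq_one_or A with rfl | rfl <;> simp
  have h1 := j0p A g
  have h2 := j0m A g
  have h3 := jpm A g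
  have h1' : Jpm A g 1 * J0 A g - J0 A g * Jpm A g 1 = -Jpm A g 1 := by rw [← neg_sub, h1]
  have h2' : Jpm A g (-1) * J0 A g - J0 A g * Jpm A g (-1) = Jpm A g (-1) := by
    rw [← neg_sub, h2, neg_neg]
  have h3' : Jpm A g (-1) * Jpm A g 1 - Jpm A g 1 * Jpm A g (-1) = -((2 : ℂ) • J0 A g) := by
    rw [← neg_sub, h3]
  rw [K0_eq, Kpm_eq, Kpm_eq]
  constructor <;>
    simp only [mul_smul_comm, smul_mul_assoc, ← smul_sub, smul_smul, hA, h1, h2, h3, h1', h2',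
      h3', sub_self, smul_zero] <;>
    module

/-- The Lie algebra action on `F^A_γ`. -/
instance : LieRingModule Spin31 (FinMod A g) where
  bracket x v := actionOfLadder (J0 A g) (Jpm A g 1) (Jpm A g (-1)) (K0 A g) (Kpm A g 1)
    (Kpm A g (-1)) x v
  add_lie x y v := by rw [actionOfLadder_add, LinearMap.add_apply]
  lie_add x v w := map_add _ v w
  leibniz_lie x y v := by
    rw [(ladder A g).map_lie, LinearMap.sub_apply, Module.End.mul_apply, Module.End.mul_apply,
      sub_add_cancel]

instance : LieModule ℂ Spin31 (FinMod A g) where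
  smul_lie t x v := by
    change actionOfLadder _ _ _ _ _ _ (t • x) v = t • actionOfLadder _ _ _ _ _ _ x v
    rw [actionOfLadder_smul, LinearMap.smul_apply]
  lie_smul t x v := map_smul _ t v

end FinMod

/-! ### Casimirs and diagonalisability -/

section Casimirs

variable (M : Type) [AddCommGroup M] [Module ℂ M] [LieRingModule Spin31 M] [LieModule ℂ Spin31 M]

/-- `𝒞₁ = J · K` acting on a module. -/
def casimir1 : Module.End ℂ M :=
  ∑ a : Fin 3, LieModule.toEnd ℂ Spin31 M (Spin31.J a) * LieModule.toEnd ℂ Spin31 M (Spin31.K a)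

/-- `𝒞₂ = J · J - K · K` acting on a module. -/
def casimir2 : Module.End ℂ M :=
  ∑ a : Fin 3, LieModule.toEnd ℂ Spin31 M (Spin31.J a) * LieModule.toEnd ℂ Spin31 M (Spin31.J a)
    - ∑ a : Fin 3,
        LieModule.toEnd ℂ Spin31 M (Spin31.K a) * LieModule.toEnd ℂ Spin31 M (Spin31.K a)

end Casimirs

/-- There is a basis consisting of eigenvectors of `S`. -/
def Diagonalisable {M : Type} [AddCommGroup M] [Module ℂ M] (S : Module.End ℂ M) : Prop :=
  ∃ (ι : Type) (v : Module.Basis ι ℂ M), ∀ i, ∃ s : ℂ, S (v i) = s • v i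

/-- There is a basis consisting of common eigenvectors of `S` and `T`. -/
def SimultaneouslyDiagonalisable {M : Type} [AddCommGroup M] [Module ℂ M]
    (S T : Module.End ℂ M) : Prop :=
  ∃ (ι : Type) (v : Module.Basis ι ℂ M), ∀ i, ∃ s t : ℂ, S (v i) = s • v i ∧ T (v i) = t • v i

/-- `(s, t)` is a pair of joint eigenvalues of `S` and `T`. -/
def IsJointEigenvalue {M : Type} [AddCommGroup M] [Module ℂ M]
    (S T : Module.End ℂ M) (s t : ℂ) : Prop :=
  ∃ v : M, v ≠ 0 ∧ S v = s • v ∧ T v = t • v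

end

end SpinCG

open SpinCG

/-! Put `σ = Aρ` and `x = λ + σ = A(ρ + Aλ)`. The operators `(J - iAK)/2` span a chiral `sl₂`; it
acts on `F^A_γ` with spin `γ`, while `J + iAK` acts there by zero. On `V_{λ,ρ}` the chiral Casimir
is `(x² - 1)/4`, and on the summand with parameters `(λ + ν, ρ + Aν)` it is `((x + 2ν)² - 1)/4`. Two
of these values coincide for distinct `ν, ν' ∈ ℳ_γ` exactly when `x = -(ν + ν')`, that is, when `x`
is an integer in `(-2γ, 2γ)`.

Away from coincidences, the splitting is built from spin 1/2. In a suitably rescaled basis `V_{λ,ρ}`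
behaves like a space of functions homogeneous of degree `x - 1` in two variables. Multiplication by
the variables (`Z`) and differentiation (`D`) are doublets of operators to the modules with
parameters shifted by `±(1/2, A/2)`, and the Weyl relations between them invert the map `F_{1/2} ⊗ V
→ V₊ ⊕ V₋` as soon as `x ≠ 0` (`repIso_spinor_tensor`, `IrrMod.repIso_spinor_tensor_irrMod`). The
same argument on binary forms gives `F_{1/2} ⊗ F_{γ+1/2} ≅ F_{γ+1} ⊕ F_γ`. Expanding `F_{1/2} ⊗
F_{γ+1/2} ⊗ V` in both ways and cancelling `F_γ ⊗ V` gives the decomposition by induction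
(`repIso_tensor_fin`). Cancellation is legitimate because each `V` occurring has only scalar
endomorphisms (`IrrMod.scalarCommutant`, `RepIso.cancel`), and `NonTerminating.shift` keeps all
shifted modules infinite-dimensional. The Casimirs are scalars on each summand, which gives
diagonalisability and the joint eigenvalues.

In the case of coincidence, both Casimirs of `F ⊗ V` are affine functions, with nonzero slope, of
one operator, the `coupling` `T = ∑ Jₐ ⊗ (Jₐ - iA Kₐ)` (`casimir_tensor`). An eigenvalue of `T` is
determined by an eigenvalue of the chiral Casimir, and an induction on spin that needs no splitting
of `V` confines these to the list above (`chiralSpectrum_tensor`); hence `T` has at most `2γ`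
eigenvalues. On the other hand, `T` moves the product of the highest weight vectors one step deeper
each time it is applied, so no nonzero polynomial in `T` that is a product of at most `2γ` distinct
linear factors vanishes (`exists_hasDepth_aeval`). A diagonalisable `T` would be annihilated by such
a product. -/

namespace SpinCG

/-! ### Isomorphism of families of operators -/

section RepIso

variable {X : Type}

/-- The families of operators `π` and `π'` are intertwined by a linear isomorphism. -/
def RepIso {M N : Type} [AddCommGroup M] [Module ℂ M] [AddCommGroup N] [Module ℂ N]
    (π : X → Module.End ℂ M) (π' : X → Module.End ℂ N) : Prop :=
  ∃ e : M ≃ₗ[ℂ] N, ∀ x m, e (π x m) = π' x (e m)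

variable {M N L M' N' : Type} [AddCommGroup M] [Module ℂ M] [AddCommGroup N] [Module ℂ N]
  [AddCommGroup L] [Module ℂ L] [AddCommGroup M'] [Module ℂ M'] [AddCommGroup N'] [Module ℂ N']
  {π : X → Module.End ℂ M} {θ : X → Module.End ℂ N} {ψ : X → Module.End ℂ L}
  {π' : X → Module.End ℂ M'} {θ' : X → Module.End ℂ N'}

theorem RepIso.refl (π : X → Module.End ℂ M) : RepIso π π :=
  ⟨LinearEquiv.refl ℂ M, fun _ _ => rfl⟩

theorem RepIso.symm (h : RepIso π θ) : RepIso θ π := by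
  obtain ⟨e, he⟩ := h
  exact ⟨e.symm, fun x m => by rw [LinearEquiv.symm_apply_eq, he, e.apply_symm_apply]⟩

theorem RepIso.trans (h : RepIso π θ) (h' : RepIso θ ψ) : RepIso π ψ := by
  obtain ⟨e, he⟩ := h
  obtain ⟨e', he'⟩ := h'
  exact ⟨e.trans e', fun x m => by simp [he, he']⟩

/-- The product of two families of operators. -/
def prodRep (π : X → Module.End ℂ M) (θ : X → Module.End ℂ N) : X → Module.End ℂ (M × N) :=
  fun x => (π x).prodMap (θ x)

/-- The product of a collection of families of operators. -/
def piRep {ι : Type} {M : ι → Type} [∀ i, AddCommGroup (M i)] [∀ i, Module ℂ (M i)]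
    (π : ∀ i, X → Module.End ℂ (M i)) : X → Module.End ℂ (∀ i, M i) :=
  fun x => LinearMap.pi fun i => (π i x).comp (LinearMap.proj i)

/-- The tensor product of two families of operators, in the sense of Lie algebra representations. -/
noncomputable def tensorRep (π : X → Module.End ℂ M) (θ : X → Module.End ℂ N) :
    X → Module.End ℂ (M ⊗[ℂ] N) :=
  fun x => (π x).rTensor N + (θ x).lTensor M

@[simp] theorem prodRep_apply (x : X) (m : M × N) : prodRep π θ x m = (π x m.1, θ x m.2) := rfl

@[simp] theorem piRep_apply {ι : Type} {M : ι → Type} [∀ i, AddCommGroup (M i)]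
    [∀ i, Module ℂ (M i)] (π : ∀ i, X → Module.End ℂ (M i)) (x : X) (m : ∀ i, M i) (i : ι) :
    piRep π x m i = π i x (m i) := rfl

@[simp] theorem tensorRep_tmul (x : X) (m : M) (n : N) :
    tensorRep π θ x (m ⊗ₜ n) = π x m ⊗ₜ n + m ⊗ₜ θ x n := by simp [tensorRep]

theorem RepIso.prod (h : RepIso π π') (h' : RepIso θ θ') :
    RepIso (prodRep π θ) (prodRep π' θ') := by
  obtain ⟨e, he⟩ := h
  obtain ⟨e', he'⟩ := h'
  exact ⟨e.prodCongr e', fun x m => by simp [he, he']⟩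

theorem RepIso.prod_comm : RepIso (prodRep π θ) (prodRep θ π) :=
  ⟨LinearEquiv.prodComm ℂ M N, fun x m => by simp⟩

theorem RepIso.prod_assoc :
    RepIso (prodRep (prodRep π θ) ψ) (prodRep π (prodRep θ ψ)) :=
  ⟨LinearEquiv.prodAssoc ℂ M N L, fun x m => by simp⟩

theorem RepIso.pi {ι : Type} {M N : ι → Type} [∀ i, AddCommGroup (M i)] [∀ i, Module ℂ (M i)]
    [∀ i, AddCommGroup (N i)] [∀ i, Module ℂ (N i)] {π : ∀ i, X → Module.End ℂ (M i)}
    {θ : ∀ i, X → Module.End ℂ (N i)} (h : ∀ i, RepIso (π i) (θ i)) :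
    RepIso (piRep π) (piRep θ) := by
  choose e he using h
  exact ⟨LinearEquiv.piCongrRight e, fun x m => by ext i; simp [he]⟩

theorem RepIso.pi_prod {ι : Type} {M N : ι → Type} [∀ i, AddCommGroup (M i)]
    [∀ i, Module ℂ (M i)] [∀ i, AddCommGroup (N i)] [∀ i, Module ℂ (N i)]
    {π : ∀ i, X → Module.End ℂ (M i)} {θ : ∀ i, X → Module.End ℂ (N i)} :
    RepIso (piRep fun i => prodRep (π i) (θ i)) (prodRep (piRep π) (piRep θ)) :=
  ⟨{ toFun m := (fun i => (m i).1, fun i => (m i).2)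
     invFun m i := (m.1 i, m.2 i)
     map_add' _ _ := rfl
     map_smul' _ _ := rfl
     left_inv _ := rfl
     right_inv _ := rfl }, fun _ _ => rfl⟩

theorem RepIso.pi_succ {n : ℕ} {M : ℕ → Type} [∀ i, AddCommGroup (M i)]
    [∀ i, Module ℂ (M i)] {π : ∀ i, X → Module.End ℂ (M i)} :
    RepIso (piRep fun i : Fin (n + 1) => π i)
      (prodRep (π 0) (piRep fun i : Fin n => π (i + 1))) :=
  ⟨{ toFun m := (m 0, fun i => m i.succ)
     invFun m := Fin.cons (α := fun i : Fin (n + 1) => M i) m.1 m.2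
     map_add' _ _ := rfl
     map_smul' _ _ := rfl
     left_inv m := Fin.cons_self_tail (α := fun i : Fin (n + 1) => M i) m
     right_inv _ := rfl }, fun _ _ => rfl⟩

theorem RepIso.pi_zero {M : Fin 0 → Type} [∀ i, AddCommGroup (M i)]
    [∀ i, Module ℂ (M i)] {π : ∀ i, X → Module.End ℂ (M i)} :
    RepIso (prodRep θ (piRep π)) θ :=
  ⟨LinearEquiv.prodUnique, fun _ _ => rfl⟩

theorem RepIso.pi_one {M : Fin 1 → Type} [∀ i, AddCommGroup (M i)]
    [∀ i, Module ℂ (M i)] {π : ∀ i, X → Module.End ℂ (M i)} :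
    RepIso (piRep π) (π 0) :=
  ⟨LinearEquiv.piUnique ℂ M, fun _ _ => rfl⟩

theorem RepIso.tensor (h : RepIso π π') (h' : RepIso θ θ') :
    RepIso (tensorRep π θ) (tensorRep π' θ') := by
  obtain ⟨e, he⟩ := h
  obtain ⟨e', he'⟩ := h'
  refine ⟨TensorProduct.congr e e', fun x m => ?_⟩
  induction m with
  | zero => simp
  | add a b ha hb => simp only [map_add, ha, hb]
  | tmul a b => simp [he, he']

theorem RepIso.tensor_assoc :
    RepIso (tensorRep (tensorRep π θ) ψ) (tensorRep π (tensorRep θ ψ)) := by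
  refine ⟨TensorProduct.assoc ℂ M N L, fun x m => ?_⟩
  induction m with
  | zero => simp
  | add a b ha hb => simp only [map_add, ha, hb]
  | tmul a c =>
    induction a with
    | zero => simp
    | add a b ha hb => simp only [map_add, TensorProduct.add_tmul, ha, hb]
    | tmul a b => simp [TensorProduct.add_tmul, TensorProduct.tmul_add, add_assoc]

theorem RepIso.prod_tensor :
    RepIso (tensorRep (prodRep π θ) ψ) (prodRep (tensorRep π ψ) (tensorRep θ ψ)) := by
  refine ⟨TensorProduct.prodLeft ℂ ℂ M N L, fun x m => ?_⟩
  induction m with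
  | zero => simp only [map_zero]
  | add a b ha hb => simp only [map_add, ha, hb]
  | tmul a c => obtain ⟨a, b⟩ := a; simp

theorem RepIso.tensor_pi {n : ℕ} {N : Fin n → Type} [∀ i, AddCommGroup (N i)]
    [∀ i, Module ℂ (N i)] {θ : ∀ i, X → Module.End ℂ (N i)} :
    RepIso (tensorRep π (piRep θ)) (piRep fun i => tensorRep π (θ i)) := by
  refine ⟨TensorProduct.piRight ℂ ℂ M N, fun x m => ?_⟩
  induction m with
  | zero => simp
  | add a b ha hb => simp only [map_add, ha, hb]
  | tmul a c => ext i; simp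

/-- Every operator that commutes with the family is a scalar. -/
def ScalarCommutant (π : X → Module.End ℂ M) : Prop :=
  ∀ f : Module.End ℂ M, (∀ x m, f (π x m) = π x (f m)) → ∃ c : ℂ, ∀ m, f m = c • m

/-- A factor whose commutant consists of scalars can be cancelled. -/
theorem RepIso.cancel (hs : ScalarCommutant ψ) (h : RepIso (prodRep π ψ) (prodRep θ ψ)) :
    RepIso π θ := by
  obtain ⟨e, he⟩ := h
  have he' : ∀ x m, e.symm (prodRep θ ψ x m) = prodRep π ψ x (e.symm m) := fun x m => by
    rw [LinearEquiv.symm_apply_eq, he, e.apply_symm_apply]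
  obtain ⟨d, hd⟩ := hs ((LinearMap.snd ℂ N L).comp (e.toLinearMap.comp (LinearMap.inr ℂ M L)))
    fun x m => by simpa using congrArg Prod.snd (he x (0, m))
  simp only [LinearMap.comp_apply, LinearMap.inr_apply, LinearMap.snd_apply,
    LinearEquiv.coe_coe] at hd
  -- `d` is the scalar by which the block `L → L` of `e` acts. If it vanishes, `e` is precomposed
  -- with a shear of `M × L` chosen so that the block becomes the identity.
  wlog hd0 : d ≠ 0 generalizing e d
  · have hd0 : d = 0 := not_not.1 hd0
    subst hd0
    let b : L →ₗ[ℂ] M := (LinearMap.fst ℂ M L).comp (e.symm.toLinearMap.comp (LinearMap.inr ℂ N L))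
    have hb : ∀ v, b v = (e.symm (0, v)).1 := fun v => rfl
    have hbx : ∀ x v, b (ψ x v) = π x (b v) := fun x v => by
      simpa [hb] using congrArg Prod.fst (he' x (0, v))
    let u : (M × L) ≃ₗ[ℂ] (M × L) :=
      { toFun m := (m.1 + b m.2, m.2)
        invFun m := (m.1 - b m.2, m.2)
        map_add' m m' := by ext <;> simp; abel
        map_smul' c m := by ext <;> simp
        left_inv m := by simp
        right_inv m := by simp }
    have hu : ∀ m, u m = (m.1 + b m.2, m.2) := fun m => rfl
    have hue : ∀ x m, (u.trans e) (prodRep π ψ x m) = prodRep θ ψ x ((u.trans e) m) := by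
      intro x m
      rw [LinearEquiv.trans_apply, LinearEquiv.trans_apply, ← he]
      simp [hu, hbx]
    refine this (u.trans e) hue ?_ 1 ?_ one_ne_zero
    · intro x m
      rw [LinearEquiv.symm_apply_eq, hue, LinearEquiv.apply_symm_apply]
    · intro v
      -- The vector `(b v, v)` agrees with the preimage of `(0, v)` up to an element of `L`, and `e`
      -- sends elements of `L` to vectors without `L`-component because `d = 0`. Its image therefore
      -- has `L`-component `v`.
      have h1 : e (b v, v) = e (e.symm (0, v)) + e (0, v - (e.symm (0, v)).2) := by
        rw [← map_add]; congr 1; ext <;> simp [hb]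
      rw [LinearEquiv.trans_apply, hu, zero_add, h1, e.apply_symm_apply, Prod.snd_add, hd]
      simp
  · have key : ∀ (m : M) (v : L), e (m, v) = e (m, 0) + e (0, v) := fun m v => by
      rw [← map_add]; simp
    -- The Schur complement: `m` is corrected by the element of `L` that makes the `L`-component of
    -- its image vanish, which is possible since `d` is invertible.
    let f : M →ₗ[ℂ] N :=
      { toFun m := (e (m, -(d⁻¹ • (e (m, 0)).2))).1
        map_add' m m' := by
          rw [← Prod.fst_add, ← map_add, Prod.mk_add_mk]
          congr 3
          rw [show ((m + m', 0) : M × L) = (m, 0) + (m', 0) by simp, map_add, Prod.snd_add]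
          module
        map_smul' c m := by
          simp only [RingHom.id_apply]
          rw [← Prod.smul_fst, ← map_smul, Prod.smul_mk]
          congr 3
          rw [show ((c • m, 0) : M × L) = c • (m, 0) by simp, map_smul, Prod.smul_snd]
          module }
    have hf : ∀ m, e (m, -(d⁻¹ • (e (m, 0)).2)) = (f m, 0) := fun m => by
      ext
      · rfl
      · rw [key, Prod.snd_add, hd, smul_neg, smul_smul, mul_inv_cancel₀ hd0]; simp
    have hinj : Function.Injective f := by
      rw [← LinearMap.ker_eq_bot, LinearMap.ker_eq_bot']
      intro m hm
      have h1 := hf m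
      rw [hm, show ((0, 0) : N × L) = 0 from rfl, e.map_eq_zero_iff] at h1
      exact congrArg Prod.fst h1
    have hsurj : Function.Surjective f := by
      intro n
      refine ⟨(e.symm (n, 0)).1, ?_⟩
      have h1 : e ((e.symm (n, 0)).1, (e.symm (n, 0)).2) = (n, 0) := e.apply_symm_apply _
      rw [key] at h1
      have h2 := congrArg Prod.snd h1
      rw [Prod.snd_add, hd] at h2
      have h3 : (e.symm (n, 0)).2 = -(d⁻¹ • (e ((e.symm (n, 0)).1, 0)).2) := by
        have h4 : (e ((e.symm (n, 0)).1, 0)).2 = -(d • (e.symm (n, 0)).2) :=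
          eq_neg_of_add_eq_zero_left h2
        rw [h4, smul_neg, neg_neg, smul_smul, inv_mul_cancel₀ hd0, one_smul]
      have h5 := hf (e.symm (n, 0)).1
      rw [← h3] at h5
      have h6 : e ((e.symm (n, 0)).1, (e.symm (n, 0)).2) = (n, 0) := e.apply_symm_apply _
      rw [h6] at h5
      exact (congrArg Prod.fst h5).symm
    refine ⟨LinearEquiv.ofBijective f ⟨hinj, hsurj⟩, fun x m => ?_⟩
    change f (π x m) = θ x (f m)
    have h1 := he x (m, -(d⁻¹ • (e (m, 0)).2))
    rw [hf] at h1
    have h2 := congrArg Prod.snd (he x (m, 0))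
    simp only [prodRep_apply, map_zero, map_neg, map_smul] at h1 h2
    rw [← h2, hf] at h1
    exact congrArg Prod.fst h1

/-- One factor is cancelled at a time. The family is indexed by `ℕ` rather than by `Fin n` so that
the induction can shift it. -/
theorem RepIso.cancel_pi {n : ℕ} {L : ℕ → Type} [∀ i, AddCommGroup (L i)]
    [∀ i, Module ℂ (L i)] {ψ : ∀ i, X → Module.End ℂ (L i)} (hs : ∀ i < n, ScalarCommutant (ψ i))
    (h : RepIso (prodRep π (piRep fun i : Fin n => ψ i)) (prodRep θ (piRep fun i : Fin n => ψ i))) :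
    RepIso π θ := by
  induction n generalizing L with
  | zero => exact (RepIso.pi_zero.symm.trans h).trans RepIso.pi_zero
  | succ n ih =>
    have key : ∀ {M : Type} [AddCommGroup M] [Module ℂ M] (π : X → Module.End ℂ M),
        RepIso (prodRep π (piRep fun i : Fin (n + 1) => ψ i))
          (prodRep (prodRep π (piRep fun i : Fin n => ψ (i + 1))) (ψ 0)) := fun π =>
      ((RepIso.refl π).prod (RepIso.pi_succ.trans RepIso.prod_comm)).trans RepIso.prod_assoc.symm
    exact ih (fun i hi => hs (i + 1) (by omega))
      (RepIso.cancel (hs 0 (by omega)) (((key π).symm.trans h).trans (key θ)))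

end RepIso

end SpinCG

namespace SpinCG

/-! ### Ladder generators -/

namespace Spin31

/-- `J₊` and `J₋`. -/
noncomputable def Jladder (ε : ℤˣ) : Spin31 := J 1 + ((ε : ℤ) * Complex.I) • J 2
/-- `K₊` and `K₋`. -/
noncomputable def Kladder (ε : ℤˣ) : Spin31 := K 1 + ((ε : ℤ) * Complex.I) • K 2

theorem ext_coord {x y : Spin31} (h : ∀ i, rot x i = rot y i) (h' : ∀ i, boost x i = boost y i) :
    x = y := ext' (funext h) (funext h')

@[simp] theorem rot_J (a : Fin 3) : rot (J a) = Pi.single a 1 := rfl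
@[simp] theorem boost_J (a : Fin 3) : boost (J a) = 0 := rfl
@[simp] theorem rot_K (a : Fin 3) : rot (K a) = 0 := rfl
@[simp] theorem boost_K (a : Fin 3) : boost (K a) = Pi.single a 1 := rfl

theorem J_one_eq : J 1 = (1 / 2 : ℂ) • (Jladder 1 + Jladder (-1)) := by
  simp only [Jladder, Units.val_one, Units.val_neg]
  push_cast
  module

theorem J_two_eq : J 2 = (-Complex.I / 2) • (Jladder 1 - Jladder (-1)) := by
  simp only [Jladder, Units.val_one, Units.val_neg]
  push_cast
  match_scalars <;> ring_nf
  simp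

theorem K_one_eq : K 1 = (1 / 2 : ℂ) • (Kladder 1 + Kladder (-1)) := by
  simp only [Kladder, Units.val_one, Units.val_neg]
  push_cast
  module

theorem K_two_eq : K 2 = (-Complex.I / 2) • (Kladder 1 - Kladder (-1)) := by
  simp only [Kladder, Units.val_one, Units.val_neg]
  push_cast
  match_scalars <;> ring_nf
  simp

theorem sum_eq (x : Spin31) :
    x = rot x 0 • J 0 + rot x 1 • J 1 + rot x 2 • J 2
      + boost x 0 • K 0 + boost x 1 • K 1 + boost x 2 • K 2 := by
  apply ext_coord <;> intro i <;> fin_cases i <;> simp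

theorem lie_Jladder : ⁅Jladder 1, Jladder (-1)⁆ = (2 : ℂ) • J 0 := by
  apply ext_coord <;> intro i <;> fin_cases i <;>
    simp [rot_lie, boost_lie, Jladder, cross_apply]
  ring_nf

theorem lie_K_Jladder (ε : ℤˣ) : ⁅K 0, Jladder ε⁆ = ((ε : ℤ) : ℂ) • Kladder ε := by
  rcases Int.units_eq_one_or ε with rfl | rfl <;>
  apply ext_coord <;> intro i <;> fin_cases i <;>
    simp [rot_lie, boost_lie, Jladder, Kladder, cross_apply]

/-- A converse to `LadderRelations.map_lie`, valid on every module: identities between Casimirs and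
generators become commutator algebra in `Module.End`. -/
theorem ladderRelations (M : Type) [AddCommGroup M] [Module ℂ M] [LieRingModule Spin31 M]
    [LieModule ℂ Spin31 M] :
    LadderRelations (LieModule.toEnd ℂ Spin31 M (J 0)) (LieModule.toEnd ℂ Spin31 M (Jladder 1))
      (LieModule.toEnd ℂ Spin31 M (Jladder (-1))) (LieModule.toEnd ℂ Spin31 M (K 0))
      (LieModule.toEnd ℂ Spin31 M (Kladder 1)) (LieModule.toEnd ℂ Spin31 M (Kladder (-1))) := by
  have key : ∀ {x y z : Spin31}, ⁅x, y⁆ = z → LieModule.toEnd ℂ Spin31 M x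
      * LieModule.toEnd ℂ Spin31 M y - LieModule.toEnd ℂ Spin31 M y * LieModule.toEnd ℂ Spin31 M x
      = LieModule.toEnd ℂ Spin31 M z := fun {x y z} h => by
    ext m
    simp [← h]
  constructor <;>
    (try simp only [← map_neg, ← map_smul, ← map_zero (LieModule.toEnd ℂ Spin31 M)]) <;>
    apply key <;> apply ext_coord <;> intro i <;> fin_cases i <;>
    simp [rot_lie, boost_lie, Jladder, Kladder, cross_apply]
  all_goals
    ring_nf
    try rw [Complex.I_sq]
    try norm_num

/-- The generators `J₊`, `J₋`, `K₀` span the Lie algebra under brackets. -/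
theorem induction_ladder {p : Spin31 → Prop} (add : ∀ x y, p x → p y → p (x + y))
    (smul : ∀ (c : ℂ) x, p x → p (c • x)) (lie : ∀ x y, p x → p y → p ⁅x, y⁆)
    (hJ : ∀ ε, p (Jladder ε)) (hK : p (K 0)) (x : Spin31) : p x := by
  have sub : ∀ x y, p x → p y → p (x - y) := fun x y hx hy => by
    have := add _ _ hx (smul (-1) _ hy)
    rwa [neg_one_smul, ← sub_eq_add_neg] at this
  have hJ0 : p (J 0) := by
    have := smul (1 / 2) _ (lie _ _ (hJ 1) (hJ (-1)))
    rwa [lie_Jladder, smul_smul, show (1 / 2 * 2 : ℂ) = 1 by norm_num, one_smul] at this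
  have hKl : ∀ ε, p (Kladder ε) := fun ε => by
    have := smul ((ε : ℤ) : ℂ) _ (lie _ _ hK (hJ ε))
    rw [lie_K_Jladder, smul_smul] at this
    rcases Int.units_eq_one_or ε with rfl | rfl <;> simpa using this
  have h1 : p (J 1) := J_one_eq ▸ smul _ _ (add _ _ (hJ 1) (hJ (-1)))
  have h2 : p (J 2) := J_two_eq ▸ smul _ _ (sub _ _ (hJ 1) (hJ (-1)))
  have h3 : p (K 1) := K_one_eq ▸ smul _ _ (add _ _ (hKl 1) (hKl (-1)))
  have h4 : p (K 2) := K_two_eq ▸ smul _ _ (sub _ _ (hKl 1) (hKl (-1)))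
  rw [sum_eq x]
  exact add _ _ (add _ _ (add _ _ (add _ _ (add _ _ (smul _ _ hJ0) (smul _ _ h1)) (smul _ _ h2))
    (smul _ _ hK)) (smul _ _ h3)) (smul _ _ h4)

end Spin31

open Spin31

/-! ### Equivariance on generators and invariance of the Casimirs -/

section Equivariance

variable {M N : Type} [AddCommGroup M] [Module ℂ M] [LieRingModule Spin31 M]
  [LieModule ℂ Spin31 M] [AddCommGroup N] [Module ℂ N] [LieRingModule Spin31 N]
  [LieModule ℂ Spin31 N]

/-- The elements `J_±` and `K₀` generate the Lie algebra, and the set of elements commuting with `f`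
is closed under linear combinations and brackets. Every intertwiner below is verified on these three
elements only. -/
theorem map_lie_of_ladder (f : M →ₗ[ℂ] N) (hJ : ∀ ε m, f ⁅Jladder ε, m⁆ = ⁅Jladder ε, f m⁆)
    (hK : ∀ m, f ⁅K 0, m⁆ = ⁅K 0, f m⁆) (x : Spin31) (m : M) : f ⁅x, m⁆ = ⁅x, f m⁆ := by
  induction x using induction_ladder generalizing m with
  | add x y hx hy => simp only [add_lie, map_add, hx, hy]
  | smul c x hx => simp only [smul_lie, map_smul, hx]
  | lie x y hx hy => simp only [lie_lie, map_sub, hx, hy]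
  | hJ ε => exact hJ ε m
  | hK => exact hK m

variable (M) in
theorem casimir1_eq_ladder : casimir1 M =
    LieModule.toEnd ℂ Spin31 M (J 0) * LieModule.toEnd ℂ Spin31 M (K 0)
      + (1 / 2 : ℂ) • (LieModule.toEnd ℂ Spin31 M (Jladder 1)
          * LieModule.toEnd ℂ Spin31 M (Kladder (-1))
        + LieModule.toEnd ℂ Spin31 M (Jladder (-1))
          * LieModule.toEnd ℂ Spin31 M (Kladder 1)) := by
  rw [casimir1, Fin.sum_univ_three, J_one_eq, J_two_eq, K_one_eq, K_two_eq]
  simp only [map_smul, map_add, map_sub, smul_mul_assoc, mul_smul_comm, add_mul, mul_add,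
    sub_mul, mul_sub]
  match_scalars <;> ring_nf <;> simp <;> ring

variable (M) in
theorem casimir2_eq_ladder : casimir2 M =
    (LieModule.toEnd ℂ Spin31 M (J 0) * LieModule.toEnd ℂ Spin31 M (J 0)
      + (1 / 2 : ℂ) • (LieModule.toEnd ℂ Spin31 M (Jladder 1)
          * LieModule.toEnd ℂ Spin31 M (Jladder (-1))
        + LieModule.toEnd ℂ Spin31 M (Jladder (-1))
          * LieModule.toEnd ℂ Spin31 M (Jladder 1)))
      - (LieModule.toEnd ℂ Spin31 M (K 0) * LieModule.toEnd ℂ Spin31 M (K 0)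
      + (1 / 2 : ℂ) • (LieModule.toEnd ℂ Spin31 M (Kladder 1)
          * LieModule.toEnd ℂ Spin31 M (Kladder (-1))
        + LieModule.toEnd ℂ Spin31 M (Kladder (-1))
          * LieModule.toEnd ℂ Spin31 M (Kladder 1))) := by
  rw [casimir2, Fin.sum_univ_three, Fin.sum_univ_three, J_one_eq, J_two_eq, K_one_eq, K_two_eq]
  simp only [map_smul, map_add, map_sub, smul_mul_assoc, mul_smul_comm, add_mul, mul_add,
    sub_mul, mul_sub]
  match_scalars <;> ring_nf <;> simp <;> ring

theorem commute_toEnd_of_ladder (C : Module.End ℂ M)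
    (hJ : ∀ ε, LieModule.toEnd ℂ Spin31 M (Jladder ε) * C
      - C * LieModule.toEnd ℂ Spin31 M (Jladder ε) = 0)
    (hK : LieModule.toEnd ℂ Spin31 M (K 0) * C - C * LieModule.toEnd ℂ Spin31 M (K 0) = 0) (x : Spin31) (m : M) :
    C ⁅x, m⁆ = ⁅x, C m⁆ := by
  refine map_lie_of_ladder C (fun ε m => ?_) (fun m => ?_) x m
  · have := LinearMap.congr_fun (hJ ε) m
    exact (sub_eq_zero.1 this).symm
  · have := LinearMap.congr_fun hK m
    exact (sub_eq_zero.1 this).symm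

/-- Bracketing with a generator is a derivation of `Module.End`, so the commutators with `J_±` and
`K₀` can be evaluated factor by factor from the bracket table. -/
theorem casimir_lie (x : Spin31) (m : M) :
    casimir1 M ⁅x, m⁆ = ⁅x, casimir1 M m⁆ ∧ casimir2 M ⁅x, m⁆ = ⁅x, casimir2 M m⁆ := by
  let := LieRing.ofAssociativeRing (A := Module.End ℂ M)
  let := LieAlgebra.ofAssociativeAlgebra (R := ℂ) (A := Module.End ℂ M)
  have hmul : ∀ a b c : Module.End ℂ M, ⁅a, b * c⁆ = ⁅a, b⁆ * c + b * ⁅a, c⁆ := fun a b c => by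
    simp only [LieRing.of_associative_ring_bracket]; noncomm_ring
  obtain ⟨h1, h2, h3, h4, h5, h6, h7, h8, h9, h10, h11, h12, h13, h14, h15⟩ := ladderRelations M
  simp only [← LieRing.of_associative_ring_bracket] at h1 h2 h3 h4 h5 h6 h7 h8 h9 h10 h11 h12 h13 h14 h15
  have r1 := (lie_skew _ _).trans h1
  have r2 := (lie_skew _ _).trans h2
  have r3 := (lie_skew _ _).trans h3
  have r4 := (lie_skew _ _).trans h4
  have r7 := (lie_skew _ _).trans h7
  have r8 := (lie_skew _ _).trans h8
  rw [neg_eq_iff_eq_neg] at r1 r2 r3 r4 r7 r8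
  constructor <;> refine commute_toEnd_of_ladder _ (fun ε => ?_) ?_ x m <;>
      rw [← LieRing.of_associative_ring_bracket]
  · rw [casimir1_eq_ladder]
    rcases Int.units_eq_one_or ε with rfl | rfl
    · simp only [lie_add, lie_smul, hmul, lie_self, h3, h7, h9, h11, r1]
      noncomm_ring; module
    · simp only [lie_add, lie_smul, hmul, lie_self, h8, h10, h12, r2, r3]
      noncomm_ring; module
  · rw [casimir1_eq_ladder]
    simp only [lie_add, lie_smul, hmul, lie_self, h13, h14, r4, r7, r8]
    -- What is left is half of `[J₊, J₋] + [K₊, K₋]`; the two brackets are `2 J₀` and `-2 J₀`.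
    have k3 := (ladderRelations M).jpm
    have k15 := (ladderRelations M).kpm
    rw [sub_eq_iff_eq_add] at k3 k15
    noncomm_ring
    rw [k3, k15]
    module
  · rw [casimir2_eq_ladder]
    rcases Int.units_eq_one_or ε with rfl | rfl
    · simp only [lie_add, lie_sub, lie_smul, hmul, lie_self, h3, h7, h9, h11, r1]
      noncomm_ring; try module
    · simp only [lie_add, lie_sub, lie_smul, hmul, lie_self, h8, h10, h12, r2, r3]
      noncomm_ring; try module
  · rw [casimir2_eq_ladder]
    simp only [lie_add, lie_sub, lie_smul, hmul, lie_self, h13, h14, r4, r7, r8]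
    noncomm_ring; try module

end Equivariance

/-! ### Action of the generators on the modules -/

theorem actionOfLadder_generators {M : Type} [AddCommGroup M] [Module ℂ M]
    (J0 Jp Jm K0 Kp Km : Module.End ℂ M) :
    actionOfLadder J0 Jp Jm K0 Kp Km (J 0) = J0 ∧
    actionOfLadder J0 Jp Jm K0 Kp Km (Jladder 1) = Jp ∧
    actionOfLadder J0 Jp Jm K0 Kp Km (Jladder (-1)) = Jm ∧
    actionOfLadder J0 Jp Jm K0 Kp Km (K 0) = K0 ∧
    actionOfLadder J0 Jp Jm K0 Kp Km (Kladder 1) = Kp ∧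
    actionOfLadder J0 Jp Jm K0 Kp Km (Kladder (-1)) = Km := by
  refine ⟨?_, ?_, ?_, ?_, ?_, ?_⟩ <;> simp [actionOfLadder, Jladder, Kladder] <;>
    match_scalars <;> ring_nf <;> simp <;> ring

namespace IrrMod

variable (l : ℤ) (ρ : ℂ)

theorem lie_J (v : IrrMod l ρ) : ⁅Spin31.J 0, v⁆ = J0 l ρ v :=
  LinearMap.congr_fun (actionOfLadder_generators _ _ _ _ _ _).1 v

theorem lie_Jladder (ε : ℤˣ) (v : IrrMod l ρ) : ⁅Jladder ε, v⁆ = Jpm l ρ ε v := by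
  rcases Int.units_eq_one_or ε with rfl | rfl
  · exact LinearMap.congr_fun (actionOfLadder_generators _ _ _ _ _ _).2.1 v
  · exact LinearMap.congr_fun (actionOfLadder_generators _ _ _ _ _ _).2.2.1 v

theorem lie_K (v : IrrMod l ρ) : ⁅Spin31.K 0, v⁆ = K0 l ρ v :=
  LinearMap.congr_fun (actionOfLadder_generators _ _ _ _ _ _).2.2.2.1 v

end IrrMod

namespace FinMod

variable (A : ℤˣ) (g : ℤ)

theorem lie_J (v : FinMod A g) : ⁅Spin31.J 0, v⁆ = J0 A g v :=
  LinearMap.congr_fun (actionOfLadder_generators _ _ _ _ _ _).1 v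

theorem lie_Jladder (ε : ℤˣ) (v : FinMod A g) : ⁅Jladder ε, v⁆ = Jpm A g ε v := by
  rcases Int.units_eq_one_or ε with rfl | rfl
  · exact LinearMap.congr_fun (actionOfLadder_generators _ _ _ _ _ _).2.1 v
  · exact LinearMap.congr_fun (actionOfLadder_generators _ _ _ _ _ _).2.2.1 v

theorem lie_K (v : FinMod A g) : ⁅Spin31.K 0, v⁆ = K0 A g v :=
  LinearMap.congr_fun (actionOfLadder_generators _ _ _ _ _ _).2.2.2.1 v

theorem lie_Kladder (ε : ℤˣ) (v : FinMod A g) : ⁅Kladder ε, v⁆ = Kpm A g ε v := by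
  rcases Int.units_eq_one_or ε with rfl | rfl
  · exact LinearMap.congr_fun (actionOfLadder_generators _ _ _ _ _ _).2.2.2.2.1 v
  · exact LinearMap.congr_fun (actionOfLadder_generators _ _ _ _ _ _).2.2.2.2.2 v

/-- Boosts act on `F^A_γ` as multiples of rotations. -/
theorem lie_K_eq (a : Fin 3) (v : FinMod A g) :
    ⁅Spin31.K a, v⁆ = (Complex.I * (A : ℤ)) • ⁅Spin31.J a, v⁆ := by
  fin_cases a
  · change ⁅Spin31.K 0, v⁆ = _ • ⁅Spin31.J 0, v⁆
    rw [lie_J, lie_K, K0_eq, LinearMap.smul_apply]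
  · change ⁅Spin31.K 1, v⁆ = _ • ⁅Spin31.J 1, v⁆
    simp only [J_one_eq, K_one_eq, smul_lie, add_lie, lie_Jladder, lie_Kladder, Kpm_eq,
      LinearMap.smul_apply]
    module
  · change ⁅Spin31.K 2, v⁆ = _ • ⁅Spin31.J 2, v⁆
    simp only [J_two_eq, K_two_eq, smul_lie, sub_lie, lie_Jladder, lie_Kladder, Kpm_eq,
      LinearMap.smul_apply]
    module

end FinMod

end SpinCG

namespace SpinCG

open Spin31

/-! ### An unnormalised model of `V_{λ,ρ}` -/

/-- The space on which the unnormalised operators act. -/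
abbrev Formal : Type := ℤ × ℤ →₀ ℂ

namespace Formal

/-- The unnormalised vector with labels `(a, b) = (2j, 2m)`. -/
noncomputable def e (a b : ℤ) : Formal := Finsupp.single (a, b) 1

/-- The operator with prescribed values on the vectors `e a b`. -/
noncomputable def op (f : ℤ → ℤ → Formal) : Module.End ℂ Formal :=
  Finsupp.linearCombination ℂ fun p : ℤ × ℤ => f p.1 p.2

@[simp] theorem op_e (f : ℤ → ℤ → Formal) (a b : ℤ) : op f (e a b) = f a b := by
  simp [op, e]

/-- The raising coefficient of the boosts. -/
noncomputable def up (σ : ℂ) (a : ℤ) : ℂ := (a + 2 - 2 * σ) / (((a : ℂ) + 1) * (a + 2))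
/-- The diagonal coefficient of the boosts. -/
noncomputable def mid (l : ℤ) (σ : ℂ) (a : ℤ) : ℂ :=
  2 * l * σ / (a * (a + 2))
/-- The lowering coefficient of the boosts. -/
noncomputable def down (l : ℤ) (σ : ℂ) (a : ℤ) : ℂ :=
  -(((a : ℂ) - l) * (a + l) * (a + 2 * σ)) / (4 * (a * (a + 1)))

/-- `J₀` on unnormalised vectors. -/
noncomputable def J0 : Module.End ℂ Formal := op fun a b => (b / 2 : ℂ) • e a b

/-- `J_±` on unnormalised vectors. -/
noncomputable def Jpm (ε : ℤˣ) : Module.End ℂ Formal := op fun a b =>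
  ((a : ℂ) / 2 - (ε : ℤ) * (b / 2)) • e a (b + 2 * ε)

/-- `K₀` on unnormalised vectors, up to the factor `iA`. -/
noncomputable def K0 (l : ℤ) (σ : ℂ) : Module.End ℂ Formal := op fun a b =>
  up σ a • e (a + 2) b + (mid l σ a * (b / 2)) • e a b
    + (down l σ a * ((a : ℂ) / 2 + b / 2) * ((a : ℂ) / 2 - b / 2)) • e (a - 2) b

/-- The doublet of multiplication operators, from parameters `(λ, σ)` to `(λ + 1/2, σ + 1/2)`. -/
noncomputable def Z (l : ℤ) (ε : ℤˣ) : Module.End ℂ Formal := op fun a b =>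
  (1 / ((a : ℂ) + 1)) • e (a + 1) (b + ε)
    + (-((ε : ℤ) : ℂ) * ((a : ℂ) / 2 - l / 2) * ((a : ℂ) / 2 - (ε : ℤ) * (b / 2)) / ((a : ℂ) + 1)) •
      e (a - 1) (b + ε)

/-- The doublet of differentiation operators, from parameters `(λ, σ)` to
`(λ - 1/2, σ - 1/2)`. -/
noncomputable def D (l : ℤ) (σ : ℂ) (ε : ℤˣ) : Module.End ℂ Formal := op fun a b =>
  ((σ - 1 - (a : ℂ) / 2) / ((a : ℂ) + 1)) • e (a + 1) (b + ε)
    + (((ε : ℤ) : ℂ) * ((a : ℂ) / 2 + l / 2) * ((a : ℂ) / 2 + σ)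
        * ((a : ℂ) / 2 - (ε : ℤ) * (b / 2)) / ((a : ℂ) + 1)) • e (a - 1) (b + ε)

/-- The labels of the infinite-dimensional modules with `λ = l / 2`. -/
def Label (l a b : ℤ) : Prop := |l| ≤ a ∧ (2 : ℤ) ∣ a - l ∧ b ∈ weights a

section relations

variable (l : ℤ) (σ : ℂ) {a b : ℤ}

/-- This and the next three lemmas express that `Z` and `D` transform under rotations like the basis
of the spin 1/2 module. The bound on `a` keeps the denominator `a + 1` away from zero. -/
theorem Jpm_Z_same (ε : ℤˣ) (h : 0 ≤ a) :
    Jpm ε (Z l ε (e a b)) = Z l ε (Jpm ε (e a b)) := by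
  have h1 : (a : ℂ) + 1 ≠ 0 := by exact_mod_cast (by omega : a + 1 ≠ 0)
  rcases Int.units_eq_one_or ε with rfl | rfl <;>
  · simp only [Jpm, Z, op_e, map_add, map_smul, Units.val_one, Units.val_neg]
    push_cast
    ring_nf
    match_scalars <;> field_simp <;> ring

theorem Jpm_Z_opp (ε : ℤˣ) (h : 0 ≤ a) :
    Jpm ε (Z l (-ε) (e a b)) = Z l ε (e a b) + Z l (-ε) (Jpm ε (e a b)) := by
  have h1 : (a : ℂ) + 1 ≠ 0 := by exact_mod_cast (by omega : a + 1 ≠ 0)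
  rcases Int.units_eq_one_or ε with rfl | rfl <;>
  · simp only [Jpm, Z, op_e, map_add, map_smul, Units.val_one, Units.val_neg, neg_neg]
    push_cast
    ring_nf
    match_scalars <;> field_simp <;> ring

theorem Jpm_D_same (ε : ℤˣ) (h : 0 ≤ a) :
    Jpm ε (D l σ ε (e a b)) = D l σ ε (Jpm ε (e a b)) := by
  have h1 : (a : ℂ) + 1 ≠ 0 := by exact_mod_cast (by omega : a + 1 ≠ 0)
  rcases Int.units_eq_one_or ε with rfl | rfl <;>
  · simp only [Jpm, D, op_e, map_add, map_smul, Units.val_one, Units.val_neg]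
    push_cast
    ring_nf
    match_scalars <;> field_simp <;> ring

theorem Jpm_D_opp (ε : ℤˣ) (h : 0 ≤ a) :
    Jpm ε (D l σ (-ε) (e a b)) = D l σ ε (e a b) + D l σ (-ε) (Jpm ε (e a b)) := by
  have h1 : (a : ℂ) + 1 ≠ 0 := by exact_mod_cast (by omega : a + 1 ≠ 0)
  rcases Int.units_eq_one_or ε with rfl | rfl <;>
  · simp only [Jpm, D, op_e, map_add, map_smul, Units.val_one, Units.val_neg, neg_neg]
    push_cast
    ring_nf
    match_scalars <;> field_simp <;> ring

/-- The relations of `K₀` with `Z` and `D` involve the denominators `a` and `a - 1`. At `a = 0` and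
`a = 1` the coefficients take the default value of division by zero, so the finitely many labels
there are checked by hand. -/
theorem Label.zero_or_one_or_two_le {l a b : ℤ} (h : Label l a b) :
    (a = 0 ∧ l = 0 ∧ b = 0) ∨ (a = 1 ∧ (l = 1 ∨ l = -1) ∧ (b = 1 ∨ b = -1)) ∨ 2 ≤ a := by
  obtain ⟨h1, h2, h3, h4, h5⟩ := h
  rw [abs_le] at h1
  omega

theorem index_identities (a : ℤ) : a + 1 + 2 = a + 3 ∧ a + 2 + 1 = a + 3 ∧ a + 1 - 2 = a - 1 ∧
    a - 1 + 2 = a + 1 ∧ a - 1 - 2 = a - 3 ∧ a - 2 - 1 = a - 3 ∧ a - 2 + 1 = a - 1 ∧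
    a + 2 - 1 = a + 1 := by omega

theorem cast_identities (a : ℂ) : a + 1 + 1 = a + 2 ∧ a + 1 + 2 = a + 3 ∧ a - 1 + 1 = a ∧
    a - 1 + 2 = a + 1 ∧ a + 2 + 1 = a + 3 ∧ a - 2 + 1 = a - 1 ∧ a + 2 + 2 = a + 4 := by
  refine ⟨?_, ?_, ?_, ?_, ?_, ?_, ?_⟩ <;> ring

/-- The factor `a + 2 - 2σ` in `up` is unchanged under `(a, σ) ↦ (a + 1, σ + 1/2)`; this is why
multiplication leads to the parameters `(λ + 1/2, σ + 1/2)`. The extra term is the weight `ε/2` of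
the doublet itself, in units of `iA`. -/
theorem K0_Z (ε : ℤˣ) (h : Label l a b) :
    K0 (l + 1) (σ + 1 / 2) (Z l ε (e a b))
      = Z l ε (K0 l σ (e a b)) + (((ε : ℤ) : ℂ) / 2) • Z l ε (e a b) := by
  rcases h.zero_or_one_or_two_le with ⟨rfl, rfl, rfl⟩ | ⟨rfl, hl, hb⟩ | h2
  · rcases Int.units_eq_one_or ε with rfl | rfl <;>
    · simp only [K0, Z, op_e, map_add, map_smul, Units.val_one, Units.val_neg, up, mid, down]
      norm_num
      try match_scalars <;> ring
  · rcases hl with rfl | rfl <;> rcases hb with rfl | rfl <;>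
    rcases Int.units_eq_one_or ε with rfl | rfl <;>
    · simp only [K0, Z, op_e, map_add, map_smul, Units.val_one, Units.val_neg, up, mid, down]
      norm_num
      try match_scalars <;> ring
  · have h1 : (a : ℂ) + 1 ≠ 0 := by exact_mod_cast (by omega : a + 1 ≠ 0)
    have h0 : (a : ℂ) ≠ 0 := by exact_mod_cast (by omega : a ≠ 0)
    have h3 : (a : ℂ) + 2 ≠ 0 := by exact_mod_cast (by omega : a + 2 ≠ 0)
    have h4 : (a : ℂ) + 3 ≠ 0 := by exact_mod_cast (by omega : a + 3 ≠ 0)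
    have h5 : (a : ℂ) - 1 ≠ 0 := by exact_mod_cast (by omega : a - 1 ≠ 0)
    rcases Int.units_eq_one_or ε with rfl | rfl <;>
    · simp only [K0, Z, op_e, map_add, map_smul, Units.val_one, Units.val_neg, up, mid, down,
        index_identities a]
      push_cast
      simp only [cast_identities]
      match_scalars <;> field_simp <;> ring

theorem K0_D (ε : ℤˣ) (h : Label l a b) :
    K0 (l - 1) (σ - 1 / 2) (D l σ ε (e a b))
      = D l σ ε (K0 l σ (e a b)) + (((ε : ℤ) : ℂ) / 2) • D l σ ε (e a b) := by
  rcases h.zero_or_one_or_two_le with ⟨rfl, rfl, rfl⟩ | ⟨rfl, hl, hb⟩ | h2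
  · rcases Int.units_eq_one_or ε with rfl | rfl <;>
    · simp only [K0, D, op_e, map_add, map_smul, Units.val_one, Units.val_neg, up, mid, down]
      norm_num
      try match_scalars <;> ring
  · rcases hl with rfl | rfl <;> rcases hb with rfl | rfl <;>
    rcases Int.units_eq_one_or ε with rfl | rfl <;>
    · simp only [K0, D, op_e, map_add, map_smul, Units.val_one, Units.val_neg, up, mid, down]
      norm_num
      try match_scalars <;> ring
  · have h1 : (a : ℂ) + 1 ≠ 0 := by exact_mod_cast (by omega : a + 1 ≠ 0)
    have h0 : (a : ℂ) ≠ 0 := by exact_mod_cast (by omega : a ≠ 0)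
    have h3 : (a : ℂ) + 2 ≠ 0 := by exact_mod_cast (by omega : a + 2 ≠ 0)
    have h4 : (a : ℂ) + 3 ≠ 0 := by exact_mod_cast (by omega : a + 3 ≠ 0)
    have h5 : (a : ℂ) - 1 ≠ 0 := by exact_mod_cast (by omega : a - 1 ≠ 0)
    rcases Int.units_eq_one_or ε with rfl | rfl <;>
    · simp only [K0, D, op_e, map_add, map_smul, Units.val_one, Units.val_neg, up, mid, down,
        index_identities a]
      push_cast
      simp only [cast_identities]
      match_scalars <;> field_simp <;> ring

theorem half_index_identities (a : ℤ) : a + 1 + 1 = a + 2 ∧ a + 1 - 1 = a ∧ a - 1 + 1 = a ∧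
    a - 1 - 1 = a - 2 ∧ a + 1 + -1 = a ∧ a + -1 + 1 = a ∧ a + -1 + -1 = a - 2 := by omega

theorem Z_comm (h : Label l a b) :
    Z (l + 1) 1 (Z l (-1) (e a b)) = Z (l + 1) (-1) (Z l 1 (e a b)) := by
  obtain ⟨rfl, rfl, rfl⟩ | h2 : (a = 0 ∧ l = 0 ∧ b = 0) ∨ 1 ≤ a := by
    rcases h.zero_or_one_or_two_le with h | h | h <;> omega
  · simp only [Z, op_e, map_add, map_smul, Units.val_one, Units.val_neg]
    norm_num
  · have h1 : (a : ℂ) + 1 ≠ 0 := by exact_mod_cast (by omega : a + 1 ≠ 0)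
    have h0 : (a : ℂ) ≠ 0 := by exact_mod_cast (by omega : a ≠ 0)
    have h3 : (a : ℂ) + 2 ≠ 0 := by exact_mod_cast (by omega : a + 2 ≠ 0)
    simp only [Z, op_e, map_add, map_smul, Units.val_one, Units.val_neg,
      half_index_identities]
    push_cast
    simp only [cast_identities]
    match_scalars <;> field_simp <;> ring

theorem D_comm (h : Label l a b) :
    D (l - 1) (σ - 1 / 2) 1 (D l σ (-1) (e a b))
      = D (l - 1) (σ - 1 / 2) (-1) (D l σ 1 (e a b)) := by
  obtain ⟨rfl, rfl, rfl⟩ | h2 : (a = 0 ∧ l = 0 ∧ b = 0) ∨ 1 ≤ a := by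
    rcases h.zero_or_one_or_two_le with h | h | h <;> omega
  · simp only [D, op_e, map_add, map_smul, Units.val_one, Units.val_neg]
    norm_num
  · have h1 : (a : ℂ) + 1 ≠ 0 := by exact_mod_cast (by omega : a + 1 ≠ 0)
    have h0 : (a : ℂ) ≠ 0 := by exact_mod_cast (by omega : a ≠ 0)
    have h3 : (a : ℂ) + 2 ≠ 0 := by exact_mod_cast (by omega : a + 2 ≠ 0)
    simp only [D, op_e, map_add, map_smul, Units.val_one, Units.val_neg,
      half_index_identities]
    push_cast
    simp only [cast_identities]
    match_scalars <;> field_simp <;> ring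

/-- The model is `D ε = ε ∂/∂z_{-ε}` and `Z ε = z_ε`. The left side is then the Euler operator, and
the scalar is the degree of homogeneity `x - 1` with `x = λ + σ`. The three lemmas that follow are
the other Weyl relations: the Euler operator plus two, the commutation of `∂/∂z_{-ε}` with `z_ε`,
and `ε` times the Euler operator plus one. -/
theorem Z_D_sub (h : Label l a b) :
    Z (l - 1) (-1) (D l σ 1 (e a b)) - Z (l - 1) 1 (D l σ (-1) (e a b))
      = ((l : ℂ) / 2 + σ - 1) • e a b := by
  obtain ⟨rfl, rfl, rfl⟩ | h2 : (a = 0 ∧ l = 0 ∧ b = 0) ∨ 1 ≤ a := by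
    rcases h.zero_or_one_or_two_le with h | h | h <;> omega
  · simp only [Z, D, op_e, map_add, map_smul, Units.val_one, Units.val_neg]
    norm_num
    try match_scalars <;> ring
  · have h1 : (a : ℂ) + 1 ≠ 0 := by exact_mod_cast (by omega : a + 1 ≠ 0)
    have h0 : (a : ℂ) ≠ 0 := by exact_mod_cast (by omega : a ≠ 0)
    have h3 : (a : ℂ) + 2 ≠ 0 := by exact_mod_cast (by omega : a + 2 ≠ 0)
    simp only [Z, D, op_e, map_add, map_smul, Units.val_one, Units.val_neg,
      half_index_identities]
    push_cast
    simp only [cast_identities]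
    match_scalars <;> field_simp <;> ring

theorem D_Z_sub (h : Label l a b) :
    D (l + 1) (σ + 1 / 2) 1 (Z l (-1) (e a b)) - D (l + 1) (σ + 1 / 2) (-1) (Z l 1 (e a b))
      = ((l : ℂ) / 2 + σ + 1) • e a b := by
  obtain ⟨rfl, rfl, rfl⟩ | h2 : (a = 0 ∧ l = 0 ∧ b = 0) ∨ 1 ≤ a := by
    rcases h.zero_or_one_or_two_le with h | h | h <;> omega
  · simp only [Z, D, op_e, map_add, map_smul, Units.val_one, Units.val_neg]
    norm_num
    try match_scalars <;> ring
  · have h1 : (a : ℂ) + 1 ≠ 0 := by exact_mod_cast (by omega : a + 1 ≠ 0)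
    have h0 : (a : ℂ) ≠ 0 := by exact_mod_cast (by omega : a ≠ 0)
    have h3 : (a : ℂ) + 2 ≠ 0 := by exact_mod_cast (by omega : a + 2 ≠ 0)
    simp only [Z, D, op_e, map_add, map_smul, Units.val_one, Units.val_neg,
      half_index_identities]
    push_cast
    simp only [cast_identities]
    match_scalars <;> field_simp <;> ring

theorem D_Z_same (ε : ℤˣ) (h : Label l a b) :
    D (l + 1) (σ + 1 / 2) ε (Z l ε (e a b)) = Z (l - 1) ε (D l σ ε (e a b)) := by
  obtain ⟨rfl, rfl, rfl⟩ | h2 : (a = 0 ∧ l = 0 ∧ b = 0) ∨ 1 ≤ a := by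
    rcases h.zero_or_one_or_two_le with h | h | h <;> omega
  · rcases Int.units_eq_one_or ε with rfl | rfl <;>
    · simp only [Z, D, op_e, map_add, map_smul, Units.val_one, Units.val_neg]
      norm_num
      try match_scalars <;> ring
  · have h1 : (a : ℂ) + 1 ≠ 0 := by exact_mod_cast (by omega : a + 1 ≠ 0)
    have h0 : (a : ℂ) ≠ 0 := by exact_mod_cast (by omega : a ≠ 0)
    have h3 : (a : ℂ) + 2 ≠ 0 := by exact_mod_cast (by omega : a + 2 ≠ 0)
    rcases Int.units_eq_one_or ε with rfl | rfl <;>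
    · simp only [Z, D, op_e, map_add, map_smul, Units.val_one, Units.val_neg,
        half_index_identities]
      push_cast
      simp only [cast_identities]
      match_scalars <;> field_simp <;> ring

theorem Z_D_sub_D_Z (ε : ℤˣ) (h : Label l a b) :
    Z (l - 1) (-ε) (D l σ ε (e a b)) - D (l + 1) (σ + 1 / 2) (-ε) (Z l ε (e a b))
      = (((ε : ℤ) : ℂ) * ((l : ℂ) / 2 + σ)) • e a b := by
  obtain ⟨rfl, rfl, rfl⟩ | h2 : (a = 0 ∧ l = 0 ∧ b = 0) ∨ 1 ≤ a := by
    rcases h.zero_or_one_or_two_le with h | h | h <;> omega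
  · rcases Int.units_eq_one_or ε with rfl | rfl <;>
    · simp only [Z, D, op_e, map_add, map_smul, Units.val_one, Units.val_neg, neg_neg]
      norm_num
      try match_scalars <;> ring
  · have h1 : (a : ℂ) + 1 ≠ 0 := by exact_mod_cast (by omega : a + 1 ≠ 0)
    have h0 : (a : ℂ) ≠ 0 := by exact_mod_cast (by omega : a ≠ 0)
    have h3 : (a : ℂ) + 2 ≠ 0 := by exact_mod_cast (by omega : a + 2 ≠ 0)
    rcases Int.units_eq_one_or ε with rfl | rfl <;>
    · simp only [Z, D, op_e, map_add, map_smul, Units.val_one, Units.val_neg, neg_neg,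
        half_index_identities]
      push_cast
      simp only [cast_identities]
      match_scalars <;> field_simp <;> ring

end relations

end Formal

end SpinCG

namespace SpinCG

open Spin31

/-! ### Comparison of the normalised and the unnormalised vectors -/

theorem sqrt_ne_zero' {z : ℂ} (h : z ≠ 0) : z.sqrt ≠ 0 := fun h0 => h (by
  rw [← sqrt_mul_self' z, h0, mul_zero])

/-- The product of the square roots of `1, …, n`. -/
noncomputable def rootFactorial (n : ℕ) : ℂ := ∏ i ∈ Finset.range n, ((i : ℂ) + 1).sqrt

theorem rootFactorial_succ (n : ℕ) :
    rootFactorial (n + 1) = rootFactorial n * ((n : ℂ) + 1).sqrt := Finset.prod_range_succ _ n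

theorem rootFactorial_ne_zero (n : ℕ) : rootFactorial n ≠ 0 :=
  Finset.prod_ne_zero_iff.2 fun i _ => sqrt_ne_zero' (by exact_mod_cast i.succ_ne_zero)

theorem rootFactorial_half {x y : ℤ} (hx : 0 ≤ x) (h2 : (2 : ℤ) ∣ x) (hy : y = x + 2) :
    rootFactorial (y / 2).toNat = rootFactorial (x / 2).toNat * ((x : ℂ) / 2 + 1).sqrt := by
  obtain ⟨k, rfl⟩ := h2
  obtain ⟨n, rfl⟩ := Int.eq_ofNat_of_zero_le (show 0 ≤ k by omega)
  have h1 : (y / 2).toNat = n + 1 := by omega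
  have h3 : ((2 * (n : ℤ)) / 2).toNat = n := by omega
  rw [h1, h3, rootFactorial_succ]
  congr 2
  push_cast; ring

theorem unit_mul_self (A : ℤˣ) : ((A : ℤ) : ℂ) * ((A : ℤ) : ℂ) = 1 := by
  rcases Int.units_eq_one_or A with rfl | rfl <;> simp

/-- The parameters for which all the coefficients `P⁺_{λ,ρ}` are nonzero. -/
def NonTerminating (l : ℤ) (ρ : ℂ) : Prop :=
  ∀ c : ℤ, |l| < c → (2 : ℤ) ∣ c - l → 2 * ρ ≠ c ∧ 2 * ρ ≠ -c

/-- Squaring removes the principal roots, so that zeros and products of the coefficients can be read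
off from a rational function. -/
theorem coeffPplus_sq (l : ℤ) (ρ : ℂ) {a : ℤ} (h : 0 ≤ a) : coeffPplus (l / 2) ρ (a / 2) ^ 2 =
    ((a + 2 : ℂ) ^ 2 - (l : ℂ) ^ 2) * (a + 2 - 2 * ρ) * (a + 2 + 2 * ρ)
      / (4 * ((a + 2) ^ 2 * ((a + 3) * (a + 1)))) := by
  rw [coeffPplus, IrrMod.coeffPminus_sq,
    show 2 * ((a : ℂ) / 2 + 1) + 1 = a + 3 by ring,
    show 2 * ((a : ℂ) / 2 + 1) - 1 = a + 1 by ring,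
    show (a : ℂ) / 2 + 1 = (a + 2) / 2 by ring]
  have h1 : (a : ℂ) + 1 ≠ 0 := by exact_mod_cast (by omega : a + 1 ≠ 0)
  have h2 : (a : ℂ) + 2 ≠ 0 := by exact_mod_cast (by omega : a + 2 ≠ 0)
  have h3 : (a : ℂ) + 3 ≠ 0 := by exact_mod_cast (by omega : a + 3 ≠ 0)
  field_simp
  ring

theorem NonTerminating.factors {l : ℤ} {ρ : ℂ} (h : NonTerminating l ρ) {a : ℤ} (ha : |l| ≤ a)
    (h2 : (2 : ℤ) ∣ a - l) : (a : ℂ) + 2 - 2 * ρ ≠ 0 ∧ (a : ℂ) + 2 + 2 * ρ ≠ 0 := by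
  obtain ⟨h1, h3⟩ := h (a + 2) (by omega) (by omega)
  push_cast at h1 h3
  exact ⟨fun h0 => h1 (by linear_combination -h0), fun h0 => h3 (by linear_combination h0)⟩

theorem NonTerminating.coeffPplus_ne_zero {l : ℤ} {ρ : ℂ} (h : NonTerminating l ρ) {a : ℤ}
    (ha : |l| ≤ a) (h2 : (2 : ℤ) ∣ a - l) : coeffPplus (l / 2) ρ (a / 2) ≠ 0 := by
  have h0 : 0 ≤ a := (abs_nonneg l).trans ha
  intro hP
  have hsq := coeffPplus_sq l ρ h0
  rw [hP] at hsq
  obtain ⟨f1, f2⟩ := h.factors ha h2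
  have h1 : (a : ℂ) + 1 ≠ 0 := by exact_mod_cast (by omega : a + 1 ≠ 0)
  have h4 : (a : ℂ) + 2 ≠ 0 := by exact_mod_cast (by omega : a + 2 ≠ 0)
  have h3 : (a : ℂ) + 3 ≠ 0 := by exact_mod_cast (by omega : a + 3 ≠ 0)
  have h5 : (a + 2 : ℂ) ^ 2 - (l : ℂ) ^ 2 ≠ 0 := by
    have : (a + 2) ^ 2 - l ^ 2 ≠ 0 := by
      rw [← sq_abs l]; nlinarith [abs_nonneg l]
    exact_mod_cast this
  have h7 : (4 : ℂ) ≠ 0 := by norm_num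
  exact div_ne_zero (mul_ne_zero (mul_ne_zero h5 f1) f2) (mul_ne_zero h7
    (mul_ne_zero (pow_ne_zero 2 h4) (mul_ne_zero h3 h1))) (by rw [← hsq]; ring)

/-- If `2ρ = ±c` for a forbidden `c`, then `P⁺` vanishes at `j = c/2 - 1`. The labels are therefore
confined to `a < c`, which leaves finitely many. -/
theorem nonTerminating_of_infinite {l : ℤ} {ρ : ℂ} (h : ¬ FiniteDimensional ℂ (IrrMod l ρ)) :
    NonTerminating l ρ := by
  intro c hc h2
  by_contra hρ
  refine h ?_
  have hP : coeffPplus (l / 2) ρ ((c - 2 : ℤ) / 2) = 0 := by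
    rw [← sq_eq_zero_iff, coeffPplus_sq]
    · rw [show (2 * ρ ≠ c ∧ 2 * ρ ≠ -c) ↔ ¬ (2 * ρ = c ∨ 2 * ρ = -c) by tauto, not_not] at hρ
      push_cast
      rcases hρ with h | h <;> rw [h] <;> ring
    · have : (2 : ℤ) ∣ |l| - l := by rcases abs_choice l with h | h <;> rw [h] <;> omega
      have := abs_nonneg l
      omega
  have hfin : (labels l ρ).Finite := by
    refine ((Set.finite_Icc 0 c).prod (Set.finite_Icc (-c) c)).subset ?_
    rintro ⟨a, b⟩ ⟨h1, h3, h4, h5⟩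
    simp only at h1 h3 h4 h5
    have hl : (2 : ℤ) ∣ |l| - l := by rcases abs_choice l with h | h <;> rw [h] <;> omega
    have hac : a < c := by
      by_contra hac
      exact h4 (c - 2) (by omega) (by omega) (by omega) hP
    have := abs_nonneg l
    simp only [weights, Set.mem_ofPred_eq] at h5
    simp only [Set.mem_prod, Set.mem_Icc]
    omega
  have := hfin.to_subtype
  exact Module.Finite.of_basis (IrrMod.basis l ρ)

/-- The truncation clause of `labels` is automatic here, and the label set no longer depends on `ρ`.
-/
theorem NonTerminating.mem_labels {l : ℤ} {ρ : ℂ} (h : NonTerminating l ρ) {a b : ℤ} :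
    (a, b) ∈ labels l ρ ↔ Formal.Label l a b :=
  ⟨fun h' => ⟨h'.1, h'.2.1, h'.2.2.2⟩,
    fun h' => ⟨h'.1, h'.2.1, fun _ hc _ h2 => h.coeffPplus_ne_zero hc h2, h'.2.2⟩⟩

namespace IrrMod

variable (A : ℤˣ) (l : ℤ) (ρ : ℂ)

/-- The part of the normalisation that depends on `j`. -/
noncomputable def scale (n : ℕ) : ℂ := ∏ i ∈ Finset.range n,
  (Complex.I * (A : ℤ) * Formal.up ((A : ℤ) * ρ) (|l| + 2 * i))
    / coeffPplus (l / 2) ρ (((|l| + 2 * i : ℤ) : ℂ) / 2)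

/-- The normalisation of `|j, m⟩` in terms of the unnormalised vector. -/
noncomputable def norm (a b : ℤ) : ℂ := scale A l ρ ((a - |l|) / 2).toNat
  / (rootFactorial ((a + b) / 2).toNat * rootFactorial ((a - b) / 2).toNat)

variable {l ρ}

theorem up_ne_zero (h : NonTerminating l ρ) {a : ℤ} (ha : |l| ≤ a) (h2 : (2 : ℤ) ∣ a - l) :
    Formal.up ((A : ℤ) * ρ) a ≠ 0 := by
  have h0 : 0 ≤ a := (abs_nonneg l).trans ha
  have h1 : (a : ℂ) + 1 ≠ 0 := by exact_mod_cast (by omega : a + 1 ≠ 0)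
  have h4 : (a : ℂ) + 2 ≠ 0 := by exact_mod_cast (by omega : a + 2 ≠ 0)
  obtain ⟨f1, f2⟩ := h.factors ha h2
  refine div_ne_zero ?_ (mul_ne_zero h1 h4)
  rcases Int.units_eq_one_or A with rfl | rfl
  · simpa using f1
  · simpa using f2

theorem two_dvd_abs_sub (l : ℤ) : (2 : ℤ) ∣ |l| - l := by
  rcases abs_choice l with h | h <;> rw [h] <;> omega

theorem norm_ne_zero (h : NonTerminating l ρ) (a b : ℤ) : norm A l ρ a b ≠ 0 := by
  have hl := two_dvd_abs_sub l
  refine div_ne_zero (Finset.prod_ne_zero_iff.2 fun i _ => div_ne_zero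
    (mul_ne_zero (mul_ne_zero Complex.I_ne_zero ?_) (up_ne_zero A h (by omega) (by omega)))
    (h.coeffPplus_ne_zero (by omega) (by omega)))
    (mul_ne_zero (rootFactorial_ne_zero _) (rootFactorial_ne_zero _))
  exact_mod_cast A.ne_zero

/-- The factorials in `norm` are there for this: they trade the symmetric square roots of `C_±` for
the one-sided coefficient `j - εm`. -/
theorem norm_raise (ε : ℤˣ) {a b : ℤ} (hb : b ∈ weights a) (hb' : b + 2 * ε ∈ weights a) :
    norm A l ρ a (b + 2 * ε) * ((a : ℂ) / 2 + (ε : ℤ) * (b / 2) + 1).sqrt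
      = norm A l ρ a b * ((a : ℂ) / 2 - (ε : ℤ) * (b / 2)).sqrt := by
  simp only [weights, Set.mem_ofPred_eq] at hb hb'
  rcases Int.units_eq_one_or ε with rfl | rfl
  · simp only [Units.val_one] at *
    have e1 := rootFactorial_half (x := a + b) (y := a + (b + 2 * 1)) (by omega) (by omega)
      (by omega)
    have e2 := rootFactorial_half (x := a - (b + 2 * 1)) (y := a - b) (by omega) (by omega)
      (by omega)
    have h1 := rootFactorial_ne_zero ((a + b) / 2).toNat
    have h2 := rootFactorial_ne_zero ((a - (b + 2 * 1)) / 2).toNat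
    have h3 := rootFactorial_ne_zero ((a + (b + 2 * 1)) / 2).toNat
    have h4 := rootFactorial_ne_zero ((a - b) / 2).toNat
    have f1 : ((a : ℂ) / 2 + (1 : ℤ) * (b / 2) + 1) = ((a + b : ℤ) : ℂ) / 2 + 1 := by
      push_cast; ring
    have f2 : ((a : ℂ) / 2 - (1 : ℤ) * (b / 2)) = ((a - (b + 2 * 1) : ℤ) : ℂ) / 2 + 1 := by
      push_cast; ring
    rw [norm, norm, f1, f2]
    field_simp
    rw [e1, e2]
    ring_nf
  · simp only [Units.val_neg, Units.val_one] at *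
    have e1 := rootFactorial_half (x := a + (b + 2 * -1)) (y := a + b) (by omega) (by omega)
      (by omega)
    have e2 := rootFactorial_half (x := a - b) (y := a - (b + 2 * -1)) (by omega) (by omega)
      (by omega)
    have h1 := rootFactorial_ne_zero ((a + b) / 2).toNat
    have h2 := rootFactorial_ne_zero ((a - (b + 2 * -1)) / 2).toNat
    have h3 := rootFactorial_ne_zero ((a + (b + 2 * -1)) / 2).toNat
    have h4 := rootFactorial_ne_zero ((a - b) / 2).toNat
    have f1 : ((a : ℂ) / 2 + (-1 : ℤ) * (b / 2) + 1) = ((a - b : ℤ) : ℂ) / 2 + 1 := by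
      push_cast; ring
    have f2 : ((a : ℂ) / 2 - (-1 : ℤ) * (b / 2)) = ((a + (b + 2 * -1) : ℤ) : ℂ) / 2 + 1 := by
      push_cast; ring
    rw [norm, norm, f1, f2]
    field_simp
    rw [e1, e2]
    ring_nf

/-- `scale` is the solution of the recursion that this identity imposes on the `j`-dependent part of
the normalisation. -/
theorem norm_up (h : NonTerminating l ρ) {a b : ℤ} (hL : Formal.Label l a b) :
    coeffPplus (l / 2) ρ (a / 2) * ((a : ℂ) / 2 + b / 2 + 1).sqrt * ((a : ℂ) / 2 - b / 2 + 1).sqrt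
      * norm A l ρ (a + 2) b
      = norm A l ρ a b * (Complex.I * (A : ℤ) * Formal.up ((A : ℤ) * ρ) a) := by
  obtain ⟨h1, h2, h3⟩ := hL
  have hP := h.coeffPplus_ne_zero h1 h2
  have hl := two_dvd_abs_sub l
  simp only [weights, Set.mem_ofPred_eq] at h3
  obtain ⟨n, rfl⟩ : ∃ n : ℕ, a = |l| + 2 * n := by
    obtain ⟨k, hk⟩ : (2 : ℤ) ∣ a - |l| := by omega
    exact ⟨k.toNat, by omega⟩
  have s1 : ((|l| + 2 * (n : ℤ) - |l|) / 2).toNat = n := by omega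
  have s2 : ((|l| + 2 * (n : ℤ) + 2 - |l|) / 2).toNat = n + 1 := by omega
  generalize ha : |l| + 2 * (n : ℤ) = a at *
  have e1 := rootFactorial_half (x := a + b) (y := a + 2 + b) (by omega) (by omega) (by omega)
  have e2 := rootFactorial_half (x := a - b) (y := a + 2 - b) (by omega) (by omega) (by omega)
  have h1 := rootFactorial_ne_zero ((a + b) / 2).toNat
  have h2 := rootFactorial_ne_zero ((a - b) / 2).toNat
  have h3 := rootFactorial_ne_zero ((a + 2 + b) / 2).toNat
  have h4 := rootFactorial_ne_zero ((a + 2 - b) / 2).toNat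
  have f1 : ((a : ℂ) / 2 + b / 2 + 1) = ((a + b : ℤ) : ℂ) / 2 + 1 := by push_cast; ring
  have f2 : ((a : ℂ) / 2 - b / 2 + 1) = ((a - b : ℤ) : ℂ) / 2 + 1 := by push_cast; ring
  rw [norm, norm, f1, f2, s1, s2, scale, scale, Finset.prod_range_succ, ha]
  field_simp
  rw [e1, e2]
  ring_nf

/-- The product of a raising coefficient with the lowering coefficient that undoes it is invariant
under rescaling of the basis. The sign is `(iA)² = -1`, as `Formal.K0` omits the factor `iA`. -/
theorem up_mul_down {a : ℤ} (h0 : 0 ≤ a) : Formal.up ((A : ℤ) * ρ) a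
    * Formal.down l ((A : ℤ) * ρ) (a + 2) = -coeffPplus (l / 2) ρ (a / 2) ^ 2 := by
  have h1 : (a : ℂ) + 1 ≠ 0 := by exact_mod_cast (by omega : a + 1 ≠ 0)
  have h2 : (a : ℂ) + 2 ≠ 0 := by exact_mod_cast (by omega : a + 2 ≠ 0)
  have h3 : (a : ℂ) + 3 ≠ 0 := by exact_mod_cast (by omega : a + 3 ≠ 0)
  rw [coeffPplus_sq l ρ h0, Formal.up, Formal.down]
  push_cast
  rw [show (a : ℂ) + 2 + 1 = a + 3 by ring]
  rcases Int.units_eq_one_or A with rfl | rfl <;>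
  · push_cast
    field_simp
    ring

/-- No freedom remains after `norm_up`. The lowering coefficients must match because their products
with the raising ones do. -/
theorem norm_down (h : NonTerminating l ρ) {a b : ℤ} (hL : Formal.Label l a b)
    (hL' : Formal.Label l (a - 2) b) :
    coeffPminus (l / 2) ρ (a / 2) * ((a : ℂ) / 2 + b / 2).sqrt * ((a : ℂ) / 2 - b / 2).sqrt
      * norm A l ρ (a - 2) b
      = norm A l ρ a b * (Complex.I * (A : ℤ) * (Formal.down l ((A : ℤ) * ρ) a
        * ((a : ℂ) / 2 + b / 2) * ((a : ℂ) / 2 - b / 2))) := by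
  obtain ⟨c, rfl⟩ : ∃ c, a = c + 2 := ⟨a - 2, by ring⟩
  rw [add_sub_cancel_right] at hL' ⊢
  have hu := up_ne_zero A h hL'.1 hL'.2.1
  have k1 := norm_up A h hL'
  have k2 := up_mul_down A (l := l) (ρ := ρ) ((abs_nonneg l).trans hL'.1)
  have k3 := unit_mul_self A
  have hI : Complex.I * Complex.I = -1 := Complex.I_mul_I
  rw [← coeffPplus_eq_minus]
  have f1 : (((c + 2 : ℤ) : ℂ) / 2 + b / 2) = (c : ℂ) / 2 + b / 2 + 1 := by push_cast; ring
  have f2 : (((c + 2 : ℤ) : ℂ) / 2 - b / 2) = (c : ℂ) / 2 - b / 2 + 1 := by push_cast; ring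
  rw [f1, f2]
  have g1 := sqrt_mul_self' ((c : ℂ) / 2 + b / 2 + 1)
  have g2 := sqrt_mul_self' ((c : ℂ) / 2 - b / 2 + 1)
  generalize ((c : ℂ) / 2 + b / 2 + 1).sqrt = x at *
  generalize ((c : ℂ) / 2 - b / 2 + 1).sqrt = y at *
  rw [← g1, ← g2]
  -- Multiplication by the nonzero raising coefficient makes the invariant product `up * down`
  -- appear.
  apply mul_left_cancel₀ hu
  generalize Formal.up ((A : ℤ) * ρ) c = u at *
  generalize Formal.down l ((A : ℤ) * ρ) (c + 2) = d at *
  generalize norm A l ρ c b = N at *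
  generalize norm A l ρ (c + 2) b = N' at *
  generalize coeffPplus (l / 2) ρ (c / 2) = P at *
  generalize ((A : ℤ) : ℂ) = s at *
  linear_combination (Complex.I * s * P * x * y) * k1
    + (-N' * Complex.I * s * x ^ 2 * y ^ 2) * k2 + (P * x * y * N * u * s * s) * hI
    - (P * x * y * N * u) * k3

/-- The comparison map to the unnormalised model. -/
noncomputable def toFormal (A : ℤˣ) (l : ℤ) (ρ : ℂ) : IrrMod l ρ →ₗ[ℂ] Formal :=
  (basis l ρ).constr ℂ fun p => norm A l ρ p.1.1 p.1.2 • Formal.e p.1.1 p.1.2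

theorem toFormal_ket {a b : ℤ} (h : (a, b) ∈ labels l ρ) :
    toFormal A l ρ (ket l ρ a b) = norm A l ρ a b • Formal.e a b := by
  rw [ket, dif_pos h, toFormal, Module.Basis.constr_basis]

theorem ket_zero_or (h : NonTerminating l ρ) (a b : ℤ) :
    (¬ Formal.Label l a b ∧ ket l ρ a b = 0) ∨ (Formal.Label l a b ∧
      toFormal A l ρ (ket l ρ a b) = norm A l ρ a b • Formal.e a b) := by
  by_cases hL : Formal.Label l a b
  · exact .inr ⟨hL, toFormal_ket A (h.mem_labels.2 hL)⟩
  · exact .inl ⟨hL, ket_of_not_mem l ρ fun h' => hL (h.mem_labels.1 h')⟩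

/-- The inverse of the comparison map. -/
noncomputable def ofFormal (A : ℤˣ) (l : ℤ) (ρ : ℂ) : Formal →ₗ[ℂ] IrrMod l ρ :=
  Finsupp.linearCombination ℂ fun p => (norm A l ρ p.1 p.2)⁻¹ • ket l ρ p.1 p.2

theorem ofFormal_e (a b : ℤ) :
    ofFormal A l ρ (Formal.e a b) = (norm A l ρ a b)⁻¹ • ket l ρ a b := by
  simp [ofFormal, Formal.e]

theorem ofFormal_toFormal (h : NonTerminating l ρ) (v : IrrMod l ρ) :
    ofFormal A l ρ (toFormal A l ρ v) = v := by
  have : (ofFormal A l ρ).comp (toFormal A l ρ) = LinearMap.id := by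
    refine (basis l ρ).ext fun p => ?_
    rw [basis_eq_ket, LinearMap.comp_apply, toFormal_ket A p.2, map_smul, ofFormal_e, smul_smul,
      mul_inv_cancel₀ (norm_ne_zero A h _ _), one_smul, LinearMap.id_apply]
  exact LinearMap.congr_fun this v

theorem toFormal_injective (h : NonTerminating l ρ) : Function.Injective (toFormal A l ρ) :=
  Function.LeftInverse.injective (ofFormal_toFormal A h)

theorem toFormal_Jpm (h : NonTerminating l ρ) (ε : ℤˣ) (v : IrrMod l ρ) :
    toFormal A l ρ (Jpm l ρ ε v) = Formal.Jpm ε (toFormal A l ρ v) := by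
  have : (toFormal A l ρ).comp (Jpm l ρ ε) = (Formal.Jpm ε).comp (toFormal A l ρ) := by
    refine (basis l ρ).ext fun p => ?_
    obtain ⟨⟨a, b⟩, hp⟩ := p
    rw [basis_eq_ket, LinearMap.comp_apply, LinearMap.comp_apply, toFormal_ket A hp, map_smul,
      Jpm_ket, map_smul, Formal.Jpm, Formal.op_e, smul_smul]
    have hL := h.mem_labels.1 hp
    rcases ket_zero_or A h a (b + 2 * ε) with ⟨hn, h0⟩ | ⟨hL', h0⟩
    -- The ladder leaves the weights only from the edge `b = εa`, where the coefficient vanishes.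
    · have : (a : ℂ) / 2 - (ε : ℤ) * (b / 2) = 0 := by
        obtain ⟨h1, h2, h3⟩ := hL
        have hn' : b + 2 * ε ∉ weights a := fun hw => hn ⟨h1, h2, hw⟩
        simp only [weights, Set.mem_ofPred_eq] at hn' h3
        rcases Int.units_eq_one_or ε with rfl | rfl
        · simp only [Units.val_one] at *
          rw [show b = a by omega]; push_cast; ring
        · simp only [Units.val_one, Units.val_neg] at *
          rw [show b = -a by omega]; push_cast; ring
      rw [h0, this, map_zero, smul_zero, mul_zero, zero_smul]
    · have k := norm_raise A (l := l) (ρ := ρ) ε hL.2.2 hL'.2.2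
      have g := sqrt_mul_self' ((a : ℂ) / 2 - (ε : ℤ) * (b / 2))
      rw [h0, smul_smul, coeffC]
      congr 1
      linear_combination ((a : ℂ) / 2 - (ε : ℤ) * (b / 2)).sqrt * k + norm A l ρ a b * g
  exact LinearMap.congr_fun this v

/-- With the factor `iA` taken out, the sign `A` enters only through `σ = Aρ`, so one pair `Z`, `D`
serves both chiralities. -/
theorem toFormal_K0 (h : NonTerminating l ρ) (v : IrrMod l ρ) :
    toFormal A l ρ (K0 l ρ v)
      = (Complex.I * (A : ℤ)) • Formal.K0 l ((A : ℤ) * ρ) (toFormal A l ρ v) := by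
  have : (toFormal A l ρ).comp (K0 l ρ)
      = (Complex.I * (A : ℤ)) • (Formal.K0 l ((A : ℤ) * ρ)).comp (toFormal A l ρ) := by
    refine (basis l ρ).ext fun p => ?_
    obtain ⟨⟨a, b⟩, hp⟩ := p
    rw [basis_eq_ket, LinearMap.comp_apply, LinearMap.smul_apply, LinearMap.comp_apply,
      toFormal_ket A hp, map_smul, K0_ket, map_add, map_add, map_smul, map_smul, map_smul,
      Formal.K0, Formal.op_e, smul_add, smul_add, smul_add, smul_add]
    have hL := h.mem_labels.1 hp
    congr 1
    congr 1
    · rw [toFormal_ket A ((h.mem_labels (a := a + 2) (b := b)).2 ?_), smul_smul, smul_smul,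
        smul_smul, norm_up A h hL]
      · congr 1; ring
      · obtain ⟨h1, h2, h3⟩ := hL
        simp only [weights, Set.mem_ofPred_eq] at h3
        exact ⟨by omega, by omega, by simp only [weights, Set.mem_ofPred_eq]; omega⟩
    · rw [toFormal_ket A hp, smul_smul, smul_smul, smul_smul]
      congr 1
      have h0 : 0 ≤ a := (abs_nonneg l).trans hL.1
      have h2 : (a : ℂ) + 2 ≠ 0 := by exact_mod_cast (by omega : a + 2 ≠ 0)
      have hm : coeffP (l / 2) ρ (a / 2)
          = Complex.I * (A : ℤ) * Formal.mid l ((A : ℤ) * ρ) a := by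
        rw [coeffP_eq, Formal.mid]
        by_cases ha : (a : ℂ) = 0
        · simp [ha]
        · rw [show (a : ℂ) / 2 + 1 = (a + 2) / 2 by ring]
          field_simp
          linear_combination (-l * ρ : ℂ) * unit_mul_self A
      rw [hm]; ring
    · rcases ket_zero_or A h (a - 2) b with ⟨hn, h0⟩ | ⟨hL', h0⟩
      -- The label below is missing either because `a = |l|`, where `(a - l)(a + l) = 0`, or because
      -- `b = ±a`, where one of the last two factors vanishes.
      · have hz : Formal.down l ((A : ℤ) * ρ) a * ((a : ℂ) / 2 + b / 2)
            * ((a : ℂ) / 2 - b / 2) = 0 := by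
          obtain ⟨h1, h2, h3⟩ := hL
          have hl := two_dvd_abs_sub l
          by_cases ha : a = |l|
          · have : ((a : ℂ) - l) * (a + l) = 0 := by
              have : (a - l) * (a + l) = 0 := by
                rw [ha]; nlinarith [sq_abs l]
              exact_mod_cast this
            rw [Formal.down, this]; ring
          · have hn' : b ∉ weights (a - 2) := fun hw => hn ⟨by omega, by omega, hw⟩
            simp only [weights, Set.mem_ofPred_eq] at hn' h3
            have : b = a ∨ b = -a := by omega
            rcases this with rfl | rfl
            · ring
            · push_cast; ring
        rw [h0, hz, map_zero, smul_zero, zero_smul, smul_zero, smul_zero]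
      · rw [h0, smul_smul, smul_smul, smul_smul, norm_down A h hL hL']
        congr 1; ring
  exact LinearMap.congr_fun this v

end IrrMod

end SpinCG

namespace SpinCG

open Spin31

/-! ### Tensor product with the two-dimensional module -/

namespace FinMod

variable (A : ℤˣ)

/-- The basis vectors of the two-dimensional module. -/
noncomputable def spinor (ε : ℤˣ) : FinMod A 1 := ket A 1 ε

theorem unit_mem_weights (ε : ℤˣ) : (ε : ℤ) ∈ weights 1 := by
  rcases Int.units_eq_one_or ε with rfl | rfl <;> simp [weights]

theorem eq_unit_of_mem_weights {b : ℤ} (h : b ∈ weights 1) : ∃ ε : ℤˣ, b = ε := by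
  simp only [weights, Set.mem_ofPred_eq] at h
  rcases (by omega : b = 1 ∨ b = -1) with rfl | rfl
  exacts [⟨1, rfl⟩, ⟨-1, rfl⟩]

theorem lie_Jladder_spinor (ε : ℤˣ) : ⁅Jladder ε, spinor A ε⁆ = 0 := by
  rw [lie_Jladder, spinor, Jpm_ket, ket_of_not_mem, smul_zero]
  rcases Int.units_eq_one_or ε with rfl | rfl <;> simp [weights]

theorem lie_Jladder_spinor_neg (ε : ℤˣ) : ⁅Jladder ε, spinor A (-ε)⁆ = spinor A ε := by
  rw [lie_Jladder, spinor, Jpm_ket, spinor]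
  have h1 : (1 : ℂ).sqrt = 1 := by simp [Complex.sqrt]
  rcases Int.units_eq_one_or ε with rfl | rfl <;> simp [coeffC] <;> norm_num [h1]

theorem lie_K_spinor (ε : ℤˣ) :
    ⁅Spin31.K 0, spinor A ε⁆ = (Complex.I * (A : ℤ) * ((ε : ℤ) / 2)) • spinor A ε := by
  rw [lie_K, K0_eq, LinearMap.smul_apply, spinor, J0_ket, smul_smul]

variable {A}

theorem spinor_ext {M : Type} [AddCommGroup M] [Module ℂ M] {f f' : FinMod A 1 →ₗ[ℂ] M}
    (h : ∀ ε, f (spinor A ε) = f' (spinor A ε)) : f = f' := by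
  refine (basis A 1).ext fun b => ?_
  obtain ⟨ε, hε⟩ := eq_unit_of_mem_weights b.2
  rw [basis_eq_ket, hε]
  exact h ε

theorem spinor_tensor_ext {V M : Type} [AddCommGroup V] [Module ℂ V] [AddCommGroup M] [Module ℂ M]
    {f f' : FinMod A 1 ⊗[ℂ] V →ₗ[ℂ] M}
    (h : ∀ ε v, f (spinor A ε ⊗ₜ v) = f' (spinor A ε ⊗ₜ v)) : f = f' := by
  apply TensorProduct.ext
  refine spinor_ext fun ε => ?_
  ext v
  exact h ε v

/-- The linear map out of the tensor product given by a pair of maps. -/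
noncomputable def pairing {V W : Type} [AddCommGroup V] [Module ℂ V] [AddCommGroup W] [Module ℂ W]
    (Z : ℤˣ → V →ₗ[ℂ] W) : FinMod A 1 ⊗[ℂ] V →ₗ[ℂ] W :=
  TensorProduct.lift ((basis A 1).constr ℂ fun b => Z (if (b : ℤ) = 1 then 1 else -1))

theorem pairing_spinor {V W : Type} [AddCommGroup V] [Module ℂ V] [AddCommGroup W] [Module ℂ W]
    (Z : ℤˣ → V →ₗ[ℂ] W) (ε : ℤˣ) (v : V) : pairing Z (spinor A ε ⊗ₜ v) = Z ε v := by
  rw [pairing, TensorProduct.lift.tmul, spinor, ket, dif_pos (unit_mem_weights ε),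
    Module.Basis.constr_basis]
  rcases Int.units_eq_one_or ε with rfl | rfl <;> simp

end FinMod

open FinMod

section Doublet

variable {V V₁ V₂ : Type} [AddCommGroup V] [Module ℂ V] [LieRingModule Spin31 V]
  [LieModule ℂ Spin31 V] [AddCommGroup V₁] [Module ℂ V₁] [LieRingModule Spin31 V₁]
  [LieModule ℂ Spin31 V₁] [AddCommGroup V₂] [Module ℂ V₂] [LieRingModule Spin31 V₂]
  [LieModule ℂ Spin31 V₂]

/-- A pair of operators that transforms like the basis of the two-dimensional module. -/
structure IsDoublet (A : ℤˣ) (Z : ℤˣ → V →ₗ[ℂ] V₁) : Prop where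
  same : ∀ ε v, ⁅Jladder ε, Z ε v⁆ = Z ε ⁅Jladder ε, v⁆
  opp : ∀ ε v, ⁅Jladder ε, Z (-ε) v⁆ = Z ε v + Z (-ε) ⁅Jladder ε, v⁆
  boost : ∀ ε v, ⁅K 0, Z ε v⁆ = Z ε ⁅K 0, v⁆ + (Complex.I * (A : ℤ) * ((ε : ℤ) / 2)) • Z ε v

/-- The three doublet relations are the equivariance of `pairing Z` on the generators, evaluated on
spinors. -/
theorem IsDoublet.pairing_lie {A : ℤˣ} {Z : ℤˣ → V →ₗ[ℂ] V₁} (h : IsDoublet A Z) (x : Spin31)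
    (m : FinMod A 1 ⊗[ℂ] V) : pairing Z ⁅x, m⁆ = ⁅x, pairing Z m⁆ := by
  refine map_lie_of_ladder (pairing Z) (fun ε m => ?_) (fun m => ?_) x m
  · refine LinearMap.congr_fun (f := (pairing Z).comp (LieModule.toEnd ℂ Spin31 _ (Jladder ε)))
      (g := (LieModule.toEnd ℂ Spin31 _ (Jladder ε)).comp (pairing Z))
      (spinor_tensor_ext fun ε' v => ?_) m
    simp only [LinearMap.comp_apply, LieModule.toEnd_apply_apply,
      TensorProduct.LieModule.lie_tmul_right, map_add, pairing_spinor]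
    rcases eq_or_ne ε' ε with rfl | hne
    · rw [lie_Jladder_spinor, TensorProduct.zero_tmul, map_zero, zero_add, h.same]
    · have : ε' = -ε := by
        rcases Int.units_eq_one_or ε with rfl | rfl <;>
        rcases Int.units_eq_one_or ε' with rfl | rfl <;> simp_all
      rw [this, lie_Jladder_spinor_neg, pairing_spinor, h.opp]
  · refine LinearMap.congr_fun (f := (pairing Z).comp (LieModule.toEnd ℂ Spin31 _ (K 0)))
      (g := (LieModule.toEnd ℂ Spin31 _ (K 0)).comp (pairing Z))
      (spinor_tensor_ext fun ε' v => ?_) m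
    simp only [LinearMap.comp_apply, LieModule.toEnd_apply_apply,
      TensorProduct.LieModule.lie_tmul_right, map_add, pairing_spinor]
    rw [lie_K_spinor, ← TensorProduct.smul_tmul', map_smul, pairing_spinor, h.boost, add_comm]

/-- If the Weyl relations hold then the tensor product with the two-dimensional module splits. -/
theorem repIso_spinor_tensor (A : ℤˣ) {Z : ℤˣ → V →ₗ[ℂ] V₁} {D : ℤˣ → V →ₗ[ℂ] V₂}
    (Z' : ℤˣ → V₂ →ₗ[ℂ] V) (D' : ℤˣ → V₁ →ₗ[ℂ] V) {c : ℂ} (hc : c ≠ 0)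
    (hZ : IsDoublet A Z) (hD : IsDoublet A D)
    (zd : ∀ v, Z (-1) (D' 1 v) - Z 1 (D' (-1) v) = c • v)
    (dd : ∀ v, D 1 (D' (-1) v) = D (-1) (D' 1 v))
    (zz : ∀ v, Z 1 (Z' (-1) v) = Z (-1) (Z' 1 v))
    (dz : ∀ v, D 1 (Z' (-1) v) - D (-1) (Z' 1 v) = c • v)
    (same : ∀ ε v, D' ε (Z ε v) = Z' ε (D ε v))
    (opp : ∀ ε v, Z' (-ε) (D ε v) - D' (-ε) (Z ε v) = (((ε : ℤ) : ℂ) * c) • v) :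
    RepIso (fun x => LieModule.toEnd ℂ Spin31 (FinMod A 1 ⊗[ℂ] V) x)
      (prodRep (fun x => LieModule.toEnd ℂ Spin31 V₁ x)
        (fun x => LieModule.toEnd ℂ Spin31 V₂ x)) := by
  let t (ε : ℤˣ) : V →ₗ[ℂ] FinMod A 1 ⊗[ℂ] V := TensorProduct.mk ℂ (FinMod A 1) V (spinor A ε)
  have ht : ∀ ε v, t ε v = spinor A ε ⊗ₜ v := fun _ _ => rfl
  -- The inverse contracts the opposite doublets `D'` and `Z'` with the spinors through the
  -- antisymmetric form. The relations `zd`, `dd`, `zz`, `dz` make it a right inverse, and `same`,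
  -- `opp` make it a left inverse, each time up to the factor `c`.
  let inv : V₁ × V₂ →ₗ[ℂ] FinMod A 1 ⊗[ℂ] V := c⁻¹ • LinearMap.coprod
    ((t (-1)).comp (D' 1) - (t 1).comp (D' (-1))) ((t 1).comp (Z' (-1)) - (t (-1)).comp (Z' 1))
  have hinv : ∀ h k, inv (h, k) = c⁻¹ • ((spinor A (-1) ⊗ₜ D' 1 h - spinor A 1 ⊗ₜ D' (-1) h)
      + (spinor A 1 ⊗ₜ Z' (-1) k - spinor A (-1) ⊗ₜ Z' 1 k)) := fun h k => by
    simp [inv, ht]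
  have hc' : ∀ {M : Type} [AddCommGroup M] [Module ℂ M] (m : M), c⁻¹ • c • m = m := fun m => by
    rw [smul_smul, inv_mul_cancel₀ hc, one_smul]
  refine ⟨LinearEquiv.ofLinearMap ((pairing Z).prod (pairing D)) inv ?_ ?_, fun x m => ?_⟩
  · apply LinearMap.ext
    rintro ⟨h, k⟩
    simp only [LinearMap.comp_apply, hinv, LinearMap.prod_apply, Function.prod_apply, map_smul,
      map_add, map_sub, pairing_spinor, LinearMap.id_apply, Prod.mk_sub_mk, Prod.mk_add_mk,
      Prod.smul_mk, zd, dd, zz, dz, sub_self, zero_add, add_zero, hc']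
  · refine spinor_tensor_ext fun ε v => ?_
    simp only [LinearMap.comp_apply, LinearMap.prod_apply, Function.prod_apply, hinv, pairing_spinor,
      LinearMap.id_apply]
    have h1 := opp ε v
    have h2 := same ε v
    rcases Int.units_eq_one_or ε with rfl | rfl
    · rw [show ∀ a b c d : FinMod A 1 ⊗[ℂ] V, (a - b) + (c - d) = (c - b) + (a - d) by
        intros; abel, ← TensorProduct.tmul_sub, ← TensorProduct.tmul_sub, h1, h2, sub_self,
        TensorProduct.tmul_zero, add_zero, Units.val_one, Int.cast_one, one_mul,
        TensorProduct.tmul_smul, hc']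
    · rw [neg_neg] at h1
      rw [show ∀ a b c d : FinMod A 1 ⊗[ℂ] V, (a - b) + (c - d) = (c - b) - (d - a) by
        intros; abel, ← TensorProduct.tmul_sub, ← TensorProduct.tmul_sub, h1, h2, sub_self,
        TensorProduct.tmul_zero, zero_sub, ← TensorProduct.tmul_neg, ← neg_smul,
        Units.val_neg, Units.val_one, Int.cast_neg, Int.cast_one, neg_mul, one_mul, neg_neg,
        TensorProduct.tmul_smul, hc']
  · change (pairing Z ⁅x, m⁆, pairing D ⁅x, m⁆) = (⁅x, pairing Z m⁆, ⁅x, pairing D m⁆)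
    rw [hZ.pairing_lie, hD.pairing_lie]

end Doublet

end SpinCG

/-! ### Admissible labels and the splitting of `F_{1/2} ⊗ V_{λ,ρ}` -/

namespace SpinCG

open Spin31

namespace Formal

/-- The span of the unnormalised vectors with admissible labels. -/
noncomputable def admissible (l : ℤ) : Submodule ℂ Formal :=
  Finsupp.supported ℂ ℂ {p | Label l p.1 p.2}

theorem e_mem {l a b : ℤ} (h : Label l a b) : e a b ∈ admissible l :=
  Finsupp.single_mem_supported ℂ 1 h

theorem smul_e_mem {l a b : ℤ} {c : ℂ} (h : c ≠ 0 → Label l a b) : c • e a b ∈ admissible l := by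
  by_cases hc : c = 0
  · rw [hc, zero_smul]; exact Submodule.zero_mem _
  · exact Submodule.smul_mem _ _ (e_mem (h hc))

theorem admissible_eq_span (l : ℤ) :
    admissible l = Submodule.span ℂ {w | ∃ a b, Label l a b ∧ w = e a b} := by
  rw [admissible, Finsupp.supported_eq_span_single]
  congr 1
  ext w
  constructor
  · rintro ⟨p, hp, rfl⟩; exact ⟨p.1, p.2, hp, rfl⟩
  · rintro ⟨a, b, h, rfl⟩; exact ⟨(a, b), h, rfl⟩

theorem eq_on_admissible {l : ℤ} {M : Type} [AddCommGroup M] [Module ℂ M] {f f' : Formal →ₗ[ℂ] M}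
    (h : ∀ a b, Label l a b → f (e a b) = f' (e a b)) {w : Formal} (hw : w ∈ admissible l) :
    f w = f' w := by
  rw [admissible_eq_span] at hw
  refine LinearMap.eqOn_span (f := f) (g := f') ?_ hw
  rintro _ ⟨a, b, hab, rfl⟩
  exact h a b hab

theorem map_mem_admissible {l l' : ℤ} {f : Module.End ℂ Formal}
    (h : ∀ a b, Label l a b → f (e a b) ∈ admissible l') {w : Formal} (hw : w ∈ admissible l) :
    f w ∈ admissible l' := by
  rw [admissible_eq_span] at hw
  refine (Submodule.span_le (p := (admissible l').comap f)).2 ?_ hw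
  rintro _ ⟨a, b, hab, rfl⟩
  exact h a b hab

/-- The relations hold for formal vectors; they descend to modules because the coefficients vanish
at the boundary. The raising term always has an admissible label. The lowering term could fail only
at `a = l` or at `b = εa`, and carries the factors `a - l` and `a - εb`. For `D` below, the first
factor is `a + l`. -/
theorem Z_mem (l : ℤ) (ε : ℤˣ) {w : Formal} (hw : w ∈ admissible l) :
    Z l ε w ∈ admissible (l + 1) := by
  refine map_mem_admissible (fun a b h => ?_) hw
  obtain ⟨h1, h2, h3⟩ := h
  have h1' := abs_le.1 h1
  simp only [weights, Set.mem_ofPred_eq] at h3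
  rw [Z, op_e]
  refine Submodule.add_mem _ (Submodule.smul_mem _ _ (e_mem ⟨?_, ?_, ?_⟩))
    (smul_e_mem fun hc => ?_)
  · rw [abs_le]; omega
  · omega
  · rcases Int.units_eq_one_or ε with rfl | rfl <;>
      simp only [weights, Set.mem_ofPred_eq, Units.val_one, Units.val_neg] <;> omega
  · have n1 : a ≠ l := by
      rintro rfl
      exact hc (by rw [sub_self]; simp)
    have n2 : a - ε * b ≠ 0 := fun h0 => hc (by
      have : (a : ℂ) - ε * b = 0 := by exact_mod_cast h0
      rw [show (a : ℂ) / 2 - (ε : ℤ) * (b / 2) = (a - ε * b) / 2 by ring, this]; simp)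
    refine ⟨by rw [abs_le]; omega, by omega, ?_⟩
    rcases Int.units_eq_one_or ε with rfl | rfl <;>
      simp only [weights, Set.mem_ofPred_eq, Units.val_one, Units.val_neg] at n2 ⊢ <;> omega

theorem D_mem (l : ℤ) (σ : ℂ) (ε : ℤˣ) {w : Formal} (hw : w ∈ admissible l) :
    D l σ ε w ∈ admissible (l - 1) := by
  refine map_mem_admissible (fun a b h => ?_) hw
  obtain ⟨h1, h2, h3⟩ := h
  have h1' := abs_le.1 h1
  simp only [weights, Set.mem_ofPred_eq] at h3
  rw [D, op_e]
  refine Submodule.add_mem _ (Submodule.smul_mem _ _ (e_mem ⟨?_, ?_, ?_⟩))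
    (smul_e_mem fun hc => ?_)
  · rw [abs_le]; omega
  · omega
  · rcases Int.units_eq_one_or ε with rfl | rfl <;>
      simp only [weights, Set.mem_ofPred_eq, Units.val_one, Units.val_neg] <;> omega
  · have n1 : a ≠ -l := by
      rintro rfl
      exact hc (by rw [show ((-l : ℤ) : ℂ) / 2 + l / 2 = 0 by push_cast; ring]; simp)
    have n2 : a - ε * b ≠ 0 := fun h0 => hc (by
      have : (a : ℂ) - ε * b = 0 := by exact_mod_cast h0
      rw [show (a : ℂ) / 2 - (ε : ℤ) * (b / 2) = (a - ε * b) / 2 by ring, this]; simp)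
    refine ⟨by rw [abs_le]; omega, by omega, ?_⟩
    rcases Int.units_eq_one_or ε with rfl | rfl <;>
      simp only [weights, Set.mem_ofPred_eq, Units.val_one, Units.val_neg] at n2 ⊢ <;> omega

end Formal

namespace IrrMod

open Formal

variable (A : ℤˣ) {l l' : ℤ} {ρ ρ' : ℂ}

theorem toFormal_mem (h : NonTerminating l ρ) (v : IrrMod l ρ) :
    toFormal A l ρ v ∈ admissible l := by
  have : LinearMap.range (toFormal A l ρ) ≤ admissible l := by
    rw [LinearMap.range_eq_map, ← (basis l ρ).span_eq, Submodule.map_span, Submodule.span_le]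
    rintro _ ⟨_, ⟨p, rfl⟩, rfl⟩
    rw [basis_eq_ket, toFormal_ket A p.2]
    exact Submodule.smul_mem _ _ (e_mem (h.mem_labels.1 p.2))
  exact this ⟨v, rfl⟩

theorem toFormal_ofFormal (h : NonTerminating l ρ) {w : Formal} (hw : w ∈ admissible l) :
    toFormal A l ρ (ofFormal A l ρ w) = w := by
  refine eq_on_admissible (f := (toFormal A l ρ).comp (ofFormal A l ρ)) (f' := LinearMap.id)
    (fun a b hab => ?_) hw
  rw [LinearMap.comp_apply, ofFormal_e, map_smul, toFormal_ket A (h.mem_labels.2 hab), smul_smul,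
    inv_mul_cancel₀ (norm_ne_zero A h _ _), one_smul, LinearMap.id_apply]

/-- The map between modules induced by an operator on unnormalised vectors. -/
noncomputable def transfer (l : ℤ) (ρ : ℂ) (l' : ℤ) (ρ' : ℂ) (f : Module.End ℂ Formal) :
    IrrMod l ρ →ₗ[ℂ] IrrMod l' ρ' :=
  (ofFormal A l' ρ').comp (f.comp (toFormal A l ρ))

theorem toFormal_transfer (h : NonTerminating l ρ) (h' : NonTerminating l' ρ')
    {f : Module.End ℂ Formal} (hf : ∀ w ∈ admissible l, f w ∈ admissible l') (v : IrrMod l ρ) :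
    toFormal A l' ρ' (transfer A l ρ l' ρ' f v) = f (toFormal A l ρ v) :=
  toFormal_ofFormal A h' (hf _ (toFormal_mem A h v))

theorem toFormal_lie_Jladder (h : NonTerminating l ρ) (ε : ℤˣ) (v : IrrMod l ρ) :
    toFormal A l ρ ⁅Jladder ε, v⁆ = Formal.Jpm ε (toFormal A l ρ v) := by
  rw [lie_Jladder, toFormal_Jpm A h]

theorem toFormal_lie_K (h : NonTerminating l ρ) (v : IrrMod l ρ) :
    toFormal A l ρ ⁅Spin31.K 0, v⁆
      = (Complex.I * (A : ℤ)) • Formal.K0 l ((A : ℤ) * ρ) (toFormal A l ρ v) := by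
  rw [lie_K, toFormal_K0 A h]

theorem isDoublet_Z (h : NonTerminating l ρ) (hl : l' = l + 1) (hρ : ρ' = ρ + (A : ℤ) / 2)
    (h' : NonTerminating l' ρ') : IsDoublet A fun ε => transfer A l ρ l' ρ' (Z l ε) := by
  have hσ : ((A : ℤ) : ℂ) * ρ' = (A : ℤ) * ρ + 1 / 2 := by
    rw [hρ]; linear_combination (1 / 2 : ℂ) * unit_mul_self A
  subst hl
  have hm := fun ε => toFormal_transfer A h h' fun w => Z_mem l ε (w := w)
  constructor <;> intro ε v <;> apply toFormal_injective A h' <;>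
    simp only [map_add, map_smul, hm, toFormal_lie_Jladder A h, toFormal_lie_Jladder A h',
      toFormal_lie_K A h, toFormal_lie_K A h', hσ]
  · exact eq_on_admissible (f := (Formal.Jpm ε).comp (Z l ε)) (f' := (Z l ε).comp (Formal.Jpm ε))
      (fun a b hab => Jpm_Z_same l ε ((abs_nonneg l).trans hab.1)) (toFormal_mem A h v)
  · exact eq_on_admissible (f := (Formal.Jpm ε).comp (Z l (-ε)))
      (f' := Z l ε + (Z l (-ε)).comp (Formal.Jpm ε))
      (fun a b hab => Jpm_Z_opp l ε ((abs_nonneg l).trans hab.1)) (toFormal_mem A h v)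
  · have := eq_on_admissible (f := (Formal.K0 (l + 1) ((A : ℤ) * ρ + 1 / 2)).comp (Z l ε))
      (f' := (Z l ε).comp (Formal.K0 l ((A : ℤ) * ρ)) + (((ε : ℤ) : ℂ) / 2) • Z l ε)
      (fun a b hab => K0_Z l _ ε hab) (toFormal_mem A h v)
    simp only [LinearMap.comp_apply, LinearMap.add_apply, LinearMap.smul_apply] at this
    rw [this, smul_add, smul_smul]

theorem isDoublet_D (h : NonTerminating l ρ) (hl : l' = l - 1) (hρ : ρ' = ρ - (A : ℤ) / 2)
    (h' : NonTerminating l' ρ') :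
    IsDoublet A fun ε => transfer A l ρ l' ρ' (D l ((A : ℤ) * ρ) ε) := by
  have hσ : ((A : ℤ) : ℂ) * ρ' = (A : ℤ) * ρ - 1 / 2 := by
    rw [hρ]; linear_combination (-1 / 2 : ℂ) * unit_mul_self A
  subst hl
  generalize hs : ((A : ℤ) : ℂ) * ρ = σ at *
  have hm := fun ε => toFormal_transfer A h h' fun w => D_mem l σ ε (w := w)
  constructor <;> intro ε v <;> apply toFormal_injective A h' <;>
    simp only [map_add, map_smul, hm, toFormal_lie_Jladder A h, toFormal_lie_Jladder A h',
      toFormal_lie_K A h, toFormal_lie_K A h', hσ, hs]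
  · exact eq_on_admissible (f := (Formal.Jpm ε).comp (D l σ ε))
      (f' := (D l σ ε).comp (Formal.Jpm ε))
      (fun a b hab => Jpm_D_same l σ ε ((abs_nonneg l).trans hab.1)) (toFormal_mem A h v)
  · exact eq_on_admissible (f := (Formal.Jpm ε).comp (D l σ (-ε)))
      (f' := D l σ ε + (D l σ (-ε)).comp (Formal.Jpm ε))
      (fun a b hab => Jpm_D_opp l σ ε ((abs_nonneg l).trans hab.1)) (toFormal_mem A h v)
  · have := eq_on_admissible (f := (Formal.K0 (l - 1) (σ - 1 / 2)).comp (D l σ ε))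
      (f' := (D l σ ε).comp (Formal.K0 l σ) + (((ε : ℤ) : ℂ) / 2) • D l σ ε)
      (fun a b hab => K0_D l _ ε hab) (toFormal_mem A h v)
    simp only [LinearMap.comp_apply, LinearMap.add_apply, LinearMap.smul_apply] at this
    rw [this, smul_add, smul_smul]

/-- The constant `c` of `repIso_spinor_tensor` is `x = λ + Aρ`. For the relations starting from the
shifted modules the degree has already moved by one, which is why all of them give the same `x`. -/
theorem repIso_spinor_tensor_irrMod (h : NonTerminating l ρ) {l₁ l₂ : ℤ} {ρ₁ ρ₂ : ℂ}
    (hl₁ : l₁ = l + 1) (hρ₁ : ρ₁ = ρ + (A : ℤ) / 2) (h₁ : NonTerminating l₁ ρ₁)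
    (hl₂ : l₂ = l - 1) (hρ₂ : ρ₂ = ρ - (A : ℤ) / 2) (h₂ : NonTerminating l₂ ρ₂)
    (hx : (l : ℂ) / 2 + (A : ℤ) * ρ ≠ 0) :
    RepIso (fun x => LieModule.toEnd ℂ Spin31 (FinMod A 1 ⊗[ℂ] IrrMod l ρ) x)
      (prodRep (fun x => LieModule.toEnd ℂ Spin31 (IrrMod l₁ ρ₁) x)
        (fun x => LieModule.toEnd ℂ Spin31 (IrrMod l₂ ρ₂) x)) := by
  have hσ₁ : ((A : ℤ) : ℂ) * ρ₁ = (A : ℤ) * ρ + 1 / 2 := by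
    rw [hρ₁]; linear_combination (1 / 2 : ℂ) * unit_mul_self A
  have hZ := isDoublet_Z A h hl₁ hρ₁ h₁
  have hD := isDoublet_D A h hl₂ hρ₂ h₂
  generalize hs : ((A : ℤ) : ℂ) * ρ = σ at *
  subst hl₁ hl₂
  have el₁ : l + 1 - 1 = l := by ring
  have el₂ : l - 1 + 1 = l := by ring
  have eσ₁ : σ + 1 / 2 - 1 / 2 = σ := by ring
  have eσ₂ : σ - 1 / 2 + 1 / 2 = σ := by ring
  have mZ := fun ε => toFormal_transfer A h h₁ fun w => Z_mem l ε (w := w)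
  have mD := fun ε => toFormal_transfer A h h₂ fun w => D_mem l σ ε (w := w)
  have mZ' := fun ε => toFormal_transfer (f := Z (l - 1) ε) A h₂ h
    fun w hw => by have := Z_mem (l - 1) ε hw; rwa [el₂] at this
  have mD' := fun ε => toFormal_transfer (f := D (l + 1) (σ + 1 / 2) ε) A h₁ h
    fun w hw => by have := D_mem (l + 1) (σ + 1 / 2) ε hw; rwa [el₁] at this
  refine repIso_spinor_tensor A (fun ε => transfer A _ _ _ _ (Z (l - 1) ε))
    (fun ε => transfer A _ _ _ _ (D (l + 1) (σ + 1 / 2) ε)) hx hZ hD ?_ ?_ ?_ ?_ ?_ ?_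
  · intro v
    apply toFormal_injective A h₁
    simp only [map_sub, map_smul, mZ, mD']
    refine eq_on_admissible (f := (Z l (-1)).comp (D (l + 1) (σ + 1 / 2) 1)
      - (Z l 1).comp (D (l + 1) (σ + 1 / 2) (-1))) (f' := ((l : ℂ) / 2 + σ) • LinearMap.id)
      (fun a b hab => ?_) (toFormal_mem A h₁ v)
    have := Z_D_sub (l + 1) (σ + 1 / 2) hab
    rw [el₁] at this
    refine this.trans ?_
    rw [LinearMap.smul_apply, LinearMap.id_apply]
    congr 1
    push_cast; ring
  · intro v
    apply toFormal_injective A h₂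
    simp only [mD, mD']
    have := eq_on_admissible (f := (D l σ 1).comp (D (l + 1) (σ + 1 / 2) (-1)))
      (f' := (D l σ (-1)).comp (D (l + 1) (σ + 1 / 2) 1))
      (fun a b hab => by
        have := D_comm (l + 1) (σ + 1 / 2) hab
        rw [el₁, eσ₁] at this
        rw [LinearMap.comp_apply, LinearMap.comp_apply, this]) (toFormal_mem A h₁ v)
    rwa [LinearMap.comp_apply, LinearMap.comp_apply] at this
  · intro v
    apply toFormal_injective A h₁
    simp only [mZ, mZ']
    have := eq_on_admissible (f := (Z l 1).comp (Z (l - 1) (-1)))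
      (f' := (Z l (-1)).comp (Z (l - 1) 1))
      (fun a b hab => by
        have := Z_comm (l - 1) hab
        rw [el₂] at this
        rw [LinearMap.comp_apply, LinearMap.comp_apply, this]) (toFormal_mem A h₂ v)
    rwa [LinearMap.comp_apply, LinearMap.comp_apply] at this
  · intro v
    apply toFormal_injective A h₂
    simp only [map_sub, map_smul, mD, mZ']
    refine eq_on_admissible (f := (D l σ 1).comp (Z (l - 1) (-1))
      - (D l σ (-1)).comp (Z (l - 1) 1)) (f' := ((l : ℂ) / 2 + σ) • LinearMap.id)
      (fun a b hab => ?_) (toFormal_mem A h₂ v)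
    have := D_Z_sub (l - 1) (σ - 1 / 2) hab
    rw [el₂, eσ₂] at this
    refine this.trans ?_
    rw [LinearMap.smul_apply, LinearMap.id_apply]
    congr 1
    push_cast; ring
  · intro ε v
    apply toFormal_injective A h
    simp only [mZ, mD, mZ', mD']
    exact eq_on_admissible (f := (D (l + 1) (σ + 1 / 2) ε).comp (Z l ε))
      (f' := (Z (l - 1) ε).comp (D l σ ε))
      (fun a b hab => D_Z_same l σ ε hab) (toFormal_mem A h v)
  · intro ε v
    apply toFormal_injective A h
    simp only [map_sub, map_smul, mZ, mD, mZ', mD']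
    exact eq_on_admissible (f := (Z (l - 1) (-ε)).comp (D l σ ε)
      - (D (l + 1) (σ + 1 / 2) (-ε)).comp (Z l ε))
      (f' := (((ε : ℤ) : ℂ) * ((l : ℂ) / 2 + σ)) • LinearMap.id)
      (fun a b hab => Z_D_sub_D_Z l σ ε hab) (toFormal_mem A h v)

end IrrMod

end SpinCG

namespace SpinCG

open Spin31

/-! ### Binary forms as a model of `F^A_γ` -/

namespace BinaryForm

/-- The operator on `ℤ →₀ ℂ` with prescribed values on the basis. -/
noncomputable def op (f : ℤ → ℤ →₀ ℂ) : Module.End ℂ (ℤ →₀ ℂ) := Finsupp.linearCombination ℂ f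

/-- The monomial of weight `b`. -/
noncomputable def e (b : ℤ) : ℤ →₀ ℂ := Finsupp.single b 1

@[simp] theorem op_e (f : ℤ → ℤ →₀ ℂ) (b : ℤ) : op f (e b) = f b := by simp [op, e]

/-- `J_±` on monomials of degree `g`. -/
noncomputable def Jpm (g : ℤ) (ε : ℤˣ) : Module.End ℂ (ℤ →₀ ℂ) :=
  op fun b => ((g : ℂ) / 2 - (ε : ℤ) * (b / 2)) • e (b + 2 * ε)

/-- `J₀` on monomials. -/
noncomputable def J0 : Module.End ℂ (ℤ →₀ ℂ) := op fun b => ((b : ℂ) / 2) • e b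

/-- Multiplication by the variables. -/
noncomputable def Z (ε : ℤˣ) : Module.End ℂ (ℤ →₀ ℂ) := op fun b => e (b + ε)

/-- Differentiation of forms of degree `g`. -/
noncomputable def D (g : ℤ) (ε : ℤˣ) : Module.End ℂ (ℤ →₀ ℂ) :=
  op fun b => (((ε : ℤ) : ℂ) * ((g : ℂ) / 2 - (ε : ℤ) * (b / 2))) • e (b + ε)

/-- The forms of degree `g`. -/
noncomputable def forms (g : ℤ) : Submodule ℂ (ℤ →₀ ℂ) := Finsupp.supported ℂ ℂ (weights g)

theorem e_mem {g b : ℤ} (h : b ∈ weights g) : e b ∈ forms g :=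
  Finsupp.single_mem_supported ℂ 1 h

theorem smul_e_mem {g b : ℤ} {c : ℂ} (h : c ≠ 0 → b ∈ weights g) : c • e b ∈ forms g := by
  by_cases hc : c = 0
  · rw [hc, zero_smul]; exact Submodule.zero_mem _
  · exact Submodule.smul_mem _ _ (e_mem (h hc))

theorem eq_on_forms {g : ℤ} {M : Type} [AddCommGroup M] [Module ℂ M] {f f' : (ℤ →₀ ℂ) →ₗ[ℂ] M}
    (h : ∀ b ∈ weights g, f (e b) = f' (e b)) {w : ℤ →₀ ℂ} (hw : w ∈ forms g) : f w = f' w := by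
  rw [forms, Finsupp.supported_eq_span_single] at hw
  refine LinearMap.eqOn_span (f := f) (g := f') ?_ hw
  rintro _ ⟨b, hb, rfl⟩
  exact h b hb

theorem map_mem_forms {g g' : ℤ} {f : Module.End ℂ (ℤ →₀ ℂ)}
    (h : ∀ b ∈ weights g, f (e b) ∈ forms g') {w : ℤ →₀ ℂ} (hw : w ∈ forms g) :
    f w ∈ forms g' := by
  rw [forms, Finsupp.supported_eq_span_single] at hw
  refine (Submodule.span_le (p := (forms g').comap f)).2 ?_ hw
  rintro _ ⟨b, hb, rfl⟩
  exact h b hb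

theorem Z_mem {g : ℤ} (ε : ℤˣ) {w : ℤ →₀ ℂ} (hw : w ∈ forms g) : Z ε w ∈ forms (g + 1) := by
  refine map_mem_forms (fun b h => ?_) hw
  rw [Z, op_e]
  apply e_mem
  simp only [weights, Set.mem_ofPred_eq] at h ⊢
  rcases Int.units_eq_one_or ε with rfl | rfl <;>
    simp only [Units.val_one, Units.val_neg] <;> omega

theorem D_mem {g : ℤ} (ε : ℤˣ) {w : ℤ →₀ ℂ} (hw : w ∈ forms g) : D g ε w ∈ forms (g - 1) := by
  refine map_mem_forms (fun b h => ?_) hw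
  rw [D, op_e]
  refine smul_e_mem fun hc => ?_
  have n2 : g - ε * b ≠ 0 := fun h0 => hc (by
    have : (g : ℂ) - ε * b = 0 := by exact_mod_cast h0
    rw [show (g : ℂ) / 2 - (ε : ℤ) * (b / 2) = (g - ε * b) / 2 by ring, this]; simp)
  simp only [weights, Set.mem_ofPred_eq] at h ⊢
  rcases Int.units_eq_one_or ε with rfl | rfl <;>
    simp only [Units.val_one, Units.val_neg] at n2 ⊢ <;> omega

end BinaryForm

namespace FinMod

open BinaryForm

variable (A : ℤˣ) {g g' : ℤ}

/-- The normalisation of the basis of `F^A_γ` in terms of monomials. -/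
noncomputable def norm (g b : ℤ) : ℂ :=
  (rootFactorial ((g + b) / 2).toNat * rootFactorial ((g - b) / 2).toNat)⁻¹

theorem norm_ne_zero (g b : ℤ) : norm g b ≠ 0 :=
  inv_ne_zero (mul_ne_zero (rootFactorial_ne_zero _) (rootFactorial_ne_zero _))

/-- The same factorials normalise the lowest `K`-type of `V_{a/2,0}`, where `scale` is an empty
product. -/
theorem norm_raise (ε : ℤˣ) {a b : ℤ} (hb : b ∈ weights a) (hb' : b + 2 * ε ∈ weights a) :
    norm a (b + 2 * ε) * ((a : ℂ) / 2 + (ε : ℤ) * (b / 2) + 1).sqrt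
      = norm a b * ((a : ℂ) / 2 - (ε : ℤ) * (b / 2)).sqrt := by
  have key := IrrMod.norm_raise 1 (l := a) (ρ := 0) ε hb hb'
  simp only [weights, Set.mem_ofPred_eq] at hb
  have ha : ((a - |a|) / 2).toNat = 0 := by rw [abs_of_nonneg (by omega)]; simp
  have hs : ∀ c, IrrMod.norm 1 a 0 a c = norm a c := fun c => by
    rw [IrrMod.norm, norm, ha, IrrMod.scale, Finset.prod_range_zero, one_div]
  rwa [hs, hs] at key

/-- The comparison map to binary forms. -/
noncomputable def toForm (A : ℤˣ) (g : ℤ) : FinMod A g →ₗ[ℂ] ℤ →₀ ℂ :=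
  (basis A g).constr ℂ fun b => norm g b • e b

/-- The inverse of the comparison map. -/
noncomputable def ofForm (A : ℤˣ) (g : ℤ) : (ℤ →₀ ℂ) →ₗ[ℂ] FinMod A g :=
  Finsupp.linearCombination ℂ fun b => (norm g b)⁻¹ • ket A g b

theorem toForm_ket {b : ℤ} (h : b ∈ weights g) : toForm A g (ket A g b) = norm g b • e b := by
  rw [ket, dif_pos h, toForm, Module.Basis.constr_basis]

theorem ofForm_e (b : ℤ) : ofForm A g (e b) = (norm g b)⁻¹ • ket A g b := by
  simp [ofForm, e]

theorem ofForm_toForm (v : FinMod A g) : ofForm A g (toForm A g v) = v := by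
  have : (ofForm A g).comp (toForm A g) = LinearMap.id := by
    refine (basis A g).ext fun b => ?_
    rw [basis_eq_ket, LinearMap.comp_apply, toForm_ket A b.2, map_smul, ofForm_e, smul_smul,
      mul_inv_cancel₀ (norm_ne_zero _ _), one_smul, LinearMap.id_apply]
  exact LinearMap.congr_fun this v

theorem toForm_injective : Function.Injective (toForm A g) :=
  Function.LeftInverse.injective (ofForm_toForm A)

theorem toForm_mem (v : FinMod A g) : toForm A g v ∈ forms g := by
  have : LinearMap.range (toForm A g) ≤ forms g := by
    rw [LinearMap.range_eq_map, ← (basis A g).span_eq, Submodule.map_span, Submodule.span_le]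
    rintro _ ⟨_, ⟨b, rfl⟩, rfl⟩
    rw [basis_eq_ket, toForm_ket A b.2]
    exact Submodule.smul_mem _ _ (e_mem b.2)
  exact this ⟨v, rfl⟩

theorem toForm_ofForm {w : ℤ →₀ ℂ} (hw : w ∈ forms g) : toForm A g (ofForm A g w) = w := by
  refine eq_on_forms (f := (toForm A g).comp (ofForm A g)) (f' := LinearMap.id)
    (fun b hb => ?_) hw
  rw [LinearMap.comp_apply, ofForm_e, map_smul, toForm_ket A hb, smul_smul,
    inv_mul_cancel₀ (norm_ne_zero _ _), one_smul, LinearMap.id_apply]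

theorem toForm_lie_Jladder (ε : ℤˣ) (v : FinMod A g) :
    toForm A g ⁅Jladder ε, v⁆ = BinaryForm.Jpm g ε (toForm A g v) := by
  have : (toForm A g).comp (Jpm A g ε) = (BinaryForm.Jpm g ε).comp (toForm A g) := by
    refine (basis A g).ext fun p => ?_
    obtain ⟨b, hb⟩ := p
    rw [basis_eq_ket, LinearMap.comp_apply, LinearMap.comp_apply, toForm_ket A hb, map_smul,
      Jpm_ket, map_smul, BinaryForm.Jpm, op_e, smul_smul]
    by_cases hb' : b + 2 * ε ∈ weights g
    · have k := norm_raise ε hb hb'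
      have q := sqrt_mul_self' ((g : ℂ) / 2 - (ε : ℤ) * (b / 2))
      rw [toForm_ket A hb', smul_smul, coeffC]
      congr 1
      linear_combination ((g : ℂ) / 2 - (ε : ℤ) * (b / 2)).sqrt * k + norm g b * q
    · have : (g : ℂ) / 2 - (ε : ℤ) * (b / 2) = 0 := by
        simp only [weights, Set.mem_ofPred_eq] at hb' hb
        rcases Int.units_eq_one_or ε with rfl | rfl
        · simp only [Units.val_one] at *
          rw [show b = g by omega]; push_cast; ring
        · simp only [Units.val_one, Units.val_neg] at *
          rw [show b = -g by omega]; push_cast; ring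
      rw [this, ket_of_not_mem A g hb', map_zero, smul_zero, mul_zero, zero_smul]
  rw [lie_Jladder]
  exact LinearMap.congr_fun this v

theorem toForm_lie_K (v : FinMod A g) :
    toForm A g ⁅Spin31.K 0, v⁆ = (Complex.I * (A : ℤ)) • BinaryForm.J0 (toForm A g v) := by
  have : (toForm A g).comp (J0 A g) = BinaryForm.J0.comp (toForm A g) := by
    refine (basis A g).ext fun b => ?_
    rw [basis_eq_ket, LinearMap.comp_apply, LinearMap.comp_apply, toForm_ket A b.2, map_smul,
      J0_ket, map_smul, toForm_ket A b.2, BinaryForm.J0, op_e, smul_comm]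
  rw [lie_K, K0_eq, LinearMap.smul_apply, map_smul]
  congr 1
  exact LinearMap.congr_fun this v

/-- The map between modules induced by an operator on forms. -/
noncomputable def transfer (A : ℤˣ) (g g' : ℤ) (f : Module.End ℂ (ℤ →₀ ℂ)) :
    FinMod A g →ₗ[ℂ] FinMod A g' :=
  (ofForm A g').comp (f.comp (toForm A g))

theorem toForm_transfer {f : Module.End ℂ (ℤ →₀ ℂ)} (hf : ∀ w ∈ forms g, f w ∈ forms g')
    (v : FinMod A g) : toForm A g' (transfer A g g' f v) = f (toForm A g v) :=
  toForm_ofForm A (hf _ (toForm_mem A v))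

theorem isDoublet_Z (hg : g' = g + 1) : IsDoublet A fun ε => transfer A g g' (Z ε) := by
  subst hg
  have hm := fun ε => toForm_transfer A fun w => Z_mem (g := g) ε (w := w)
  constructor <;> intro ε v <;> apply toForm_injective A <;>
    simp only [map_add, map_smul, hm, toForm_lie_Jladder A, toForm_lie_K A]
  · refine eq_on_forms (f := (BinaryForm.Jpm (g + 1) ε).comp (Z ε))
      (f' := (Z ε).comp (BinaryForm.Jpm g ε)) (fun b hb => ?_) (toForm_mem A v)
    rcases Int.units_eq_one_or ε with rfl | rfl <;>
    · simp only [LinearMap.comp_apply, BinaryForm.Jpm, Z, op_e, map_smul, Units.val_one,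
        Units.val_neg]
      push_cast
      ring_nf
  · refine eq_on_forms (f := (BinaryForm.Jpm (g + 1) ε).comp (Z (-ε)))
      (f' := Z ε + (Z (-ε)).comp (BinaryForm.Jpm g ε)) (fun b hb => ?_) (toForm_mem A v)
    rcases Int.units_eq_one_or ε with rfl | rfl <;>
    · simp only [LinearMap.comp_apply, LinearMap.add_apply, BinaryForm.Jpm, Z, op_e, map_smul,
        Units.val_one, Units.val_neg, neg_neg]
      push_cast
      ring_nf
      module
  · have := eq_on_forms (f := BinaryForm.J0.comp (Z ε))
      (f' := (Z ε).comp BinaryForm.J0 + (((ε : ℤ) : ℂ) / 2) • Z ε) (fun b hb => ?_)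
      (toForm_mem A v)
    · simp only [LinearMap.comp_apply, LinearMap.add_apply, LinearMap.smul_apply] at this
      rw [this, smul_add, smul_smul]
    · simp only [LinearMap.comp_apply, LinearMap.add_apply, LinearMap.smul_apply, BinaryForm.J0, Z,
        op_e, map_smul]
      push_cast
      module

theorem isDoublet_D (hg : g' = g - 1) : IsDoublet A fun ε => transfer A g g' (D g ε) := by
  subst hg
  have hm := fun ε => toForm_transfer A fun w => D_mem (g := g) ε (w := w)
  constructor <;> intro ε v <;> apply toForm_injective A <;>
    simp only [map_add, map_smul, hm, toForm_lie_Jladder A, toForm_lie_K A]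
  · refine eq_on_forms (f := (BinaryForm.Jpm (g - 1) ε).comp (D g ε))
      (f' := (D g ε).comp (BinaryForm.Jpm g ε)) (fun b hb => ?_) (toForm_mem A v)
    rcases Int.units_eq_one_or ε with rfl | rfl <;>
    · simp only [LinearMap.comp_apply, BinaryForm.Jpm, D, op_e, map_smul, Units.val_one,
        Units.val_neg, smul_smul]
      push_cast
      ring_nf
  · refine eq_on_forms (f := (BinaryForm.Jpm (g - 1) ε).comp (D g (-ε)))
      (f' := D g ε + (D g (-ε)).comp (BinaryForm.Jpm g ε)) (fun b hb => ?_) (toForm_mem A v)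
    rcases Int.units_eq_one_or ε with rfl | rfl <;>
    · simp only [LinearMap.comp_apply, LinearMap.add_apply, BinaryForm.Jpm, D, op_e, map_smul,
        Units.val_one, Units.val_neg, neg_neg]
      push_cast
      ring_nf
      module
  · have := eq_on_forms (f := BinaryForm.J0.comp (D g ε))
      (f' := (D g ε).comp BinaryForm.J0 + (((ε : ℤ) : ℂ) / 2) • D g ε) (fun b hb => ?_)
      (toForm_mem A v)
    · simp only [LinearMap.comp_apply, LinearMap.add_apply, LinearMap.smul_apply] at this
      rw [this, smul_add, smul_smul]
    · simp only [LinearMap.comp_apply, LinearMap.add_apply, LinearMap.smul_apply, BinaryForm.J0, D,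
        op_e, map_smul]
      push_cast
      module

/-- The Clebsch–Gordan decomposition of the tensor product with the two-dimensional module. -/
theorem repIso_spinor_tensor_finMod (g : ℤ) (hg : 0 ≤ g) :
    RepIso (fun x => LieModule.toEnd ℂ Spin31 (FinMod A 1 ⊗[ℂ] FinMod A (g + 1)) x)
      (prodRep (fun x => LieModule.toEnd ℂ Spin31 (FinMod A (g + 2)) x)
        (fun x => LieModule.toEnd ℂ Spin31 (FinMod A g) x)) := by
  have e₁ : g + 2 = g + 1 + 1 := by ring
  have e₂ : g = g + 1 - 1 := by ring
  have e₃ : g + 1 = g + 2 - 1 := by ring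
  -- The constant `c` is the degree `g + 1` of the forms plus one. It is positive, so this splitting
  -- has no exceptional case.
  have hc : (g : ℂ) + 2 ≠ 0 := by exact_mod_cast (by omega : g + 2 ≠ 0)
  have mZ := fun ε => toForm_transfer (g' := g + 2) A
    fun w hw => by have := Z_mem ε hw; rwa [← e₁] at this
  have mD := fun ε => toForm_transfer (g := g + 1) (g' := g) (f := D (g + 1) ε) A
    fun w hw => by have := D_mem ε hw; rwa [← e₂] at this
  have mZ' := fun ε => toForm_transfer A fun w => Z_mem (g := g) ε (w := w)
  have mD' := fun ε => toForm_transfer (g := g + 2) (g' := g + 1) (f := D (g + 2) ε) A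
    fun w hw => by have := D_mem ε hw; rwa [← e₃] at this
  refine repIso_spinor_tensor A (fun ε => transfer A g (g + 1) (Z ε))
    (fun ε => transfer A (g + 2) (g + 1) (D (g + 2) ε)) hc
    (isDoublet_Z A (g := g + 1) (g' := g + 2) e₁) (isDoublet_D A (g := g + 1) (g' := g) e₂)
    ?_ ?_ ?_ ?_ ?_ ?_
  · intro v
    apply toForm_injective A
    simp only [map_sub, map_smul, mZ, mD']
    refine eq_on_forms (f := (Z (-1)).comp (D (g + 2) 1) - (Z 1).comp (D (g + 2) (-1)))
      (f' := ((g : ℂ) + 2) • LinearMap.id) (fun b hb => ?_) (toForm_mem A v)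
    simp only [LinearMap.comp_apply, LinearMap.sub_apply, LinearMap.smul_apply, D, Z, op_e,
      map_smul, Units.val_one, Units.val_neg, LinearMap.id_apply]
    push_cast
    ring_nf
    module
  · intro v
    apply toForm_injective A
    simp only [mD, mD']
    have := eq_on_forms (f := (D (g + 1) 1).comp (D (g + 2) (-1)))
      (f' := (D (g + 1) (-1)).comp (D (g + 2) 1)) (fun b hb => by
        simp only [LinearMap.comp_apply, D, op_e, map_smul, Units.val_one, Units.val_neg]
        push_cast
        ring_nf
        module) (toForm_mem A v)
    rwa [LinearMap.comp_apply, LinearMap.comp_apply] at this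
  · intro v
    apply toForm_injective A
    simp only [mZ, mZ']
    have := eq_on_forms (f := (Z 1).comp (Z (-1))) (f' := (Z (-1)).comp (Z 1))
      (fun b hb => by
        simp only [LinearMap.comp_apply, Z, op_e, Units.val_one, Units.val_neg]
        ring_nf) (toForm_mem A v)
    rwa [LinearMap.comp_apply, LinearMap.comp_apply] at this
  · intro v
    apply toForm_injective A
    simp only [map_sub, map_smul, mD, mZ']
    refine eq_on_forms (f := (D (g + 1) 1).comp (Z (-1)) - (D (g + 1) (-1)).comp (Z 1))
      (f' := ((g : ℂ) + 2) • LinearMap.id) (fun b hb => ?_) (toForm_mem A v)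
    simp only [LinearMap.comp_apply, LinearMap.sub_apply, LinearMap.smul_apply, D, Z, op_e,
      Units.val_one, Units.val_neg, LinearMap.id_apply]
    push_cast
    ring_nf
    module
  · intro ε v
    apply toForm_injective A
    simp only [mZ, mD, mZ', mD']
    have := eq_on_forms (f := (D (g + 2) ε).comp (Z ε)) (f' := (Z ε).comp (D (g + 1) ε))
      (fun b hb => by
        rcases Int.units_eq_one_or ε with rfl | rfl <;>
        · simp only [LinearMap.comp_apply, D, Z, op_e, map_smul, Units.val_one, Units.val_neg]
          push_cast
          ring_nf) (toForm_mem A v)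
    rwa [LinearMap.comp_apply, LinearMap.comp_apply] at this
  · intro ε v
    apply toForm_injective A
    simp only [map_sub, map_smul, mZ, mD, mZ', mD']
    refine eq_on_forms (f := (Z (-ε)).comp (D (g + 1) ε) - (D (g + 2) (-ε)).comp (Z ε))
      (f' := (((ε : ℤ) : ℂ) * ((g : ℂ) + 2)) • LinearMap.id) (fun b hb => ?_) (toForm_mem A v)
    rcases Int.units_eq_one_or ε with rfl | rfl <;>
    · simp only [LinearMap.comp_apply, LinearMap.sub_apply, LinearMap.smul_apply, D, Z, op_e,
        map_smul, Units.val_one, Units.val_neg, LinearMap.id_apply, neg_neg]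
      push_cast
      ring_nf
      module

end FinMod

end SpinCG

namespace SpinCG

open Spin31

/-! ### Generation, commutant and Casimirs of the modules `V_{λ,ρ}` -/

namespace Formal

theorem J0_apply (w : Formal) (a b : ℤ) : J0 w (a, b) = (b / 2 : ℂ) * w (a, b) := by
  have : (Finsupp.lapply (a, b)).comp J0 = (b / 2 : ℂ) • (Finsupp.lapply (a, b) : Formal →ₗ[ℂ] ℂ) := by
    refine Finsupp.lhom_ext' fun p => LinearMap.ext_ring ?_
    have hp : (Finsupp.lsingle p : ℂ →ₗ[ℂ] Formal) 1 = e p.1 p.2 := rfl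
    simp only [LinearMap.comp_apply, hp, J0, op_e, LinearMap.smul_apply, map_smul,
      Finsupp.lapply_apply]
    simp only [e, smul_eq_mul, Finsupp.single_apply, Prod.mk.injEq]
    split_ifs with h
    · rw [h.2]
    · simp
  exact LinearMap.congr_fun this w

theorem Jpm_one_apply (w : Formal) (a b : ℤ) :
    Jpm 1 w (a, b + 2) = ((a : ℂ) / 2 - b / 2) * w (a, b) := by
  have : (Finsupp.lapply (a, b + 2)).comp (Jpm 1)
      = ((a : ℂ) / 2 - b / 2) • (Finsupp.lapply (a, b) : Formal →ₗ[ℂ] ℂ) := by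
    refine Finsupp.lhom_ext' fun p => LinearMap.ext_ring ?_
    have hp : (Finsupp.lsingle p : ℂ →ₗ[ℂ] Formal) 1 = e p.1 p.2 := rfl
    simp only [LinearMap.comp_apply, hp, Jpm, op_e, LinearMap.smul_apply, map_smul,
      Finsupp.lapply_apply]
    simp only [e, smul_eq_mul, Finsupp.single_apply, Prod.mk.injEq, Units.val_one,
      mul_one, add_left_inj]
    split_ifs with h
    · rw [h.1, h.2]; push_cast; ring
    · simp
  exact LinearMap.congr_fun this w

end Formal

namespace IrrMod

open Formal

variable (A : ℤˣ) {l : ℤ} {ρ : ℂ}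

theorem lie_Jladder_ofFormal (h : NonTerminating l ρ) (ε : ℤˣ) {a b : ℤ} (hL : Label l a b) :
    ⁅Jladder ε, ofFormal A l ρ (e a b)⁆
      = ((a : ℂ) / 2 - (ε : ℤ) * (b / 2)) • ofFormal A l ρ (e a (b + 2 * ε)) := by
  rw [← ofFormal_toFormal A h ⁅Jladder ε, ofFormal A l ρ (e a b)⁆, toFormal_lie_Jladder A h,
    toFormal_ofFormal A h (e_mem hL), Formal.Jpm, op_e, map_smul]

theorem lie_K_ofFormal (h : NonTerminating l ρ) {a b : ℤ} (hL : Label l a b) :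
    ⁅Spin31.K 0, ofFormal A l ρ (e a b)⁆ = (Complex.I * (A : ℤ)) •
      (up ((A : ℤ) * ρ) a • ofFormal A l ρ (e (a + 2) b)
        + (mid l ((A : ℤ) * ρ) a * (b / 2)) • ofFormal A l ρ (e a b)
        + (down l ((A : ℤ) * ρ) a * ((a : ℂ) / 2 + b / 2) * ((a : ℂ) / 2 - b / 2)) •
          ofFormal A l ρ (e (a - 2) b)) := by
  rw [← ofFormal_toFormal A h ⁅Spin31.K 0, ofFormal A l ρ (e a b)⁆, toFormal_lie_K A h,
    toFormal_ofFormal A h (e_mem hL), Formal.K0, op_e]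
  simp only [map_smul, map_add]

theorem toFormal_lie_J (v : IrrMod l ρ) :
    toFormal A l ρ ⁅Spin31.J 0, v⁆ = Formal.J0 (toFormal A l ρ v) := by
  have : (toFormal A l ρ).comp (J0 l ρ) = Formal.J0.comp (toFormal A l ρ) := by
    refine (basis l ρ).ext fun p => ?_
    have hp : (p.1.1, p.1.2) ∈ labels l ρ := p.2
    rw [basis_eq_ket, LinearMap.comp_apply, LinearMap.comp_apply, toFormal_ket A hp, map_smul,
      J0_ket, map_smul, toFormal_ket A hp, Formal.J0, op_e, smul_comm]
  rw [lie_J]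
  exact LinearMap.congr_fun this v

theorem label_diag (l : ℤ) (n : ℕ) : Label l (|l| + 2 * n) (|l| + 2 * n) := by
  have := two_dvd_abs_sub l
  have := abs_nonneg l
  exact ⟨by omega, by omega, by simp only [weights, Set.mem_ofPred_eq]; omega⟩

theorem label_lowest (l : ℤ) : Label l |l| |l| := by simpa using label_diag l 0

theorem lie_Jladder_one_diag (h : NonTerminating l ρ) (n : ℕ) :
    ⁅Jladder 1, ofFormal A l ρ (e (|l| + 2 * n) (|l| + 2 * n))⁆ = 0 := by
  rw [lie_Jladder_ofFormal A h 1 (label_diag l n)]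
  simp

/-- On a highest weight vector of a `K`-type the lowering term of `K₀` vanishes, and `J₊` kills the
diagonal one. Only the highest weight vector of the next `K`-type survives, and under nontermination
its coefficient is nonzero. -/
theorem lie_Jladder_lie_K_diag (h : NonTerminating l ρ) (n : ℕ) :
    ⁅Jladder 1, ⁅Spin31.K 0, ofFormal A l ρ (e (|l| + 2 * n) (|l| + 2 * n))⁆⁆
      = (Complex.I * (A : ℤ) * up ((A : ℤ) * ρ) (|l| + 2 * n)) •
        ofFormal A l ρ (e (|l| + 2 * (n + 1 : ℕ)) (|l| + 2 * (n + 1 : ℕ))) := by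
  have hL := label_diag l n
  have hL' : Label l (|l| + 2 * n + 2) (|l| + 2 * n) := by
    obtain ⟨h1, h2, h3⟩ := hL
    simp only [weights, Set.mem_ofPred_eq] at h3
    exact ⟨by omega, by omega, by simp only [weights, Set.mem_ofPred_eq]; omega⟩
  rw [lie_K_ofFormal A h hL, sub_self, mul_zero, zero_smul, add_zero, lie_smul, lie_add, lie_smul,
    lie_smul, lie_Jladder_one_diag A h, smul_zero, add_zero, lie_Jladder_ofFormal A h 1 hL']
  rw [show (|l| + 2 * (n : ℤ) + 2 : ℤ) = |l| + 2 * (n + 1 : ℕ) by push_cast; ring,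
    show (|l| + 2 * (n : ℤ) + 2 * ((1 : ℤˣ) : ℤ) : ℤ) = |l| + 2 * (n + 1 : ℕ) by push_cast; ring,
    smul_smul, smul_smul]
  congr 1
  push_cast
  ring

/-- The module is generated by the highest weight vector of its lowest `K`-type. -/
theorem eq_top_of_lowest_mem (h : NonTerminating l ρ) (S : Submodule ℂ (IrrMod l ρ))
    (hJ : ∀ ε, ∀ m ∈ S, ⁅Jladder ε, m⁆ ∈ S) (hK : ∀ m ∈ S, ⁅Spin31.K 0, m⁆ ∈ S)
    (h0 : ofFormal A l ρ (e |l| |l|) ∈ S) : S = ⊤ := by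
  -- `J₊K₀` climbs through the highest weight vectors of all `K`-types.
  have h1 : ∀ n : ℕ, ofFormal A l ρ (e (|l| + 2 * n) (|l| + 2 * n)) ∈ S := by
    intro n
    induction n with
    | zero => simpa using h0
    | succ n ih =>
      have := hJ 1 _ (hK _ ih)
      rw [lie_Jladder_lie_K_diag A h] at this
      have hL := label_diag l n
      have hA : ((A : ℤ) : ℂ) ≠ 0 := by exact_mod_cast A.ne_zero
      exact (S.smul_mem_iff (mul_ne_zero (mul_ne_zero Complex.I_ne_zero hA)
        (up_ne_zero A h hL.1 hL.2.1))).1 this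
  -- `J₋` descends within each `K`-type, with nonzero coefficient until the lowest weight is
  -- reached.
  have h2 : ∀ n k : ℕ, k ≤ |l| + 2 * n →
      ofFormal A l ρ (e (|l| + 2 * n) (|l| + 2 * n - 2 * k)) ∈ S := by
    intro n k hk
    induction k with
    | zero => simpa using h1 n
    | succ k ih =>
      have := hJ (-1) _ (ih (by push_cast at hk; omega))
      rw [lie_Jladder_ofFormal A h (-1)] at this
      · rw [show |l| + 2 * (n : ℤ) - 2 * k + 2 * ((-1 : ℤˣ) : ℤ)
          = |l| + 2 * n - 2 * (k + 1 : ℕ) by push_cast; ring] at this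
        refine (S.smul_mem_iff ?_).1 this
        have h3 : (|l| + 2 * n : ℤ) - k ≠ 0 := by push_cast at hk; omega
        have h4 : (((|l| + 2 * n : ℤ) - k : ℤ) : ℂ) ≠ 0 := by exact_mod_cast h3
        intro h5
        apply h4
        rw [← h5]
        push_cast; ring
      · obtain ⟨l1, l2, l3⟩ := label_diag l n
        simp only [weights, Set.mem_ofPred_eq] at l3
        push_cast at hk
        exact ⟨by omega, by omega, by simp only [weights, Set.mem_ofPred_eq]; omega⟩
  rw [eq_top_iff, ← (basis l ρ).span_eq, Submodule.span_le]
  rintro _ ⟨⟨⟨a, b⟩, hp⟩, rfl⟩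
  rw [basis_eq_ket]
  obtain ⟨l1, l2, l3⟩ := h.mem_labels.1 hp
  have hl := two_dvd_abs_sub l
  simp only [weights, Set.mem_ofPred_eq] at l3
  have h3 := h2 ((a - |l|) / 2).toNat ((a - b) / 2).toNat (by omega)
  rw [show |l| + 2 * (((a - |l|) / 2).toNat : ℤ) = a by omega,
    show a - 2 * (((a - b) / 2).toNat : ℤ) = b by omega, ofFormal_e] at h3
  exact (S.smul_mem_iff (inv_ne_zero (norm_ne_zero A h _ _))).1 h3

/-- Schur's lemma without analysis of submodules: the generating vector is, up to a scalar, the only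
vector of weight `|λ|` killed by `J₊`, so an endomorphism multiplies it by a scalar, and hence the
whole module. -/
theorem scalarCommutant (h : NonTerminating l ρ) :
    ScalarCommutant (fun x => LieModule.toEnd ℂ Spin31 (IrrMod l ρ) x) := by
  intro f hf
  simp only [LieModule.toEnd_apply_apply] at hf
  have hL := label_lowest l
  set v := ofFormal 1 l ρ (e |l| |l|) with hv
  have hvf : toFormal 1 l ρ v = e |l| |l| := toFormal_ofFormal 1 h (e_mem hL)
  have hJ : Formal.Jpm 1 (toFormal 1 l ρ (f v)) = 0 := by
    have := lie_Jladder_one_diag 1 h 0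
    simp only [Nat.cast_zero, mul_zero, add_zero] at this
    rw [← toFormal_lie_Jladder 1 h, ← hf, this, map_zero, map_zero]
  have hJ0 : Formal.J0 (toFormal 1 l ρ (f v)) = (|l| / 2 : ℂ) • toFormal 1 l ρ (f v) := by
    have : ⁅Spin31.J 0, v⁆ = (|l| / 2 : ℂ) • v := by
      apply toFormal_injective 1 h
      rw [toFormal_lie_J 1, map_smul, hvf, Formal.J0, op_e]
    rw [← toFormal_lie_J 1, ← hf, this, map_smul, map_smul]
  set w := toFormal 1 l ρ (f v) with hw
  -- At a label with nonzero coefficient, `J₊ w = 0` forces `a = b`, and the weight forces `b =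
  -- |l|`.
  have hwe : w = w (|l|, |l|) • e |l| |l| := by
    ext ⟨a, b⟩
    rw [Finsupp.smul_apply, e, Finsupp.single_apply, smul_eq_mul]
    split_ifs with hab
    · rw [← hab, mul_one]
    · rw [mul_zero]
      have k1 := Formal.Jpm_one_apply w a b
      have k2 := Formal.J0_apply w a b
      rw [hJ, Finsupp.zero_apply] at k1
      rw [hJ0, Finsupp.smul_apply, smul_eq_mul] at k2
      by_contra hne
      have e1 : (a : ℂ) = b := by
        rcases mul_eq_zero.1 k1.symm with k | k
        · linear_combination 2 * k
        · exact absurd k hne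
      have e2 := mul_right_cancel₀ hne k2
      have e3 : ((|l| : ℤ) : ℂ) = b := by linear_combination 2 * e2
      have e4 : a = b := by exact_mod_cast e1
      have e5 : |l| = b := by exact_mod_cast e3
      exact hab (by rw [e4, e5])
  have hfv : f v = w (|l|, |l|) • v := by
    apply toFormal_injective 1 h
    rw [map_smul, hvf, ← hwe]
  have htop := eq_top_of_lowest_mem 1 h (LinearMap.ker (f - w (|l|, |l|) • LinearMap.id))
    (fun ε m hm => ?_) (fun m hm => ?_) ?_
  · refine ⟨w (|l|, |l|), fun m => ?_⟩
    have hm : m ∈ LinearMap.ker (f - w (|l|, |l|) • LinearMap.id) := by rw [htop]; trivial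
    simpa [sub_eq_zero] using hm
  · simp only [LinearMap.mem_ker, LinearMap.sub_apply, LinearMap.smul_apply, LinearMap.id_apply,
      sub_eq_zero] at hm ⊢
    rw [hf, hm, lie_smul]
  · simp only [LinearMap.mem_ker, LinearMap.sub_apply, LinearMap.smul_apply, LinearMap.id_apply,
      sub_eq_zero] at hm ⊢
    rw [hf, hm, lie_smul]
  · simp only [LinearMap.mem_ker, LinearMap.sub_apply, LinearMap.smul_apply, LinearMap.id_apply,
      sub_eq_zero]
    exact hfv

end IrrMod

/-! ### Casimirs evaluated through `J₀`, `J_±` and `K₀` -/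

section Reduction

variable {M : Type} [AddCommGroup M] [Module ℂ M] [LieRingModule Spin31 M]
  [LieModule ℂ Spin31 M]

theorem lie_Kladder_eq (ε : ℤˣ) (v : M) :
    ⁅Kladder ε, v⁆ = ((ε : ℤ) : ℂ) • (⁅K 0, ⁅Jladder ε, v⁆⁆ - ⁅Jladder ε, ⁅K 0, v⁆⁆) := by
  rw [← lie_lie, lie_K_Jladder, smul_lie, smul_smul, unit_mul_self, one_smul]

theorem casimir1_apply (v : M) : casimir1 M v
    = ⁅J 0, ⁅K 0, v⁆⁆ + (1 / 2 : ℂ) • (⁅Jladder 1, ⁅Kladder (-1), v⁆⁆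
      + ⁅Jladder (-1), ⁅Kladder 1, v⁆⁆) := by
  rw [casimir1_eq_ladder]
  simp only [LinearMap.add_apply, Module.End.mul_apply, LieModule.toEnd_apply_apply,
    LinearMap.smul_apply]

/-- Raising operators are moved to the right, so that fewer terms survive on a highest weight
vector. -/
theorem casimir2_apply (v : M) : casimir2 M v
    = ⁅J 0, ⁅J 0, v⁆⁆ + (2 : ℂ) • ⁅J 0, v⁆ + ⁅Jladder (-1), ⁅Jladder 1, v⁆⁆
      - ⁅K 0, ⁅K 0, v⁆⁆ - ⁅Kladder (-1), ⁅Kladder 1, v⁆⁆ := by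
  have h := LinearMap.congr_fun (ladderRelations M).jpm v
  simp only [LinearMap.sub_apply, Module.End.mul_apply, LieModule.toEnd_apply_apply,
    LinearMap.smul_apply] at h
  have h' := LinearMap.congr_fun (ladderRelations M).kpm v
  simp only [LinearMap.sub_apply, Module.End.mul_apply, LieModule.toEnd_apply_apply,
    LinearMap.smul_apply] at h'
  rw [sub_eq_iff_eq_add] at h h'
  rw [casimir2_eq_ladder]
  simp only [LinearMap.add_apply, LinearMap.sub_apply, Module.End.mul_apply,
    LieModule.toEnd_apply_apply, LinearMap.smul_apply, h, h']
  module

end Reduction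

namespace IrrMod

open Formal

variable (A : ℤˣ) {l : ℤ} {ρ : ℂ}

/-- The Casimirs commute with the action, so the scalar commutant applies. Their values then need
only one coordinate of one vector. -/
theorem casimir_scalar (h : NonTerminating l ρ) :
    (∃ c : ℂ, ∀ v, casimir1 (IrrMod l ρ) v = c • v) ∧
      ∃ c : ℂ, ∀ v, casimir2 (IrrMod l ρ) v = c • v :=
  ⟨scalarCommutant h _ fun x v => (casimir_lie x v).1,
    scalarCommutant h _ fun x v => (casimir_lie x v).2⟩

theorem casimir1_irrMod (h : NonTerminating l ρ) (v : IrrMod l ρ) :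
    casimir1 (IrrMod l ρ) v = (Complex.I * (l / 2) * ρ) • v := by
  obtain ⟨⟨c, hc⟩, -⟩ := casimir_scalar h
  have h1 := congrArg (fun w => toFormal 1 l ρ w (|l|, |l|)) (hc (ofFormal 1 l ρ (e |l| |l|)))
  have hl : (|l| : ℤ) = 0 → l = 0 := abs_eq_zero.1
  have h0 : 0 ≤ |l| := abs_nonneg l
  have hL := label_lowest l
  rw [hc]
  congr 1
  generalize |l| = a at *
  simp only [casimir1_apply, lie_Kladder_eq, map_add, map_smul, map_sub, toFormal_lie_J 1,
    toFormal_lie_Jladder 1 h, toFormal_lie_K 1 h, toFormal_ofFormal 1 h (e_mem hL)] at h1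
  simp only [Formal.J0, Formal.Jpm, Formal.K0, op_e, map_add, map_smul] at h1
  simp [e] at h1
  rw [← h1, mid]
  have h2 : (a : ℂ) + 2 ≠ 0 := by exact_mod_cast (by omega : a + 2 ≠ 0)
  -- At `a = 0` the coefficient `mid` has a zero denominator; then `l = 0` as well and both sides
  -- vanish.
  by_cases ha : a = 0
  · simp [ha, hl ha]
  · have h3 : (a : ℂ) ≠ 0 := by exact_mod_cast ha
    field_simp
    ring

theorem casimir2_irrMod (h : NonTerminating l ρ) (v : IrrMod l ρ) :
    casimir2 (IrrMod l ρ) v = ((l / 2 : ℂ) ^ 2 + ρ ^ 2 - 1) • v := by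
  obtain ⟨-, c, hc⟩ := casimir_scalar h
  have h1 := congrArg (fun w => toFormal 1 l ρ w (|l|, |l|)) (hc (ofFormal 1 l ρ (e |l| |l|)))
  have hl : (|l| : ℤ) = 0 → l = 0 := abs_eq_zero.1
  have h0 : 0 ≤ |l| := abs_nonneg l
  have hL := label_lowest l
  rw [hc]
  congr 1
  generalize |l| = a at *
  simp only [casimir2_apply, lie_Kladder_eq, map_add, map_smul, map_sub, toFormal_lie_J 1,
    toFormal_lie_Jladder 1 h, toFormal_lie_K 1 h, toFormal_ofFormal 1 h (e_mem hL)] at h1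
  simp only [Formal.J0, Formal.Jpm, Formal.K0, op_e, map_add, map_smul] at h1
  have h5 : a + 2 + 2 = a + 4 := by ring
  simp [e, h5] at h1
  rw [← h1, mid, up, down]
  have h2 : (a : ℂ) + 2 ≠ 0 := by exact_mod_cast (by omega : a + 2 ≠ 0)
  have h3 : (a : ℂ) + 1 ≠ 0 := by exact_mod_cast (by omega : a + 1 ≠ 0)
  have h4 : (a : ℂ) + 3 ≠ 0 := by exact_mod_cast (by omega : a + 3 ≠ 0)
  have h6 : (a : ℂ) + 2 + 1 ≠ 0 := by exact_mod_cast (by omega : a + 2 + 1 ≠ 0)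
  push_cast
  by_cases ha : a = 0
  · simp [ha, hl ha]
    field_simp
    simp only [Complex.I_sq]
    ring
  · have h3 : (a : ℂ) ≠ 0 := by exact_mod_cast ha
    field_simp
    simp only [Complex.I_sq]
    ring

end IrrMod

end SpinCG

namespace SpinCG

open Spin31

/-! ### Decomposition of the tensor products -/

/-- The operators by which the Lie algebra acts on a module. -/
noncomputable abbrev lieRep (M : Type) [AddCommGroup M] [Module ℂ M] [LieRingModule Spin31 M]
    [LieModule ℂ Spin31 M] : Spin31 → Module.End ℂ M :=
  fun x => LieModule.toEnd ℂ Spin31 M x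

theorem lieRep_tensor (M N : Type) [AddCommGroup M] [Module ℂ M] [LieRingModule Spin31 M]
    [LieModule ℂ Spin31 M] [AddCommGroup N] [Module ℂ N] [LieRingModule Spin31 N]
    [LieModule ℂ Spin31 N] : lieRep (M ⊗[ℂ] N) = tensorRep (lieRep M) (lieRep N) := by
  funext x
  refine TensorProduct.ext' fun m n => ?_
  simp [tensorRep, lieRep, TensorProduct.LieModule.lie_tmul_right]

theorem RepIso.pi_reindex {X ι κ : Type} {M : ι → Type} [∀ i, AddCommGroup (M i)]
    [∀ i, Module ℂ (M i)] {π : ∀ i, X → Module.End ℂ (M i)} (e : κ ≃ ι) :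
    RepIso (piRep π) (piRep fun k => π (e k)) :=
  ⟨{ toFun m k := m (e k)
     invFun := (Equiv.piCongrLeft M e)
     map_add' _ _ := rfl
     map_smul' _ _ := rfl
     left_inv m := by
      funext i
      obtain ⟨k, rfl⟩ := e.surjective i
      rw [Equiv.piCongrLeft_apply_apply]
     right_inv m := by
      funext k
      exact Equiv.piCongrLeft_apply_apply M e m k }, fun _ _ => rfl⟩

theorem FinMod.lie_zero_weight (A : ℤˣ) (x : Spin31) (v : FinMod A 0) : ⁅x, v⁆ = 0 := by
  have hw : ∀ {b}, b ∈ weights 0 → b = 0 := fun h => by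
    simp only [weights, Set.mem_ofPred_eq] at h; omega
  have hJ0 : J0 A 0 = 0 := (basis A 0).ext fun b => by
    rw [basis_eq_ket, J0_ket, hw b.2]; simp
  have hJ : ∀ ε, Jpm A 0 ε = 0 := fun ε => (basis A 0).ext fun b => by
    rw [basis_eq_ket, Jpm_ket, hw b.2, ket_of_not_mem, smul_zero, LinearMap.zero_apply]
    intro h
    have := hw h
    have := ε.ne_zero
    omega
  induction x using induction_ladder generalizing v with
  | add x y hx hy => rw [add_lie, hx, hy, add_zero]
  | smul c x hx => rw [smul_lie, hx, smul_zero]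
  | lie x y hx hy => rw [lie_lie, hx v, hy v, lie_zero, lie_zero, sub_zero]
  | hJ ε => rw [FinMod.lie_Jladder, hJ, LinearMap.zero_apply]
  | hK => rw [FinMod.lie_K_eq, FinMod.lie_J, hJ0, LinearMap.zero_apply, smul_zero]

theorem repIso_finMod_zero_tensor (A : ℤˣ) (M : Type) [AddCommGroup M] [Module ℂ M]
    [LieRingModule Spin31 M] [LieModule ℂ Spin31 M] :
    RepIso (lieRep (FinMod A 0 ⊗[ℂ] M)) (lieRep M) := by
  have hw : (0 : ℤ) ∈ weights 0 := by simp [weights]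
  let _ : Unique (weights 0) := ⟨⟨⟨0, hw⟩⟩, fun b => Subtype.ext (by
    have := b.2
    simp only [weights, Set.mem_ofPred_eq] at this
    change b.1 = 0
    omega)⟩
  let e : FinMod A 0 ≃ₗ[ℂ] ℂ :=
    (FinMod.basis A 0).repr.trans (Finsupp.uniqueLinearEquiv ℂ ℂ (default : weights 0))
  refine ⟨(TensorProduct.congr e (LinearEquiv.refl ℂ M)).trans (TensorProduct.lid ℂ M),
    fun x m => ?_⟩
  induction m with
  | zero => simp
  | add a b ha hb => simp only [map_add, ha, hb]
  | tmul f m => simp [FinMod.lie_zero_weight, TensorProduct.LieModule.lie_tmul_right]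

/-- The summand `V_{λ+ν/2, ρ+Aν/2}`, with `λ = l/2`. -/
noncomputable abbrev shiftRep (A : ℤˣ) (l : ℤ) (ρ : ℂ) (ν : ℤ) :
    Spin31 → Module.End ℂ (IrrMod (l + ν) (ρ + ((A : ℤ) : ℂ) * ((ν : ℂ) / 2))) :=
  lieRep _

theorem shiftRep_congr (A : ℤˣ) (l : ℤ) (ρ : ℂ) {ν μ : ℤ} (h : ν = μ) :
    RepIso (shiftRep A l ρ ν) (shiftRep A l ρ μ) := by
  subst h
  exact RepIso.refl _

theorem repIso_spinor_tensor_shift (A : ℤˣ) {l : ℤ} {ρ : ℂ} {ν : ℤ}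
    (h : ∀ μ : ℤ, |μ - ν| ≤ 1 → NonTerminating (l + μ) (ρ + ((A : ℤ) : ℂ) * ((μ : ℂ) / 2)))
    (hx : ((l + ν : ℤ) : ℂ) / 2 + (A : ℤ) * (ρ + ((A : ℤ) : ℂ) * ((ν : ℂ) / 2)) ≠ 0) :
    RepIso (tensorRep (lieRep (FinMod A 1)) (shiftRep A l ρ ν))
      (prodRep (shiftRep A l ρ (ν + 1)) (shiftRep A l ρ (ν - 1))) := by
  rw [← lieRep_tensor]
  refine IrrMod.repIso_spinor_tensor_irrMod A (h ν (by simp)) (by ring) ?_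
    (h (ν + 1) (by simp)) (by ring) ?_ (h (ν - 1) (by simp)) hx <;>
  · push_cast; ring

/-- The decomposition of `F ⊗ V` indexed by `Fin (n + 1)`. -/
theorem repIso_tensor_fin (A : ℤˣ) (n : ℕ) (l : ℤ) (ρ : ℂ)
    (hN : ∀ ν : ℤ, |ν| ≤ n → NonTerminating (l + ν) (ρ + ((A : ℤ) : ℂ) * ((ν : ℂ) / 2)))
    (hx : ∀ ν : ℤ, |ν| < n →
      ((l + ν : ℤ) : ℂ) / 2 + (A : ℤ) * (ρ + ((A : ℤ) : ℂ) * ((ν : ℂ) / 2)) ≠ 0) :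
    RepIso (lieRep (FinMod A n ⊗[ℂ] IrrMod l ρ))
      (piRep fun i : Fin (n + 1) => shiftRep A l ρ (-n + 2 * (i : ℕ))) := by
  have hV : RepIso (lieRep (IrrMod l ρ)) (shiftRep A l ρ 0) := by
    have e1 : l = l + 0 := by ring
    have e2 : ρ = ρ + ((A : ℤ) : ℂ) * (((0 : ℤ) : ℂ) / 2) := by push_cast; ring
    have : ∀ l' ρ', l = l' → ρ = ρ' → RepIso (lieRep (IrrMod l ρ)) (lieRep (IrrMod l' ρ')) := by
      rintro _ _ rfl rfl
      exact RepIso.refl _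
    exact this _ _ e1 e2
  -- Two steps, because the Clebsch–Gordan rule for `F_{1/2} ⊗ F_{(n+1)/2}` involves both
  -- `F_{(n+2)/2}` and `F_{n/2}`.
  induction n using Nat.twoStepInduction with
  | zero =>
    refine (repIso_finMod_zero_tensor A _).trans (hV.trans ((shiftRep_congr A l ρ ?_).trans
      (RepIso.pi_one (π := fun i : Fin 1 => shiftRep A l ρ (-(0 : ℕ) + 2 * (i : ℕ)))).symm))
    simp
  | one =>
    have h1 : RepIso (lieRep (FinMod A (1 : ℕ) ⊗[ℂ] IrrMod l ρ))
        (prodRep (shiftRep A l ρ (0 + 1)) (shiftRep A l ρ (0 - 1))) := by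
      rw [lieRep_tensor]
      exact (RepIso.tensor (RepIso.refl _) hV).trans (repIso_spinor_tensor_shift A
        (fun μ hμ => hN μ (by simpa using hμ)) (hx 0 (by simp)))
    refine h1.trans (RepIso.prod_comm.trans ?_)
    refine (RepIso.prod (shiftRep_congr A l ρ ?_)
      ((shiftRep_congr A l ρ ?_).trans (RepIso.pi_one
      (π := fun i : Fin 1 => shiftRep A l ρ (-(1 : ℕ) + 2 * ((i : ℕ) + 1 : ℕ)))).symm)).trans
      (RepIso.pi_succ (n := 1) (π := fun i : ℕ => shiftRep A l ρ (-(1 : ℕ) + 2 * i))).symm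
    · simp
    · simp
  | more n ih ih1 =>
    have ih := ih (fun ν hν => hN ν (by push_cast; omega)) (fun ν hν => hx ν (by push_cast; omega))
    have ih1 : RepIso (lieRep (FinMod A ((n : ℤ) + 1) ⊗[ℂ] IrrMod l ρ))
        (piRep fun i : Fin (n + 2) => shiftRep A l ρ (-(n + 1 : ℕ) + 2 * (i : ℕ))) :=
      ih1 (fun ν hν => hN ν (by push_cast at hν ⊢; omega))
        (fun ν hν => hx ν (by push_cast at hν ⊢; omega))
    rw [lieRep_tensor] at ih ih1
    have hF : RepIso (tensorRep (lieRep (FinMod A 1)) (lieRep (FinMod A ((n : ℤ) + 1))))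
        (prodRep (lieRep (FinMod A ((n + 2 : ℕ) : ℤ))) (lieRep (FinMod A n))) := by
      rw [← lieRep_tensor]
      exact FinMod.repIso_spinor_tensor_finMod A n (by omega)
    rw [lieRep_tensor]
    -- The triple product `F_{1/2} ⊗ F_{(n+1)/2} ⊗ V`, expanded on one side by Clebsch–Gordan and on
    -- the other by the induction hypothesis for `n + 1`.
    have k1 := RepIso.prod_tensor.symm.trans ((hF.symm.tensor (RepIso.refl (lieRep (IrrMod l ρ)))).trans
      (RepIso.tensor_assoc.trans (((RepIso.refl _).tensor ih1).trans RepIso.tensor_pi)))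
    have k2 : RepIso (piRep fun i : Fin (n + 2) =>
        tensorRep (lieRep (FinMod A 1)) (shiftRep A l ρ (-(n + 1 : ℕ) + 2 * (i : ℕ))))
        (piRep fun i : Fin (n + 2) => prodRep (shiftRep A l ρ (-n + 2 * (i : ℕ)))
          (shiftRep A l ρ (-(n + 2 : ℕ) + 2 * (i : ℕ)))) :=
      RepIso.pi fun i => (repIso_spinor_tensor_shift A
        (fun μ hμ => hN μ (by have := i.2; push_cast at hμ ⊢; rw [abs_le] at *; omega))
        (hx _ (by have := i.2; push_cast; rw [abs_lt]; omega))).trans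
        ((shiftRep_congr A l ρ (by push_cast; ring)).prod
          (shiftRep_congr A l ρ (by push_cast; ring)))
    -- Splitting each summand yields two strings of shifts. The lower one consists of the extreme
    -- shift `-(n + 2)` and of the decomposition of `F_{n/2} ⊗ V`. The extreme shift joins the upper
    -- string to form the answer for `n + 2`, and the rest is to be cancelled.
    have k3 : RepIso (piRep fun i : Fin (n + 2) => shiftRep A l ρ (-(n + 2 : ℕ) + 2 * (i : ℕ)))
        (prodRep (shiftRep A l ρ (-(n + 2 : ℕ) + 2 * (0 : ℕ)))
          (piRep fun i : Fin (n + 1) => shiftRep A l ρ (-n + 2 * (i : ℕ)))) :=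
      (RepIso.pi_succ (π := fun i : ℕ => shiftRep A l ρ (-(n + 2 : ℕ) + 2 * i))).trans
        ((RepIso.refl _).prod (RepIso.pi fun i => shiftRep_congr A l ρ (by push_cast; ring)))
    have k4 : RepIso (prodRep (shiftRep A l ρ (-(n + 2 : ℕ) + 2 * (0 : ℕ)))
          (piRep fun i : Fin (n + 2) => shiftRep A l ρ (-n + 2 * (i : ℕ))))
        (piRep fun i : Fin (n + 3) => shiftRep A l ρ (-(n + 2 : ℕ) + 2 * (i : ℕ))) :=
      ((RepIso.refl _).prod (RepIso.pi fun i =>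
        shiftRep_congr A l ρ (by push_cast; ring))).trans
        (RepIso.pi_succ (π := fun i : ℕ => shiftRep A l ρ (-(n + 2 : ℕ) + 2 * i))).symm
    refine RepIso.cancel_pi (ψ := fun i : ℕ => shiftRep A l ρ (-n + 2 * i)) (n := n + 1)
      (fun i hi => IrrMod.scalarCommutant (hN _ ?_)) ?_
    · rw [abs_le]; push_cast; omega
    · exact (((RepIso.refl _).prod ih.symm).trans (k1.trans (k2.trans (RepIso.pi_prod.trans
        ((RepIso.refl _).prod k3))))).trans (RepIso.prod_assoc.symm.trans
          ((RepIso.prod_comm.trans k4).prod (RepIso.refl _)))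

end SpinCG

/-! ### Nontermination of the shifted modules and the decomposition over `ℳ_γ` -/

namespace SpinCG

open Spin31

/-- Only `2ρ = d` integral with the parity of `l` matters. Nontermination then says `|d| ≤ |l|`, and
nondegeneracy says `|d + Al| ≥ 2g`. So `|l| ≥ g ≥ |ν|`, a shift by `ν` does not reverse the sign of
`l`, and `|d + Aν| ≤ |l + ν|` follows from the two bounds. -/
theorem NonTerminating.shift {A : ℤˣ} {g l : ℤ} {ρ : ℂ} (h : NonTerminating l ρ)
    (hne : ¬ ∃ n : ℤ, -g < n ∧ n < g ∧ ρ + ((A : ℤ) : ℂ) * ((l : ℂ) / 2) = (n : ℂ))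
    {ν : ℤ} (hν : |ν| ≤ g) :
    NonTerminating (l + ν) (ρ + ((A : ℤ) : ℂ) * ((ν : ℂ) / 2)) := by
  have hd : ∀ c d : ℤ, |l + ν| < c → (2 : ℤ) ∣ c - (l + ν) → 2 * ρ = d →
      d + A * ν ≠ c ∧ d + A * ν ≠ -c := by
    intro c d hc h2 hρ
    have h1 : (2 : ℤ) ∣ d - l → |d| ≤ |l| := by
      intro hdl
      by_contra! hlt
      obtain ⟨p, q⟩ := h |d| hlt (by rcases abs_choice d with e | e <;> rw [e] <;> omega)
      rcases abs_choice d with e | e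
      · rw [e] at p; exact p hρ
      · rw [e] at q; exact q (by rw [hρ]; push_cast; ring)
    have h3 : ∀ n : ℤ, 2 * n = d + A * l → n ≤ -g ∨ g ≤ n := by
      intro n hn
      by_contra! hlt
      refine hne ⟨n, by omega, by omega, ?_⟩
      have : (2 * n : ℂ) = d + A * l := by exact_mod_cast hn
      linear_combination (1 / 2 : ℂ) * hρ - (1 / 2 : ℂ) * this
    have h4 := h3 ((d + A * l) / 2)
    rcases Int.units_eq_one_or A with rfl | rfl
    · simp only [Units.val_one, one_mul] at *
      constructor <;> intro h0 <;> rcases abs_cases d with h5 | h5 <;>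
        rcases abs_cases l with h6 | h6 <;> rcases abs_cases (l + ν) with h7 | h7 <;>
        rcases abs_cases ν with h8 | h8 <;> omega
    · simp only [Units.val_neg, Units.val_one, neg_mul, one_mul] at *
      constructor <;> intro h0 <;> rcases abs_cases d with h5 | h5 <;>
        rcases abs_cases l with h6 | h6 <;> rcases abs_cases (l + ν) with h7 | h7 <;>
        rcases abs_cases ν with h8 | h8 <;> omega
  intro c hc h2
  constructor
  · intro h0
    refine (hd c (c - A * ν) hc h2 ?_).1 (by ring)
    push_cast; linear_combination h0
  · intro h0
    refine (hd c (-c - A * ν) hc h2 ?_).2 (by ring)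
    push_cast; linear_combination h0

/-- The weights of `F^A_γ` in increasing order. -/
def finEquivWeights (n : ℕ) : Fin (n + 1) ≃ weights n where
  toFun i := ⟨-n + 2 * (i : ℕ), by
    have := i.2; simp only [weights, Set.mem_ofPred_eq]; omega⟩
  invFun ν := ⟨((ν.1 + n) / 2).toNat, by
    have := ν.2; simp only [weights, Set.mem_ofPred_eq] at this; omega⟩
  left_inv i := by ext; simp
  right_inv ν := by
    have := ν.2
    simp only [weights, Set.mem_ofPred_eq] at this
    ext
    simp only
    omega

theorem repIso_tensor_weights (A : ℤˣ) {g l : ℤ} {ρ : ℂ} (hg : 0 ≤ g) (h : NonTerminating l ρ)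
    (hne : ¬ ∃ n : ℤ, -g < n ∧ n < g ∧ ρ + ((A : ℤ) : ℂ) * ((l : ℂ) / 2) = (n : ℂ)) :
    RepIso (lieRep (FinMod A g ⊗[ℂ] IrrMod l ρ))
      (piRep fun ν : weights g => shiftRep A l ρ ν) := by
  lift g to ℕ using hg
  have key : RepIso (piRep fun i : Fin (g + 1) => shiftRep A l ρ (-g + 2 * (i : ℕ)))
      (piRep fun ν : weights g => shiftRep A l ρ ν) :=
    (RepIso.pi fun i => shiftRep_congr A l ρ
      (show _ = ((finEquivWeights g i : weights g) : ℤ) from rfl)).trans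
      (RepIso.pi_reindex (π := fun ν : weights g => shiftRep A l ρ ν) (finEquivWeights g)).symm
  refine (repIso_tensor_fin A g l ρ (fun ν hν => h.shift hne hν) fun ν hν h0 => ?_).trans key
  -- The constant to be inverted at the shift `ν` is `λ + Aρ + ν`; if it vanishes, then `ρ + Aλ =
  -- -Aν`.
  refine hne ⟨-A * ν, ?_⟩
  rw [abs_lt] at hν
  refine ⟨?_, ?_, ?_⟩
  · rcases Int.units_eq_one_or A with rfl | rfl <;> simp <;> omega
  · rcases Int.units_eq_one_or A with rfl | rfl <;> simp <;> omega
  · push_cast at h0 ⊢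
    have := unit_mul_self A
    linear_combination (A : ℤ) * h0 - (ρ + (A : ℤ) * (ν / 2)) * this

theorem casimir_map {M N : Type} [AddCommGroup M] [Module ℂ M] [LieRingModule Spin31 M]
    [LieModule ℂ Spin31 M] [AddCommGroup N] [Module ℂ N] [LieRingModule Spin31 N]
    [LieModule ℂ Spin31 N] (f : M →ₗ[ℂ] N) (hf : ∀ (x : Spin31) m, f ⁅x, m⁆ = ⁅x, f m⁆) (m : M) :
    f (casimir1 M m) = casimir1 N (f m) ∧ f (casimir2 M m) = casimir2 N (f m) := by
  simp [casimir1, casimir2, hf]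

end SpinCG

/-! ### Direct sum, common eigenbasis and joint eigenvalues -/

namespace SpinCG

open Spin31

/-- An intertwiner onto a finite product gives an equivalence with the direct sum. -/
theorem RepIso.nonempty_lieModuleEquiv {ι M : Type} [Finite ι] [AddCommGroup M] [Module ℂ M]
    [LieRingModule Spin31 M] [LieModule ℂ Spin31 M] {N : ι → Type} [∀ i, AddCommGroup (N i)]
    [∀ i, Module ℂ (N i)] [∀ i, LieRingModule Spin31 (N i)] [∀ i, LieModule ℂ Spin31 (N i)]
    (h : RepIso (lieRep M) (piRep fun i => lieRep (N i))) :
    Nonempty (M ≃ₗ⁅ℂ, Spin31⁆ ⨁ i, N i) := by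
  classical
  have := Fintype.ofFinite ι
  obtain ⟨e, he⟩ := h
  let f := e.trans (DirectSum.linearEquivFunOnFintype ℂ ι N).symm
  have hf : ∀ m i, f m i = e m i := fun m i => congrFun
    ((DirectSum.linearEquivFunOnFintype ℂ ι N).apply_symm_apply (e m)) i
  refine ⟨{ f with map_lie' := fun {x m} => ?_ }⟩
  change f ⁅x, m⁆ = ⁅x, f m⁆
  refine DFinsupp.ext fun i => ?_
  rw [DirectSum.lie_module_bracket_apply, hf, hf]
  exact congrFun (he x m) i

section Scalars

variable {ι M : Type} [AddCommGroup M] [Module ℂ M] {N : ι → Type}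
  [∀ i, AddCommGroup (N i)] [∀ i, Module ℂ (N i)] {S T : Module.End ℂ M} {s t : ι → ℂ}

theorem simultaneouslyDiagonalisable_of_equiv_pi [Finite ι] {e : M ≃ₗ[ℂ] ∀ i, N i}
    (hS : ∀ m i, e (S m) i = s i • e m i) (hT : ∀ m i, e (T m) i = t i • e m i)
    {κ : ι → Type} (b : ∀ i, Module.Basis (κ i) ℂ (N i)) :
    SimultaneouslyDiagonalisable S T := by
  classical
  have := Fintype.ofFinite ι
  have key : ∀ (S : Module.End ℂ M) (s : ι → ℂ), (∀ m i, e (S m) i = s i • e m i) →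
      ∀ p, S (((Pi.basis b).map e.symm) p) = s p.1 • ((Pi.basis b).map e.symm) p := by
    intro S s hS p
    apply e.injective
    funext i
    rw [hS, map_smul, Pi.smul_apply, Module.Basis.map_apply, e.apply_symm_apply, Pi.basis_apply]
    rcases eq_or_ne i p.1 with rfl | hi
    · rfl
    · rw [Pi.single_eq_of_ne hi, smul_zero, smul_zero]
  exact ⟨_, (Pi.basis b).map e.symm, fun p => ⟨s p.1, t p.1, key S s hS p, key T t hT p⟩⟩

/-- A joint eigenvector has some nonzero coordinate, and that single index determines both
eigenvalues; conversely each nonzero summand supplies an eigenvector. -/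
theorem isJointEigenvalue_iff_of_equiv_pi {e : M ≃ₗ[ℂ] ∀ i, N i}
    (hS : ∀ m i, e (S m) i = s i • e m i) (hT : ∀ m i, e (T m) i = t i • e m i)
    [∀ i, Nontrivial (N i)] (a b : ℂ) :
    IsJointEigenvalue S T a b ↔ ∃ i, a = s i ∧ b = t i := by
  classical
  constructor
  · rintro ⟨v, hv, ha, hb⟩
    obtain ⟨i, hi⟩ := Function.ne_iff.1 ((e.map_ne_zero_iff).2 hv)
    refine ⟨i, smul_left_injective ℂ hi ?_, smul_left_injective ℂ hi ?_⟩
    · have := hS v i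
      rwa [ha, map_smul] at this
    · have := hT v i
      rwa [hb, map_smul] at this
  · rintro ⟨i, rfl, rfl⟩
    obtain ⟨w, hw⟩ := exists_ne (0 : N i)
    have key : ∀ (S : Module.End ℂ M) (s : ι → ℂ), (∀ m i, e (S m) i = s i • e m i) →
        S (e.symm (Pi.single i w)) = s i • e.symm (Pi.single i w) := by
      intro S s hS
      apply e.injective
      funext j
      rw [hS, map_smul, Pi.smul_apply, e.apply_symm_apply]
      rcases eq_or_ne j i with rfl | hj
      · rfl
      · rw [Pi.single_eq_of_ne hj, smul_zero, smul_zero]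
    refine ⟨e.symm (Pi.single i w), ?_, key S s hS, key T t hT⟩
    rw [Ne, LinearEquiv.map_eq_zero_iff, Pi.single_eq_zero_iff]
    exact hw

end Scalars

theorem NonTerminating.nontrivial {l : ℤ} {ρ : ℂ} (h : NonTerminating l ρ) :
    Nontrivial (IrrMod l ρ) :=
  ⟨_, 0, (IrrMod.basis l ρ).ne_zero ⟨(|l|, |l|), h.mem_labels.2 (IrrMod.label_lowest l)⟩⟩

instance (g : ℤ) : Finite (weights g) :=
  (Set.finite_Icc (-g) g).subset fun _ hb => ⟨hb.1, hb.2.1⟩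

section Nondegenerate

variable (A : ℤˣ) {g l : ℤ} {ρ : ℂ}

theorem exists_equiv_pi_casimir (hg : 0 ≤ g) (h : NonTerminating l ρ)
    (hne : ¬ ∃ n : ℤ, -g < n ∧ n < g ∧ ρ + ((A : ℤ) : ℂ) * ((l : ℂ) / 2) = (n : ℂ)) :
    ∃ e : (FinMod A g ⊗[ℂ] IrrMod l ρ) ≃ₗ[ℂ] ∀ ν : weights g,
      IrrMod (l + (ν : ℤ)) (ρ + ((A : ℤ) : ℂ) * (((ν : ℤ) : ℂ) / 2)),
      (∀ m ν, e (casimir1 _ m) ν = (Complex.I * ((l : ℂ) / 2 + (ν : ℤ) / 2)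
        * (ρ + ((A : ℤ) : ℂ) * ((ν : ℤ) / 2))) • e m ν) ∧
      ∀ m ν, e (casimir2 _ m) ν = (((l : ℂ) / 2 + (ν : ℤ) / 2) ^ 2
        + (ρ + ((A : ℤ) : ℂ) * ((ν : ℤ) / 2)) ^ 2 - 1) • e m ν := by
  obtain ⟨e, he⟩ := repIso_tensor_weights A hg h hne
  have hν : ∀ ν : weights g, |(ν : ℤ)| ≤ g := fun ν => abs_le.2 ⟨ν.2.1, ν.2.2.1⟩
  refine ⟨e, fun m ν => ?_, fun m ν => ?_⟩
  · have := (casimir_map ((LinearMap.proj ν).comp e.toLinearMap)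
      (fun x m => congrFun (he x m) ν) m).1
    rw [IrrMod.casimir1_irrMod (h.shift hne (hν ν))] at this
    refine this.trans ?_
    congr 1
    push_cast; ring
  · have := (casimir_map ((LinearMap.proj ν).comp e.toLinearMap)
      (fun x m => congrFun (he x m) ν) m).2
    rw [IrrMod.casimir2_irrMod (h.shift hne (hν ν))] at this
    refine this.trans ?_
    congr 1
    push_cast; ring

theorem simultaneouslyDiagonalisable_tensor (hg : 0 ≤ g) (h : NonTerminating l ρ)
    (hne : ¬ ∃ n : ℤ, -g < n ∧ n < g ∧ ρ + ((A : ℤ) : ℂ) * ((l : ℂ) / 2) = (n : ℂ)) :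
    SimultaneouslyDiagonalisable (casimir1 (FinMod A g ⊗[ℂ] IrrMod l ρ))
      (casimir2 (FinMod A g ⊗[ℂ] IrrMod l ρ)) := by
  obtain ⟨e, h1, h2⟩ := exists_equiv_pi_casimir A hg h hne
  exact simultaneouslyDiagonalisable_of_equiv_pi h1 h2 fun ν => IrrMod.basis _ _

theorem isJointEigenvalue_tensor_iff (hg : 0 ≤ g) (h : NonTerminating l ρ)
    (hne : ¬ ∃ n : ℤ, -g < n ∧ n < g ∧ ρ + ((A : ℤ) : ℂ) * ((l : ℂ) / 2) = (n : ℂ)) (s t : ℂ) :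
    IsJointEigenvalue (casimir1 (FinMod A g ⊗[ℂ] IrrMod l ρ))
      (casimir2 (FinMod A g ⊗[ℂ] IrrMod l ρ)) s t ↔
      ∃ ν ∈ weights g, s = Complex.I * ((l : ℂ) / 2 + (ν : ℂ) / 2)
          * (ρ + ((A : ℤ) : ℂ) * ((ν : ℂ) / 2)) ∧
        t = ((l : ℂ) / 2 + (ν : ℂ) / 2) ^ 2 + (ρ + ((A : ℤ) : ℂ) * ((ν : ℂ) / 2)) ^ 2 - 1 := by
  obtain ⟨e, h1, h2⟩ := exists_equiv_pi_casimir A hg h hne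
  have (ν : weights g) :
      Nontrivial (IrrMod (l + (ν : ℤ)) (ρ + ((A : ℤ) : ℂ) * (((ν : ℤ) : ℂ) / 2))) :=
    (h.shift hne (abs_le.2 ⟨ν.2.1, ν.2.2.1⟩)).nontrivial
  rw [isJointEigenvalue_iff_of_equiv_pi h1 h2, Subtype.exists]
  simp only [exists_prop]

end Nondegenerate

end SpinCG

namespace SpinCG

open Spin31

/-! ### The Casimir coupling on `F ⊗ N` -/

section SelfDual

variable (A : ℤˣ) (N : Type) [AddCommGroup N] [Module ℂ N] [LieRingModule Spin31 N]
  [LieModule ℂ Spin31 N]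

/-- The operator of `J₀ - iA K₀`. -/
noncomputable def chiral0 : Module.End ℂ N :=
  LieModule.toEnd ℂ Spin31 N (J 0) - (Complex.I * (A : ℤ)) • LieModule.toEnd ℂ Spin31 N (K 0)

/-- The operators of `J± - iA K±`. -/
noncomputable def chiral (ε : ℤˣ) : Module.End ℂ N :=
  LieModule.toEnd ℂ Spin31 N (Jladder ε)
    - (Complex.I * (A : ℤ)) • LieModule.toEnd ℂ Spin31 N (Kladder ε)

/-- The Casimir operator of the chiral `sl₂`. -/
noncomputable def chiralCasimir : Module.End ℂ N :=
  (1 / 4 : ℂ) • (casimir2 N - (2 * (Complex.I * (A : ℤ))) • casimir1 N)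

theorem I_mul_unit_sq : (Complex.I * ((A : ℤ) : ℂ)) * (Complex.I * ((A : ℤ) : ℂ)) = -1 := by
  rcases Int.units_eq_one_or A with rfl | rfl <;> simp

/-- `κ = iA` satisfies `κ² = -1`, so `J - κK` closes under brackets. It is twice a standard `sl₂`
triple, whence the factors `2` and `4`. -/
theorem chiral_relations : chiral0 A N * chiral A N 1 - chiral A N 1 * chiral0 A N
      = (2 : ℂ) • chiral A N 1 ∧
    chiral0 A N * chiral A N (-1) - chiral A N (-1) * chiral0 A N
      = -((2 : ℂ) • chiral A N (-1)) ∧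
    chiral A N 1 * chiral A N (-1) - chiral A N (-1) * chiral A N 1 = (4 : ℂ) • chiral0 A N := by
  obtain ⟨h1, h2, h3, h4, h5, h6, h7, h8, h9, h10, h11, h12, h13, h14, h15⟩ := ladderRelations N
  have hk := I_mul_unit_sq A
  simp only [chiral0, chiral, sub_mul, mul_sub, smul_mul_assoc, mul_smul_comm]
  generalize Complex.I * ((A : ℤ) : ℂ) = κ at *
  refine ⟨?_, ?_, ?_⟩
  · linear_combination (norm := module) h1 - κ • h5 + κ • h7 + (κ * κ) • h13
      - hk • LieModule.toEnd ℂ Spin31 N (Jladder 1)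
  · linear_combination (norm := module) h2 - κ • h6 + κ • h8 + (κ * κ) • h14
      + hk • LieModule.toEnd ℂ Spin31 N (Jladder (-1))
  · linear_combination (norm := module) h3 - κ • h11 + κ • h12 + (κ * κ) • h15
      - (2 : ℂ) • (hk • LieModule.toEnd ℂ Spin31 N (J 0))

/-- With `S = (J - iAK)/2` this is `S·S = S₀² + S₀ + S₋S₊`, while expanding the square gives the
combination of the two Casimirs in the definition. -/
theorem chiralCasimir_eq : chiralCasimir A N = (1 / 4 : ℂ) • (chiral0 A N * chiral0 A N
    + (2 : ℂ) • chiral0 A N + chiral A N (-1) * chiral A N 1) := by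
  have h3 := (chiral_relations A N).2.2
  have hk := I_mul_unit_sq A
  obtain ⟨-, -, -, h4, -, -, -, -, -, -, h11, h12, -, -, -⟩ := ladderRelations N
  rw [chiralCasimir, casimir1_eq_ladder, casimir2_eq_ladder]
  simp only [chiral0, chiral] at h3 ⊢
  generalize Complex.I * ((A : ℤ) : ℂ) = κ at *
  simp only [sub_mul, mul_sub, smul_mul_assoc, mul_smul_comm, smul_add, smul_sub, smul_smul]
    at h3 ⊢
  linear_combination (norm := module) (1 / 8 : ℂ) • h3 - (κ / 8) • h11 - (κ / 8) • h12
    - (κ / 4) • h4 - (1 / 4 : ℂ) • (hk • (LieModule.toEnd ℂ Spin31 N (K 0)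
      * LieModule.toEnd ℂ Spin31 N (K 0) + (1 / 2 : ℂ) • (LieModule.toEnd ℂ Spin31 N (Kladder 1)
        * LieModule.toEnd ℂ Spin31 N (Kladder (-1)) + LieModule.toEnd ℂ Spin31 N (Kladder (-1))
        * LieModule.toEnd ℂ Spin31 N (Kladder 1))))

variable (g : ℤ)

/-- The coupling `∑ₐ Jₐ ⊗ (Jₐ - iA Kₐ)`. -/
noncomputable def coupling : Module.End ℂ (FinMod A g ⊗[ℂ] N) :=
  TensorProduct.map (LieModule.toEnd ℂ Spin31 _ (J 0)) (chiral0 A N)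
    + (1 / 2 : ℂ) • (TensorProduct.map (LieModule.toEnd ℂ Spin31 _ (Jladder 1)) (chiral A N (-1))
      + TensorProduct.map (LieModule.toEnd ℂ Spin31 _ (Jladder (-1))) (chiral A N 1))

variable {A g}

theorem FinMod.lie_Kladder_eq (ε : ℤˣ) (v : FinMod A g) :
    ⁅Kladder ε, v⁆ = (Complex.I * (A : ℤ)) • ⁅Jladder ε, v⁆ := by
  rw [FinMod.lie_Kladder, FinMod.lie_Jladder, FinMod.Kpm_eq, LinearMap.smul_apply]

theorem FinMod.casimir_J (v : FinMod A g) :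
    ⁅J 0, ⁅J 0, v⁆⁆ + (1 / 2 : ℂ) • (⁅Jladder 1, ⁅Jladder (-1), v⁆⁆
      + ⁅Jladder (-1), ⁅Jladder 1, v⁆⁆) = ((g : ℂ) / 2 * (g / 2 + 1)) • v := by
  suffices J0 A g * J0 A g + (1 / 2 : ℂ) • (Jpm A g 1 * Jpm A g (-1) + Jpm A g (-1) * Jpm A g 1)
      = ((g : ℂ) / 2 * (g / 2 + 1)) • 1 by
    have := LinearMap.congr_fun this v
    simpa only [FinMod.lie_J, FinMod.lie_Jladder, LinearMap.add_apply, LinearMap.smul_apply,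
      Module.End.mul_apply, Module.End.one_apply] using this
  refine end_ext A g fun b => ?_
  simp only [LinearMap.add_apply, LinearMap.smul_apply, Module.End.mul_apply, J0_ket, Jpm_ket,
    map_smul, Units.val_one, Units.val_neg, coeffC, Module.End.one_apply]
  push_cast
  simp only [neg_add_cancel_right, add_neg_cancel_right]
  match_scalars
  ring_nf
  simp only [sqrt_sq']
  ring_nf

/-- On `F^A_γ` boosts are `iA` times rotations. The cross terms of both Casimirs therefore become
multiples of `∑ Jₐ ⊗ (Jₐ - iA Kₐ)`, and the terms on `F` reduce to `γ(γ + 1)`. -/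
theorem casimir_tensor (m : FinMod A g ⊗[ℂ] N) :
    casimir1 _ m = (Complex.I * (A : ℤ) * ((g : ℂ) / 2 * (g / 2 + 1))) • m
        + (casimir1 N).lTensor _ m + (Complex.I * (A : ℤ)) • coupling A N g m ∧
    casimir2 _ m = (2 * ((g : ℂ) / 2 * (g / 2 + 1))) • m
        + (casimir2 N).lTensor _ m + (2 : ℂ) • coupling A N g m := by
  have hk := I_mul_unit_sq A
  induction m with
  | zero => simp
  | add a b ha hb =>
    simp only [map_add, smul_add, ha, hb]
    constructor <;> abel
  | tmul f n =>
    have hJ := congrArg (fun v => v ⊗ₜ[ℂ] n) (FinMod.casimir_J f)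
    simp only [casimir1_eq_ladder, casimir2_eq_ladder, coupling, chiral0, chiral,
      LinearMap.add_apply, LinearMap.sub_apply, LinearMap.smul_apply, Module.End.mul_apply,
      LieModule.toEnd_apply_apply, TensorProduct.LieModule.lie_tmul_right, lie_add, lie_smul,
      FinMod.lie_K_eq, FinMod.lie_Kladder_eq, TensorProduct.map_tmul, LinearMap.lTensor_tmul,
      TensorProduct.tmul_add, TensorProduct.add_tmul, TensorProduct.tmul_sub,
      TensorProduct.tmul_smul, ← TensorProduct.smul_tmul', smul_add, smul_sub, smul_smul] at hJ ⊢
    generalize Complex.I * ((A : ℤ) : ℂ) = κ at *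
    constructor
    · linear_combination (norm := module) κ • hJ + hk • (⁅J 0, f⁆ ⊗ₜ[ℂ] ⁅K 0, n⁆
        + (1 / 2 : ℂ) • (⁅Jladder 1, f⁆ ⊗ₜ[ℂ] ⁅Kladder (-1), n⁆
          + ⁅Jladder (-1), f⁆ ⊗ₜ[ℂ] ⁅Kladder 1, n⁆))
    · linear_combination (norm := module) (1 - κ * κ) • hJ
        - hk • (((g : ℂ) / 2 * (g / 2 + 1)) • f ⊗ₜ[ℂ] n)

/-- On `F_{1/2} ⊗ N` the coupling satisfies a quadratic relation. -/
theorem coupling_sq (m : FinMod A 1 ⊗[ℂ] N) :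
    coupling A N 1 (coupling A N 1 m) + coupling A N 1 m
      = (chiralCasimir A N).lTensor _ m := by
  -- Here the coupling is `σ·S` with Pauli matrices `σ` and `S = (J - iAK)/2`, and the relation is
  -- the familiar `(σ·S)² = S·S - σ·S`.
  suffices coupling A N 1 ∘ₗ coupling A N 1 + coupling A N 1
      = (chiralCasimir A N).lTensor (FinMod A 1) from LinearMap.congr_fun this m
  have hs : ∀ ε : ℤˣ, ⁅J 0, FinMod.spinor A ε⁆ = (((ε : ℤ) : ℂ) / 2) • FinMod.spinor A ε :=
    fun ε => by rw [FinMod.lie_J, FinMod.spinor, FinMod.J0_ket]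
  have h1 := FinMod.lie_Jladder_spinor_neg A 1
  have h2 := FinMod.lie_Jladder_spinor_neg A (-1)
  rw [neg_neg] at h2
  refine FinMod.spinor_tensor_ext fun ε n => ?_
  obtain ⟨r1, r2, r3⟩ := chiral_relations A N
  have r1 := congrArg (fun v => FinMod.spinor A (-ε) ⊗ₜ[ℂ] v) (LinearMap.congr_fun r1 n)
  have r2 := congrArg (fun v => FinMod.spinor A (-ε) ⊗ₜ[ℂ] v) (LinearMap.congr_fun r2 n)
  have r3 := congrArg (fun v => FinMod.spinor A ε ⊗ₜ[ℂ] v) (LinearMap.congr_fun r3 n)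
  rcases Int.units_eq_one_or ε with rfl | rfl <;>
  simp only [coupling, chiralCasimir_eq, LinearMap.comp_apply, LinearMap.add_apply,
    LinearMap.smul_apply, TensorProduct.map_tmul, LieModule.toEnd_apply_apply, hs, h1, h2,
    FinMod.lie_Jladder_spinor, map_zero, map_add, map_smul, LinearMap.lTensor_tmul,
    TensorProduct.zero_tmul, TensorProduct.tmul_add, TensorProduct.tmul_sub,
    TensorProduct.tmul_neg, TensorProduct.tmul_smul, neg_neg, LinearMap.neg_apply,
    ← TensorProduct.smul_tmul', LinearMap.sub_apply, Module.End.mul_apply] at r1 r2 r3 ⊢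
  · push_cast
    linear_combination (norm := module) (-1 / 4 : ℂ) • r1
  · push_cast
    linear_combination (norm := module) (1 / 4 : ℂ) • r2 + (1 / 4 : ℂ) • r3

end SelfDual

end SpinCG

/-! ### Eigenvalues of the chiral Casimir on `F ⊗ V` -/

namespace SpinCG

open Spin31

/-- Coordinates along a basis of `F` commute with `S`, and some coordinate of `w` is nonzero. -/
theorem exists_eigenvector_of_lTensor {F N : Type} [AddCommGroup N] [Module ℂ N] [AddCommGroup F] [Module ℂ F] {κ : Type}
    (b : Module.Basis κ ℂ F) {S : Module.End ℂ N} {s : ℂ} {w : F ⊗[ℂ] N} (hw : w ≠ 0)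
    (h : S.lTensor F w = s • w) : ∃ v : N, v ≠ 0 ∧ S v = s • v := by
  classical
  let φ (k : κ) : F ⊗[ℂ] N →ₗ[ℂ] N := (TensorProduct.lid ℂ N).toLinearMap ∘ₗ (b.coord k).rTensor N
  have hφ : ∀ k u, φ k (S.lTensor F u) = S (φ k u) := fun k u => by
    induction u with
    | zero => simp
    | add x y hx hy => simp only [map_add, hx, hy]
    | tmul f n => simp [φ]
  have hex : ∃ k, φ k w ≠ 0 := by
    by_contra! h0
    refine hw ((TensorProduct.equivFinsuppOfBasisLeft b).injective ?_)
    rw [map_zero]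
    ext k
    rw [TensorProduct.equivFinsuppOfBasisLeft_apply]
    exact h0 k
  obtain ⟨k, hk⟩ := hex
  exact ⟨φ k w, hk, by rw [← hφ, h, map_smul]⟩

section Spectrum

variable {A : ℤˣ} {N M : Type} [AddCommGroup N] [Module ℂ N] [LieRingModule Spin31 N]
  [LieModule ℂ Spin31 N] [AddCommGroup M] [Module ℂ M] [LieRingModule Spin31 M]
  [LieModule ℂ Spin31 M]

/-- This is `(s + S)² = s² + S² + 2 s·S`, the coupling being `2 s·S`. -/
theorem chiralCasimir_tensor {g : ℤ} (m : FinMod A g ⊗[ℂ] N) :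
    chiralCasimir A _ m = ((g : ℂ) / 2 * (g / 2 + 1)) • m + (chiralCasimir A N).lTensor _ m
      + coupling A N g m := by
  obtain ⟨h1, h2⟩ := casimir_tensor N m
  have hk := I_mul_unit_sq A
  simp only [chiralCasimir, LinearMap.lTensor_smul, LinearMap.lTensor_sub, LinearMap.smul_apply,
    LinearMap.sub_apply, h1, h2]
  generalize Complex.I * ((A : ℤ) : ℂ) = κ at *
  linear_combination (norm := module) (-1 / 2 : ℂ) • (hk • (((g : ℂ) / 2 * (g / 2 + 1)) • m
    + coupling A N g m))

theorem chiralCasimir_map (f : M →ₗ[ℂ] N) (hf : ∀ (x : Spin31) m, f ⁅x, m⁆ = ⁅x, f m⁆) (m : M) :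
    f (chiralCasimir A M m) = chiralCasimir A N (f m) := by
  obtain ⟨h1, h2⟩ := casimir_map f hf m
  simp only [chiralCasimir, LinearMap.smul_apply, LinearMap.sub_apply, map_smul, map_sub, h1, h2]

/-- The eigenvalues of the chiral Casimir operator of `M` have the form `(y² - 1) / 4` with
`y` satisfying `P`. -/
def ChiralSpectrum (A : ℤˣ) (M : Type) [AddCommGroup M] [Module ℂ M] [LieRingModule Spin31 M]
    [LieModule ℂ Spin31 M] (P : ℂ → Prop) : Prop :=
  ∀ (s : ℂ) (v : M), v ≠ 0 → chiralCasimir A M v = s • v → ∃ y, P y ∧ s = (y ^ 2 - 1) / 4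

theorem ChiralSpectrum.of_injective {P : ℂ → Prop} (h : ChiralSpectrum A N P) (f : M →ₗ[ℂ] N)
    (hf : ∀ (x : Spin31) m, f ⁅x, m⁆ = ⁅x, f m⁆) (hinj : Function.Injective f) :
    ChiralSpectrum A M P := by
  intro s v hv hs
  refine h s (f v) ((map_ne_zero_iff f hinj).2 hv) ?_
  rw [← chiralCasimir_map f hf, hs, map_smul]

theorem ChiralSpectrum.of_repIso {P : ℂ → Prop} (h : ChiralSpectrum A N P)
    (e : RepIso (lieRep M) (lieRep N)) : ChiralSpectrum A M P := by
  obtain ⟨e, he⟩ := e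
  exact h.of_injective e.toLinearMap he e.injective

/-- Addition of spin 1/2 changes `y` by `±1`. The proof bounds the spectrum without decomposing the
tensor product, so it remains valid where the splitting fails. -/
theorem ChiralSpectrum.spinor_tensor {P : ℂ → Prop} (h : ChiralSpectrum A N P) :
    ChiralSpectrum A (FinMod A 1 ⊗[ℂ] N) fun y => P (y - 1) ∨ P (y + 1) := by
  intro s v hv hs
  -- On `v` the quadratic relation reads `(T + 1)² = s + 1/4` for the coupling `T`. Either `v` or
  -- `(T + 1 + r) v` is an eigenvector of `T`, where `r² = s + 1/4`.
  have key : ∃ (τ : ℂ) (u : FinMod A 1 ⊗[ℂ] N), u ≠ 0 ∧ coupling A N 1 u = τ • u ∧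
      (τ + 1) ^ 2 = s + 1 / 4 := by
    have hr := sqrt_sq' (s + 1 / 4)
    generalize (s + 1 / 4).sqrt = r at hr
    have h1 := chiralCasimir_tensor v
    rw [hs, ← coupling_sq] at h1
    by_cases hw : coupling A N 1 v + (1 + r) • v = 0
    · refine ⟨-1 - r, v, hv, ?_, by linear_combination hr⟩
      linear_combination (norm := module) hw
    · refine ⟨r - 1, _, hw, ?_, by linear_combination hr⟩
      rw [map_add, map_smul]
      push_cast at h1
      linear_combination (norm := module) -h1 - hr • v
  obtain ⟨τ, u, hu, hτ, hs'⟩ := key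
  have h2 := coupling_sq N u
  rw [hτ, map_smul, hτ] at h2
  obtain ⟨n, hn, hq⟩ := exists_eigenvector_of_lTensor (FinMod.basis A 1) (s := τ ^ 2 + τ) hu
    (by rw [← h2]; module)
  obtain ⟨y, hy, hyτ⟩ := h _ n hn hq
  -- From `τ² + τ = (y² - 1)/4`. Since `s = ((2τ + 2)² - 1)/4`, the sign of `2τ + 2` may be chosen
  -- to exhibit the shift of `y`.
  have h3 : (2 * τ + 1 - y) * (2 * τ + 1 + y) = 0 := by linear_combination 4 * hyτ
  rcases mul_eq_zero.1 h3 with h4 | h4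
  · refine ⟨2 * τ + 2, Or.inl ?_, by linear_combination -hs'⟩
    rwa [show 2 * τ + 2 - 1 = y by linear_combination h4]
  · refine ⟨-(2 * τ + 2), Or.inr ?_, by linear_combination -hs'⟩
    rwa [show -(2 * τ + 2) + 1 = y by linear_combination -h4]

theorem chiralCasimir_irrMod {l : ℤ} {ρ : ℂ} (h : NonTerminating l ρ) (v : IrrMod l ρ) :
    chiralCasimir A (IrrMod l ρ) v = (((l / 2 + (A : ℤ) * ρ : ℂ) ^ 2 - 1) / 4) • v := by
  rw [chiralCasimir, LinearMap.smul_apply, LinearMap.sub_apply, LinearMap.smul_apply,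
    IrrMod.casimir1_irrMod h, IrrMod.casimir2_irrMod h]
  have hA := unit_mul_self A
  match_scalars
  linear_combination (-(A : ℤ) * l * ρ / 4 : ℂ) * Complex.I_sq - ρ ^ 2 / 4 * hA

theorem chiralSpectrum_irrMod {l : ℤ} {ρ : ℂ} (h : NonTerminating l ρ) :
    ChiralSpectrum A (IrrMod l ρ) fun y => y = l / 2 + (A : ℤ) * ρ := by
  intro s v hv hs
  exact ⟨_, rfl, smul_left_injective ℂ hv (hs.symm.trans (chiralCasimir_irrMod h v))⟩

/-- For larger spin, `F_{(n+2)/2} ⊗ V` embeds in `F_{1/2} ⊗ F_{(n+1)/2} ⊗ V`, so its chiral spectrum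
is contained in that of the spin 1/2 step. Only this inclusion is needed, and nothing is assumed of
the shifted modules. -/
theorem chiralSpectrum_tensor (A : ℤˣ) {l : ℤ} {ρ : ℂ} (h : NonTerminating l ρ) (n : ℕ) :
    ChiralSpectrum A (FinMod A n ⊗[ℂ] IrrMod l ρ)
      fun y => ∃ ν ∈ weights n, y = l / 2 + (A : ℤ) * ρ + ν := by
  have mono : ∀ (M : Type) [AddCommGroup M] [Module ℂ M] [LieRingModule Spin31 M]
      [LieModule ℂ Spin31 M] {P Q : ℂ → Prop}, (∀ y, P y → Q y) → ChiralSpectrum A M P →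
      ChiralSpectrum A M Q := fun M _ _ _ _ P Q hPQ hP s v hv hs => by
    obtain ⟨y, hy, e⟩ := hP s v hv hs
    exact ⟨y, hPQ y hy, e⟩
  have step : ∀ n : ℕ, ∀ y : ℂ, ((∃ ν ∈ weights n, y - 1 = l / 2 + (A : ℤ) * ρ + ν) ∨
      ∃ ν ∈ weights n, y + 1 = l / 2 + (A : ℤ) * ρ + ν) →
      ∃ ν ∈ weights (n + 1 : ℕ), y = l / 2 + (A : ℤ) * ρ + ν := by
    rintro n y (⟨ν, hν, e⟩ | ⟨ν, hν, e⟩) <;> simp only [weights, Set.mem_ofPred_eq] at hν ⊢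
    · exact ⟨ν + 1, by push_cast; omega, by push_cast; linear_combination e⟩
    · exact ⟨ν - 1, by push_cast; omega, by push_cast; linear_combination e⟩
  induction n with
  | zero =>
    refine mono _ ?_ ((chiralSpectrum_irrMod h).of_repIso (repIso_finMod_zero_tensor A _))
    rintro y rfl
    exact ⟨0, by simp [weights], by simp⟩
  | succ n ih =>
    refine mono _ (step n) ?_
    rcases n with - | n
    · refine ih.spinor_tensor.of_repIso ?_
      rw [lieRep_tensor, lieRep_tensor _ (FinMod A (0 : ℕ) ⊗[ℂ] IrrMod l ρ)]
      exact (RepIso.refl _).tensor (repIso_finMod_zero_tensor A _).symm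
    · have hF : RepIso (tensorRep (lieRep (FinMod A 1)) (lieRep (FinMod A (n + 1 : ℕ))))
          (prodRep (lieRep (FinMod A (n + 1 + 1 : ℕ))) (lieRep (FinMod A n))) := by
        rw [← lieRep_tensor]
        exact FinMod.repIso_spinor_tensor_finMod A n (by omega)
      have k : RepIso (prodRep (lieRep (FinMod A (n + 1 + 1 : ℕ) ⊗[ℂ] IrrMod l ρ))
          (lieRep (FinMod A n ⊗[ℂ] IrrMod l ρ)))
          (lieRep (FinMod A 1 ⊗[ℂ] (FinMod A (n + 1 : ℕ) ⊗[ℂ] IrrMod l ρ))) := by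
        simp only [lieRep_tensor]
        exact RepIso.prod_tensor.symm.trans ((hF.symm.tensor (RepIso.refl _)).trans
          RepIso.tensor_assoc)
      obtain ⟨e, he⟩ := k
      refine ih.spinor_tensor.of_injective (e.toLinearMap ∘ₗ LinearMap.inl ℂ _ _)
        (fun x m => ?_) (e.injective.comp LinearMap.inl_injective)
      have := he x (m, 0)
      simpa using this

end Spectrum

end SpinCG

/-! ### Weight components and depth -/

namespace SpinCG

open Spin31

namespace FinMod

variable (A : ℤˣ) (g : ℤ)

/-- The coordinate along `|b/2⟩`, zero if `b` is not a weight. -/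
noncomputable def coordinate (b : ℤ) : FinMod A g →ₗ[ℂ] ℂ :=
  (basis A g).constr ℂ fun c => if (c : ℤ) = b then 1 else 0

variable {A g}

theorem coordinate_ket_of_mem {c : ℤ} (hc : c ∈ weights g) (b : ℤ) :
    coordinate A g b (ket A g c) = if c = b then 1 else 0 := by
  rw [ket, dif_pos hc, coordinate, Module.Basis.constr_basis]

theorem coordinate_of_not_mem {b : ℤ} (hb : b ∉ weights g) : coordinate A g b = 0 :=
  (basis A g).ext fun c => by
    rw [basis_eq_ket, coordinate_ket_of_mem c.2, if_neg, LinearMap.zero_apply]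
    rintro rfl
    exact hb c.2

theorem coordinate_ket {b : ℤ} (hb : b ∈ weights g) (c : ℤ) :
    coordinate A g b (ket A g c) = if c = b then 1 else 0 := by
  by_cases hc : c ∈ weights g
  · exact coordinate_ket_of_mem hc b
  · rw [ket_of_not_mem A g hc, map_zero, if_neg]
    rintro rfl
    exact hc hb

theorem coordinate_lie_J (b : ℤ) (f : FinMod A g) :
    coordinate A g b ⁅J 0, f⁆ = ((b : ℂ) / 2) * coordinate A g b f := by
  have : coordinate A g b ∘ₗ J0 A g = ((b : ℂ) / 2) • coordinate A g b :=
    (basis A g).ext fun c => by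
      simp only [basis_eq_ket, LinearMap.comp_apply, J0_ket, map_smul, LinearMap.smul_apply,
        coordinate_ket_of_mem c.2, smul_eq_mul]
      split_ifs with h
      · rw [h]
      · simp
  rw [lie_J]
  exact LinearMap.congr_fun this f

theorem coordinate_lie_Jladder {b : ℤ} (hb : b ∈ weights g) (ε : ℤˣ) (f : FinMod A g) :
    coordinate A g b ⁅Jladder ε, f⁆ = coeffC ε (g / 2) ((b - 2 * ε : ℤ) / 2)
      * coordinate A g (b - 2 * ε) f := by
  have : coordinate A g b ∘ₗ Jpm A g ε
      = coeffC ε (g / 2) ((b - 2 * ε : ℤ) / 2) • coordinate A g (b - 2 * ε) :=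
    (basis A g).ext fun c => by
      simp only [basis_eq_ket, LinearMap.comp_apply, Jpm_ket, map_smul, LinearMap.smul_apply,
        coordinate_ket hb, coordinate_ket_of_mem c.2, smul_eq_mul, eq_sub_iff_add_eq]
      split_ifs with h
      · rw [← h, add_sub_cancel_right]
      · simp
  rw [lie_Jladder]
  exact LinearMap.congr_fun this f

end FinMod

section Component

variable (A : ℤˣ) (g : ℤ) (N : Type) [AddCommGroup N] [Module ℂ N]

/-- The component along `|b/2⟩` of a tensor. -/
noncomputable def component (b : ℤ) : FinMod A g ⊗[ℂ] N →ₗ[ℂ] N :=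
  (TensorProduct.lid ℂ N).toLinearMap ∘ₗ (FinMod.coordinate A g b).rTensor N

variable {A g N}

theorem component_tmul (b : ℤ) (f : FinMod A g) (n : N) :
    component A g N b (f ⊗ₜ n) = FinMod.coordinate A g b f • n := by
  simp [component]

theorem component_of_not_mem {b : ℤ} (hb : b ∉ weights g) (w : FinMod A g ⊗[ℂ] N) :
    component A g N b w = 0 := by
  simp [component, FinMod.coordinate_of_not_mem hb]

variable [LieRingModule Spin31 N] [LieModule ℂ Spin31 N]

/-- With respect to the weights of `F` the coupling is tridiagonal; the entry towards lower weight
is `J₋ ⊗ (J₊ - iA K₊)`. -/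
theorem component_coupling {b : ℤ} (hb : b ∈ weights g) (w : FinMod A g ⊗[ℂ] N) :
    component A g N b (coupling A N g w) = ((b : ℂ) / 2) • chiral0 A N (component A g N b w)
      + (1 / 2 : ℂ) • (coeffC 1 (g / 2) ((b - 2 : ℤ) / 2) •
          chiral A N (-1) (component A g N (b - 2) w)
        + coeffC (-1) (g / 2) ((b + 2 : ℤ) / 2) • chiral A N 1 (component A g N (b + 2) w)) := by
  induction w with
  | zero => simp
  | add x y hx hy => simp only [map_add, hx, hy]; module
  | tmul f n =>
    have h1 := FinMod.coordinate_lie_Jladder hb 1 f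
    have h2 := FinMod.coordinate_lie_Jladder hb (-1) f
    rw [Units.val_one, mul_one] at h1
    rw [Units.val_neg, Units.val_one, mul_neg, mul_one, sub_neg_eq_add] at h2
    simp only [coupling, LinearMap.add_apply, LinearMap.smul_apply, TensorProduct.map_tmul,
      LieModule.toEnd_apply_apply, map_add, map_smul, component_tmul, h1, h2,
      FinMod.coordinate_lie_J, smul_smul]

end Component

section Cyclic

variable {A : ℤˣ} {l : ℤ} {ρ : ℂ}

/-- The highest weight vector of the `n`-th `K`-type. -/
noncomputable def IrrMod.top (A : ℤˣ) (l : ℤ) (ρ : ℂ) (n : ℕ) : IrrMod l ρ :=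
  IrrMod.ofFormal A l ρ (Formal.e (|l| + 2 * n) (|l| + 2 * n))

theorem IrrMod.top_ne_zero (h : NonTerminating l ρ) (n : ℕ) : IrrMod.top A l ρ n ≠ 0 := by
  intro h0
  have := congrArg (IrrMod.toFormal A l ρ) h0
  rw [IrrMod.top, IrrMod.toFormal_ofFormal A h (Formal.e_mem (IrrMod.label_diag l n)),
    map_zero] at this
  simp [Formal.e] at this

/-- `J₊` kills the highest weight vector, and `K₊` takes it into the next `K`-type. The coefficient
never vanishes under nontermination, so the chiral raising operator can be iterated indefinitely. -/
theorem IrrMod.chiral_top (h : NonTerminating l ρ) (n : ℕ) :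
    chiral A (IrrMod l ρ) 1 (IrrMod.top A l ρ n)
      = -Formal.up ((A : ℤ) * ρ) (|l| + 2 * n) • IrrMod.top A l ρ (n + 1) := by
  have hk := I_mul_unit_sq A
  rw [chiral, LinearMap.sub_apply, LinearMap.smul_apply, LieModule.toEnd_apply_apply,
    LieModule.toEnd_apply_apply, SpinCG.lie_Kladder_eq, IrrMod.top,
    IrrMod.lie_Jladder_one_diag A h, IrrMod.lie_Jladder_lie_K_diag A h, ← IrrMod.top, lie_zero]
  push_cast
  match_scalars
  linear_combination Formal.up ((A : ℤ) * ρ) (|l| + 2 * n) * hk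

/-- `w` has a nonzero component of depth `n`, and none of larger depth. -/
def HasDepth (A : ℤˣ) (g : ℤ) (l : ℤ) (ρ : ℂ) (n : ℕ) (w : FinMod A g ⊗[ℂ] IrrMod l ρ) : Prop :=
  (∀ k : ℕ, n < k → component A g _ (g - 2 * k) w = 0) ∧
    ∃ c : ℂ, c ≠ 0 ∧ component A g _ (g - 2 * n) w = c • IrrMod.top A l ρ n

theorem HasDepth.ne_zero (h : NonTerminating l ρ) {g : ℤ} {n : ℕ}
    {w : FinMod A g ⊗[ℂ] IrrMod l ρ} (hw : HasDepth A g l ρ n w) : w ≠ 0 := by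
  rintro rfl
  obtain ⟨-, c, hc, h0⟩ := hw
  rw [map_zero, eq_comm, smul_eq_zero] at h0
  exact h0.elim hc (IrrMod.top_ne_zero h n)

theorem hasDepth_zero {g : ℤ} (hg : 0 ≤ g) :
    HasDepth A g l ρ 0 (FinMod.ket A g g ⊗ₜ IrrMod.top A l ρ 0) := by
  have hgw : g ∈ weights g := by simp only [weights, Set.mem_ofPred_eq]; omega
  refine ⟨fun k hk => ?_, 1, one_ne_zero, ?_⟩
  · rw [component_tmul, FinMod.coordinate_ket_of_mem hgw, if_neg (by omega), zero_smul]
  · rw [component_tmul, FinMod.coordinate_ket_of_mem hgw, if_pos (by simp)]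

/-- Only the downward entry of the coupling reaches depth `n + 1`, and it carries the leading term
to a nonzero multiple of the next top vector. The subtraction of `τ • w` has no effect at that
depth. -/
theorem HasDepth.coupling_sub (h : NonTerminating l ρ) {g : ℤ} {n : ℕ} (hn : n < g)
    {w : FinMod A g ⊗[ℂ] IrrMod l ρ} (hw : HasDepth A g l ρ n w) (τ : ℂ) :
    HasDepth A g l ρ (n + 1) (coupling A _ g w - τ • w) := by
  obtain ⟨h0, c, hc, h1⟩ := hw
  have zero (k : ℕ) (hk : n < k) (b : ℤ) (hb : b = g - 2 * k) : component A g _ b w = 0 := by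
    rw [hb]; exact h0 k hk
  constructor
  · intro k hk
    by_cases hb : g - 2 * (k : ℤ) ∈ weights g
    · rw [map_sub, map_smul, component_coupling hb, zero k (by omega) _ rfl,
        zero (k + 1) (by omega) _ (by push_cast; ring), zero (k - 1) (by omega) _ (by omega)]
      simp
    · exact component_of_not_mem hb _
  · have hb : g - 2 * ((n + 1 : ℕ) : ℤ) ∈ weights g := by
      simp only [weights, Set.mem_ofPred_eq]; omega
    have hb' : g - 2 * ((n + 1 : ℕ) : ℤ) + 2 = g - 2 * n := by push_cast; ring
    -- The matrix element of `J₋` out of weight `g - 2n`, nonzero because `n < g`, times the old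
    -- leading coefficient and the coefficient of `IrrMod.chiral_top`.
    refine ⟨(1 / 2) * coeffC (-1) (g / 2) ((g - 2 * n : ℤ) / 2) * c
      * -Formal.up ((A : ℤ) * ρ) (|l| + 2 * n), ?_, ?_⟩
    · have hL := IrrMod.label_diag l n
      have hu := IrrMod.up_ne_zero A h hL.1 hL.2.1
      refine mul_ne_zero (mul_ne_zero (mul_ne_zero (by norm_num) ?_) hc) (neg_ne_zero.2 hu)
      refine mul_ne_zero (sqrt_ne_zero' ?_) (sqrt_ne_zero' ?_)
      · have : (g : ℂ) - n ≠ 0 := by exact_mod_cast (by omega : g - n ≠ 0)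
        intro h2
        apply this
        rw [← h2]; push_cast; ring
      · have : (n : ℂ) + 1 ≠ 0 := by exact_mod_cast (by omega : n + 1 ≠ 0)
        intro h2
        apply this
        rw [← h2]; push_cast; ring
    · rw [map_sub, map_smul, component_coupling hb, zero (n + 1) (by omega) _ rfl,
        zero (n + 2) (by omega) _ (by push_cast; ring), hb', h1, map_smul,
        IrrMod.chiral_top h]
      simp only [map_zero, smul_zero, smul_smul]
      module

end Cyclic

end SpinCG

/-! ### Failure of diagonalisability in the degenerate case -/

namespace SpinCG

open Spin31

section Degenerate

variable {A : ℤˣ} {l : ℤ} {ρ : ℂ}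

theorem lTensor_chiralCasimir (h : NonTerminating l ρ) {g : ℤ} (w : FinMod A g ⊗[ℂ] IrrMod l ρ) :
    (chiralCasimir A (IrrMod l ρ)).lTensor _ w
      = (((l / 2 + (A : ℤ) * ρ : ℂ) ^ 2 - 1) / 4) • w := by
  rw [show chiralCasimir A (IrrMod l ρ) = (((l / 2 + (A : ℤ) * ρ : ℂ) ^ 2 - 1) / 4) • LinearMap.id
    from LinearMap.ext (chiralCasimir_irrMod h), LinearMap.lTensor_smul, LinearMap.lTensor_id,
    LinearMap.smul_apply, LinearMap.id_apply]

/-- With the Casimirs of `F` and `V` scalar, the coupling differs from the chiral Casimir by a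
constant. The value is `((x + ν)² - x²)/4 - γ(γ + 1)` with `x = λ + Aρ` and `ν` the doubled weight.
-/
theorem coupling_eigenvalue (h : NonTerminating l ρ) (n : ℕ) {τ : ℂ}
    {v : FinMod A n ⊗[ℂ] IrrMod l ρ} (hv : v ≠ 0) (hτ : coupling A _ n v = τ • v) :
    ∃ ν ∈ weights n, τ = (ν * (2 * (l / 2 + (A : ℤ) * ρ) + ν) : ℂ) / 4 - n / 2 * (n / 2 + 1) := by
  have h1 := chiralCasimir_tensor v
  rw [lTensor_chiralCasimir h, hτ, ← add_smul, ← add_smul] at h1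
  obtain ⟨_, ⟨ν, hν, rfl⟩, e⟩ := chiralSpectrum_tensor A h n _ v hv h1
  refine ⟨ν, hν, ?_⟩
  push_cast at e
  linear_combination e

/-- In the degenerate case the eigenvalues of the coupling take fewer than `n + 1` values. -/
theorem exists_finset_eigenvalues (h : NonTerminating l ρ) (n : ℕ) {m : ℤ} (hm : -n < m)
    (hm' : m < n) (hx : (l / 2 + (A : ℤ) * ρ : ℂ) = m) : ∃ S : Finset ℂ, S.card ≤ n ∧
    ∀ (τ : ℂ) (v : FinMod A n ⊗[ℂ] IrrMod l ρ), v ≠ 0 → coupling A _ n v = τ • v → τ ∈ S := by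
  let F (ν : ℤ) : ℂ := (ν * (2 * m + ν) : ℂ) / 4 - n / 2 * (n / 2 + 1)
  -- `F` depends on `ν` through `(m + ν)²` only.
  have hF : ∀ ν, F (-2 * m - ν) = F ν := fun ν => by simp only [F]; push_cast; ring
  -- One extreme weight is redundant: for `m ≥ 0` the weight `-n` reflects to `n - 2m`, and for `m <
  -- 0` the weight `n` reflects to `-n - 2m`. The offset `d` omits it, leaving `n` values.
  let d : ℤ := if 0 ≤ m then 2 else 0
  refine ⟨(Finset.range n).image fun i : ℕ => F (-n + 2 * i + d),
    Finset.card_image_le.trans (Finset.card_range n).le, fun τ v hv hτ => ?_⟩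
  obtain ⟨ν, hν, e⟩ := coupling_eigenvalue h n hv hτ
  rw [hx] at e
  replace e : τ = F ν := e
  simp only [weights, Set.mem_ofPred_eq] at hν
  have key : ∀ μ : ℤ, F μ = F ν → -n + d ≤ μ → μ < n + d → (2 : ℤ) ∣ n - μ →
      τ ∈ (Finset.range n).image fun i : ℕ => F (-n + 2 * i + d) := by
    intro μ hμ h1 h2 h3
    have hd : (2 : ℤ) ∣ d := by simp only [d]; split_ifs <;> norm_num
    refine Finset.mem_image.2 ⟨((μ + n - d) / 2).toNat, Finset.mem_range.2 (by omega), ?_⟩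
    rw [e, ← hμ]
    congr 1
    omega
  by_cases h0 : -n + d ≤ ν ∧ ν < n + d
  · exact key ν rfl h0.1 h0.2 hν.2.2
  · refine key (-2 * m - ν) (hF ν) ?_ ?_ (by omega) <;>
    · simp only [d] at *
      split_ifs at * <;> omega

/-- Each linear factor increases the depth by one, so a product of at most `n` factors does not
annihilate the vector of depth zero. -/
theorem exists_hasDepth_aeval (h : NonTerminating l ρ) (n : ℕ) (S : Finset ℂ) (hS : S.card ≤ n) :
    HasDepth A n l ρ S.card (Polynomial.aeval (coupling A (IrrMod l ρ) n)
      (∏ τ ∈ S, (Polynomial.X - Polynomial.C τ)) (FinMod.ket A n n ⊗ₜ IrrMod.top A l ρ 0)) := by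
  classical
  induction S using Finset.induction_on with
  | empty => simpa using hasDepth_zero (A := A) (l := l) (ρ := ρ) (g := n) (by omega)
  | insert τ S hτ ih =>
    rw [Finset.card_insert_of_notMem hτ] at hS ⊢
    rw [Finset.prod_insert hτ, map_mul, Module.End.mul_apply, map_sub, Polynomial.aeval_X,
      Polynomial.aeval_C, LinearMap.sub_apply, Module.algebraMap_end_apply]
    exact (ih (by omega)).coupling_sub h (by omega) τ

/-- On an eigenbasis the product of `X - τ` over the possible eigenvalues would act as zero. It has
at most `n` factors, so this contradicts the depth of its value on the product of highest weight
vectors. -/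
theorem not_diagonalisable_coupling (h : NonTerminating l ρ) (n : ℕ) {m : ℤ} (hm : -n < m)
    (hm' : m < n) (hx : (l / 2 + (A : ℤ) * ρ : ℂ) = m) :
    ¬ Diagonalisable (coupling A (IrrMod l ρ) n) := by
  rintro ⟨ι, b, hb⟩
  obtain ⟨S, hS, hS'⟩ := exists_finset_eigenvalues (A := A) h n hm hm' hx
  refine (exists_hasDepth_aeval (A := A) h n S hS).ne_zero h ?_
  have : Polynomial.aeval (coupling A (IrrMod l ρ) n)
      (∏ τ ∈ S, (Polynomial.X - Polynomial.C τ)) = 0 := by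
    refine b.ext fun i => ?_
    obtain ⟨τ, hτ⟩ := hb i
    rw [Module.End.aeval_apply_of_hasEigenvector (μ := τ)
      ⟨Module.End.mem_eigenspace_iff.2 hτ, b.ne_zero i⟩, Polynomial.eval_prod,
      Finset.prod_eq_zero (hS' τ _ (b.ne_zero i) hτ) (by simp), zero_smul, LinearMap.zero_apply]
  rw [this, LinearMap.zero_apply]

theorem Diagonalisable.of_affine {M : Type} [AddCommGroup M] [Module ℂ M] {S T : Module.End ℂ M}
    (hS : Diagonalisable S) {c d : ℂ} (hd : d ≠ 0) (h : ∀ m, S m = c • m + d • T m) :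
    Diagonalisable T := by
  obtain ⟨ι, b, hb⟩ := hS
  refine ⟨ι, b, fun i => ?_⟩
  obtain ⟨s, hs⟩ := hb i
  refine ⟨d⁻¹ * (s - c), ?_⟩
  rw [h] at hs
  rw [mul_smul, sub_smul, ← hs, add_sub_cancel_left, smul_smul, inv_mul_cancel₀ hd, one_smul]

theorem not_diagonalisable_casimir (h : NonTerminating l ρ) {g m : ℤ} (hm : -g < m) (hm' : m < g)
    (hx : ρ + ((A : ℤ) : ℂ) * ((l : ℂ) / 2) = m) :
    ¬ Diagonalisable (casimir1 (FinMod A g ⊗[ℂ] IrrMod l ρ)) ∧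
      ¬ Diagonalisable (casimir2 (FinMod A g ⊗[ℂ] IrrMod l ρ)) := by
  lift g to ℕ using by omega
  have hA := unit_mul_self A
  have hT : ¬ Diagonalisable (coupling A (IrrMod l ρ) g) := by
    -- The coupling is governed by `λ + Aρ`, which is `A(ρ + Aλ)`; the interval is symmetric, so the
    -- sign does not matter.
    refine not_diagonalisable_coupling (m := A * m) h g ?_ ?_ ?_
    · rcases Int.units_eq_one_or A with rfl | rfl <;> simp <;> omega
    · rcases Int.units_eq_one_or A with rfl | rfl <;> simp <;> omega
    · push_cast
      linear_combination (A : ℤ) * hx - (l : ℂ) / 2 * hA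
  have e1 : casimir1 (IrrMod l ρ) = (Complex.I * (l / 2) * ρ) • LinearMap.id :=
    LinearMap.ext (IrrMod.casimir1_irrMod h)
  have e2 : casimir2 (IrrMod l ρ) = ((l / 2 : ℂ) ^ 2 + ρ ^ 2 - 1) • LinearMap.id :=
    LinearMap.ext (IrrMod.casimir2_irrMod h)
  constructor <;> intro hd <;> apply hT
  · refine hd.of_affine
      (c := Complex.I * (A : ℤ) * (((g : ℤ) : ℂ) / 2 * ((g : ℤ) / 2 + 1)) + Complex.I * (l / 2) * ρ)
      (mul_ne_zero Complex.I_ne_zero (Int.cast_ne_zero.2 A.ne_zero)) fun w => ?_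
    rw [(casimir_tensor _ w).1, e1, LinearMap.lTensor_smul, LinearMap.lTensor_id,
      LinearMap.smul_apply, LinearMap.id_apply, ← add_smul]
  · refine hd.of_affine
      (c := 2 * (((g : ℤ) : ℂ) / 2 * ((g : ℤ) / 2 + 1)) + ((l / 2 : ℂ) ^ 2 + ρ ^ 2 - 1)) two_ne_zero fun w => ?_
    rw [(casimir_tensor _ w).2, e2, LinearMap.lTensor_smul, LinearMap.lTensor_id,
      LinearMap.smul_apply, LinearMap.id_apply, ← add_smul]

end Degenerate

end SpinCG

theorem mainTheorem4 (A : ℤˣ) (g : ℤ) (hg : 1 ≤ g) (l : ℤ) (ρ : ℂ)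
    (hinf : ¬ FiniteDimensional ℂ (IrrMod l ρ)) :
    (SimultaneouslyDiagonalisable
        (casimir1 (FinMod A g ⊗[ℂ] IrrMod l ρ)) (casimir2 (FinMod A g ⊗[ℂ] IrrMod l ρ)) ↔
      ¬ ∃ n : ℤ, -g < n ∧ n < g ∧ ρ + ((A : ℤ) : ℂ) * ((l : ℂ) / 2) = (n : ℂ)) ∧
    ((¬ ∃ n : ℤ, -g < n ∧ n < g ∧ ρ + ((A : ℤ) : ℂ) * ((l : ℂ) / 2) = (n : ℂ)) →
      Nonempty ((FinMod A g ⊗[ℂ] IrrMod l ρ) ≃ₗ⁅ℂ, Spin31⁆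
        (⨁ ν : weights g,
          IrrMod (l + (ν : ℤ)) (ρ + ((A : ℤ) : ℂ) * (((ν : ℤ) : ℂ) / 2)))) ∧
      ∀ s t : ℂ,
        IsJointEigenvalue (casimir1 (FinMod A g ⊗[ℂ] IrrMod l ρ))
            (casimir2 (FinMod A g ⊗[ℂ] IrrMod l ρ)) s t ↔
          ∃ ν ∈ weights g,
            s = Complex.I * ((l : ℂ) / 2 + (ν : ℂ) / 2)
              * (ρ + ((A : ℤ) : ℂ) * ((ν : ℂ) / 2)) ∧
            t = ((l : ℂ) / 2 + (ν : ℂ) / 2) ^ 2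
              + (ρ + ((A : ℤ) : ℂ) * ((ν : ℂ) / 2)) ^ 2 - 1) ∧
    ((∃ n : ℤ, -g < n ∧ n < g ∧ ρ + ((A : ℤ) : ℂ) * ((l : ℂ) / 2) = (n : ℂ)) →
      ¬ Diagonalisable (casimir1 (FinMod A g ⊗[ℂ] IrrMod l ρ)) ∧
      ¬ Diagonalisable (casimir2 (FinMod A g ⊗[ℂ] IrrMod l ρ))) := by
  have h := nonTerminating_of_infinite hinf
  have hg' : 0 ≤ g := by omega
  refine ⟨⟨?_, fun hne => simultaneouslyDiagonalisable_tensor A hg' h hne⟩,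
    fun hne => ⟨(repIso_tensor_weights A hg' h hne).nonempty_lieModuleEquiv,
      isJointEigenvalue_tensor_iff A hg' h hne⟩, fun ⟨n, h1, h2, h3⟩ =>
        not_diagonalisable_casimir h h1 h2 h3⟩
  rintro ⟨ι, b, hb⟩ ⟨n, h1, h2, h3⟩
  refine (not_diagonalisable_casimir h h1 h2 h3).1 ⟨ι, b, fun i => ?_⟩
  obtain ⟨s, -, hs, -⟩ := hb i
  exact ⟨s, hs⟩
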